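/- Let $M=\{M(t)\}_{t\ge0}$ be a right-continuous continuous-time Markov chain with finite state space $\{1,\dots,r\}$, initial distribution $\pi$ and constant transition intensities $q_{i,j}\ge 0$ ($i\ne j$), and put $q_i=\sum_{j\ne i}q_{i,j}$. Let $\lambda_1,\dots,\lambda_r\ge 0$ and let $\gamma:[0,\infty)\to[0,\infty)$ be locally integrable (for instance of bounded variation on bounded intervals). Let $N_M$ be a right-continuous counting process with $N_M(0)=0$ such that, conditionally on the whole path of $M$, $N_M$ is a non-homogeneous Poisson process with intensity $\lambda_{M(t)}\gamma(t)$. (So $\{M,N_M\}$ is a Markov-modulated non-homogeneous Poisson process, MMNPP.) Fix $T>0$, let $0=u_0<u_1<u_2<\cdots$ be the jump times of $M$ capped at $T$, and call $[u_{k-1},u_k)$, for $u_{k-1}<T$, the $k$-th regime interval on $[0,T]$. (1) Conditionally on the path of $M$ and on $N_M(u_k)-N_M(u_{k-1})=z_k$, the successive arrival times $(T_{k,1},\dots,T_{k,z_k})$ in the $k$-th regime interval have joint density $$\frac{z_k!}{\left(\int_{u_{k-1}}^{u_k}\gamma(s)\,ds\right)^{z_k}}\prod_{i=1}^{z_k}\gamma(t_{k,i}),\qquad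 u_{k-1}<t_{k,1}<\cdots<t_{k,z_k}<u_k,$$ with respect to Lebesgue measure. Likewise, for deterministic $0\le a<b$, every state $s$ and every $z\ge 0$, given that $M(t)=s$ for all $t\in[a,b)$ and that $N_M(b)-N_M(a)=z$ (if this event has positive probability), the successive arrival times after $a$ up to $b$ have the joint density $z!\,\prod_{i=1}^z\gamma(t_i)\big/\left(\int_a^b\gamma\right)^z$ on $a<t_1<\cdots<t_z<b$. (2) Consequently the complete likelihood of the MMNPP on $[0,T]$ is as follows. For $m\ge0$, states $s_1,\dots,s_{m+1}$ with $s_k\ne s_{k+1}$ and counts $z_1,\dots,z_{m+1}\ge0$, on the event that $M$ has exactly $m$ jumps in $(0,T)$, visits the states $s_1,\dots,s_{m+1}$ in this order and $N_M$ has $z_k$ arrivals in the $k$-th regime for every $k$, the jump times and the arrival times have the joint (sub-probability) density, with $u_{m+1}=T$, $$\mathcal L^c=\pi_{s_1}\left\{\prod_{k=1}^{m}e^{-q_{s_k}(u_k-u_{k-1})}q_{s_k,s_{k+1}}\right\}e^{-q_{s_{m+1}}(T-u_m)}\prod_{k=1}^{m+1}\left[\lambda_{s_k}^{z_k}\exp\left(-\int_{u_{k-1}}^{u_k}\lambda_{s_k}\gamma(t)\,dt\right)\prod_{i=1}^{z_k}\gamma(t_{k,i})\right]$$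 on $\{0<u_1<\cdots<u_m<T,\ u_{k-1}<t_{k,1}<\cdots<t_{k,z_k}<u_k\ (1\le k\le m+1)\}$, with respect to Lebesgue measure. -/

import Mathlib

open MeasureTheory ProbabilityTheory Set

noncomputable section

namespace MMNPP

variable {Ω : Type*} {r : ℕ}

/-- The total exit rate `q_i = ∑_{j ≠ i} q_{i,j}` of state `i`; the diagonal of `q` is never used. -/
def exitRate (q : Fin r → Fin r → ℝ) (i : Fin r) : ℝ := ∑ j ∈ Finset.univ.erase i, q i j

/-- The successive jump times of the path `t ↦ M t ω`: the `0`-th is `0` and the `(n+1)`-st is the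
infimum of the times after the `n`-th at which the state differs from the state at the `n`-th
(`⊤` if the path makes no further jump). -/
def jumpTime (M : ℝ → Ω → Fin r) (ω : Ω) : ℕ → EReal
  | 0 => 0
  | n + 1 => sInf ((fun t : ℝ => (t : EReal)) ''
      {t : ℝ | jumpTime M ω n ≤ (t : EReal) ∧ M t ω ≠ M (jumpTime M ω n).toReal ω})

/-- The `k`-th regime boundary on the observation window `[0, T]`: the `k`-th jump time, capped
at `T`. The regimes are the nonempty ones among `[regimeTime M T k ω, regimeTime M T (k+1) ω)`. -/
def regimeTime (M : ℝ → Ω → Fin r) (T : ℝ) (k : ℕ) (ω : Ω) : ℝ :=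
  (min (jumpTime M ω k) (T : EReal)).toReal

/-- The `(i+1)`-st arrival time of the counting process `N` after time `a`, for `i = 0, 1, …`. -/
def arrivalTime (N : ℝ → Ω → ℕ) (a : ℝ) (i : ℕ) (ω : Ω) : ℝ :=
  sInf {t : ℝ | a ≤ t ∧ N a ω + (i + 1) ≤ N t ω}

/-- The first `z` arrival times after time `a`. -/
def arrivals (N : ℝ → Ω → ℕ) (a : ℝ) (z : ℕ) (ω : Ω) : Fin z → ℝ :=
  fun i => arrivalTime N a i ω

/-- The σ-algebra generated by the whole path of `M` on `[0, ∞)`. -/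
abbrev pathSigma (M : ℝ → Ω → Fin r) : MeasurableSpace Ω :=
  ⨆ t : {t : ℝ // 0 ≤ t}, MeasurableSpace.comap (M t) inferInstance

/-- `M` is a right-continuous Markov chain in continuous time with initial distribution `π` and
transition intensities `q i j` (`i ≠ j`), through its jump chain and holding times: from state `i`
the chain holds for an exponential time of rate `q_i` and then moves to `j ≠ i` with probability
`q i j / q_i`, independently of the past. The condition `jumpTime k + h k < jumpTime (k+1)` says
that the `k`-th jump time is finite and the holding time following it exceeds `h k`. -/
structure IsMarkovChain [MeasurableSpace Ω] (P : Measure Ω) (π : Fin r → ℝ)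
    (q : Fin r → Fin r → ℝ) (M : ℝ → Ω → Fin r) : Prop where
  measurable : ∀ t, 0 ≤ t → Measurable (M t)
  rightCont : ∀ ω t, 0 ≤ t → ContinuousWithinAt (fun x => M x ω) (Ici t) t
  law : ∀ (n : ℕ) (i : ℕ → Fin r) (h : ℕ → ℝ), (∀ k, 0 ≤ h k) → (∀ k < n, i k ≠ i (k + 1)) →
    P {ω | ∀ k ≤ n, M (jumpTime M ω k).toReal ω = i k ∧
        jumpTime M ω k + (h k : EReal) < jumpTime M ω (k + 1)} =
      ENNReal.ofReal (π (i 0) *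
        (∏ k ∈ Finset.range n, Real.exp (-(exitRate q (i k) * h k)) *
          (q (i k) (i (k + 1)) / exitRate q (i k))) *
        Real.exp (-(exitRate q (i n) * h n)))

/-- The pair `(M, N)` is a Markov-modulated non-homogeneous Poisson process: `M` is a finite-state
Markov chain, `N` is a right-continuous counting process started at `0`, and conditionally on the
path of `M` the increments of `N` over consecutive intervals are independent and Poisson, with mean
the integral of `λ_{M(x)} γ(x)`. -/
structure IsMMNPP [MeasurableSpace Ω] (P : Measure Ω) (π : Fin r → ℝ)
    (q : Fin r → Fin r → ℝ) (lam : Fin r → ℝ) (γ : ℝ → ℝ)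
    (M : ℝ → Ω → Fin r) (N : ℝ → Ω → ℕ) : Prop where
  chain : IsMarkovChain P π q M
  measurable : ∀ t, 0 ≤ t → Measurable (N t)
  zero : ∀ ω, N 0 ω = 0
  mono : ∀ ω, MonotoneOn (fun t => N t ω) (Ici 0)
  rightCont : ∀ ω t, 0 ≤ t → ContinuousWithinAt (fun x => N x ω) (Ici t) t
  condPoisson : ∀ (n : ℕ) (a : ℕ → ℝ) (z : ℕ → ℕ), 0 ≤ a 0 → Monotone a →
    P⟦{ω | ∀ k < n, N (a (k + 1)) ω = N (a k) ω + z k} | pathSigma M⟧ =ᵐ[P]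
      fun ω => ∏ k ∈ Finset.range n,
        Real.exp (-∫ x in (a k)..(a (k + 1)), lam (M x ω) * γ x) *
          (∫ x in (a k)..(a (k + 1)), lam (M x ω) * γ x) ^ z k / (z k).factorial

/-- The ordered configurations `a < t_1 < ⋯ < t_z < b`. -/
def orderedTimes (z : ℕ) (a b : ℝ) : Set (Fin z → ℝ) :=
  {t | StrictMono t ∧ ∀ i, t i ∈ Ioo a b}

/-- The function `z! ∏ γ(t_i) / (∫_a^b γ)^z`. -/
def arrivalDensity (γ : ℝ → ℝ) (a b : ℝ) (z : ℕ) (t : Fin z → ℝ) : ℝ :=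
  (z.factorial : ℝ) / (∫ x in a..b, γ x) ^ z * ∏ i, γ (t i)

/-- The points `0 = u_0, u_1, …, u_m, u_{m+1} = T` (and `T` from then on). -/
def knot (T : ℝ) {m : ℕ} (u : Fin m → ℝ) : ℕ → ℝ
  | 0 => 0
  | k + 1 => if h : k < m then u ⟨k, h⟩ else T

/-- The possible values of the regime change times and of the arrival times in each regime:
`0 = u_0 < u_1 < ⋯ < u_m < u_{m+1} = T` and `u_k < t_{k,1} < ⋯ < t_{k,z_k} < u_{k+1}` for each
regime, the regimes being numbered `0, …, m`. -/
def configurations (T : ℝ) (m : ℕ) (z : Fin (m + 1) → ℕ) :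
    Set ((Fin m → ℝ) × ((k : Fin (m + 1)) → Fin (z k) → ℝ)) :=
  {p | (∀ k : Fin (m + 1), knot T p.1 k < knot T p.1 (k + 1)) ∧
    ∀ k : Fin (m + 1), p.2 k ∈ orderedTimes (z k) (knot T p.1 k) (knot T p.1 (k + 1))}

/-- The complete likelihood of the regimes `s`, the regime change times `u` and the arrival times
`t`, with `z k` arrivals in the `k`-th regime. -/
def completeLikelihood (π : Fin r → ℝ) (q : Fin r → Fin r → ℝ) (lam : Fin r → ℝ) (γ : ℝ → ℝ)
    (T : ℝ) {m : ℕ} (s : Fin (m + 1) → Fin r) (z : Fin (m + 1) → ℕ)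
    (u : Fin m → ℝ) (t : (k : Fin (m + 1)) → Fin (z k) → ℝ) : ℝ :=
  π (s 0) *
    (∏ k : Fin m, Real.exp (-(exitRate q (s k.castSucc) * (knot T u (k + 1) - knot T u k))) *
      q (s k.castSucc) (s k.succ)) *
    Real.exp (-(exitRate q (s (Fin.last m)) * (T - knot T u m))) *
    ∏ k : Fin (m + 1), (lam (s k) ^ z k *
      Real.exp (-∫ x in (knot T u k)..(knot T u (k + 1)), lam (s k) * γ x) *
      ∏ i, γ (t k i))

/-- The number of arrivals in the `k`-th regime interval on the window `[0, T]`. -/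
def regimeCount (M : ℝ → Ω → Fin r) (N : ℝ → Ω → ℕ) (T : ℝ) (k : ℕ) (ω : Ω) : ℕ :=
  N (regimeTime M T (k + 1) ω) ω - N (regimeTime M T k ω) ω

/-- The first `z` arrival times after the start of the `k`-th regime on the window `[0, T]`. -/
def regimeArrivals (M : ℝ → Ω → Fin r) (N : ℝ → Ω → ℕ) (T : ℝ) (k z : ℕ) (ω : Ω) : Fin z → ℝ :=
  arrivals N (regimeTime M T k ω) z ω

end MMNPP

end

noncomputable section

/-! ### Product measures, ordered simplices and ordered boxes. -/

namespace MMNPP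

/-! The hypothesis on `N` only concerns increments between deterministic times, while regimes are
bounded by random times. Since these times depend on the path of `M` alone, they can be approximated
from the right by times with countably many values; on each piece where those values are fixed the
hypothesis applies, and right-continuity of `N` together with continuity of the cumulated rate
allows passage to the limit. This is `IsMMNPP.measure_grid`: given the path, increments over a
path-measurable random grid are independent Poisson variables.

Suppose `M` stays in state `s` on `[U, V)`. For ordered disjoint intervals `(c_i, d_i]` inside it,
having exactly `z` arrivals with the `i`-th in the `i`-th interval means increment one on each
interval and zero on each gap. The Poisson factors multiply to `exp(-λ_s ∫γ) λ_s^z ∏ ∫_{c_i}^{d_i}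
γ`, which is `exp(-λ_s ∫γ) λ_s^z` times the mass of the box for the product of the measures `γ(x)
dx`. Rational boxes cover the increasing vectors, so this identifies the whole law
(`measure_eq_of_orderedBox`, `PoissonAfter.arrivals`). By symmetry the ordered simplex has mass
`(∫γ)^z / z!` (`factorial_mul_pi_strictMono`); dividing by the probability of `z` arrivals cancels
both the exponential and `λ_s^z`, which leaves the conditional density of (1).

For (2), `PoissonAfter` is an invariant carried from one regime to the next: past a path-measurable
time the process is still conditionally Poisson, and each regime multiplies the conditional weight
by one factor `segmentWeight`. The chain itself contributes independent exponential holding times,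
the last one censored. Their partial sums are the jump times, and taking partial sums preserves
volume, which gives `IsMarkovChain.measure_regimeTimes`. Integrating the product of weights against
this density, and comparing with Tonelli's theorem for the claimed likelihood, gives equality on
rectangles, hence on all measurable sets. -/

/-- Tonelli's theorem for a product of functions of the separate coordinates. -/
theorem lintegral_fin_prod_eq_prod {n : ℕ} {α : Fin n → Type*} [∀ i, MeasurableSpace (α i)]
    (μ : ∀ i, Measure (α i)) [∀ i, SigmaFinite (μ i)] (f : ∀ i, α i → ENNReal)
    (hf : ∀ i, Measurable (f i)) :
    ∫⁻ x, ∏ i, f i (x i) ∂Measure.pi μ = ∏ i, ∫⁻ x, f i x ∂μ i := by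
  induction n with
  | zero => simp
  | succ n ih =>
    have hmp := (measurePreserving_piFinSuccAbove μ 0).symm
    rw [← hmp.lintegral_comp_emb (MeasurableEquiv.measurableEmbedding _)]
    have h2 := ih (fun i => μ i.succ) (fun i => f i.succ) (fun i => hf _)
    rw [Fin.prod_univ_succ, ← h2]
    refine Eq.trans ?_ (lintegral_prod_mul (μ := μ 0) (ν := Measure.pi fun i : Fin n => μ i.succ)
      (hf 0).aemeasurable (g := fun y => ∏ i : Fin n, f i.succ (y i)) ?_)
    · refine lintegral_congr fun a => ?_
      rw [Fin.prod_univ_succ]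
      rfl
    · exact (Finset.measurable_prod _ fun i _ => (hf _).comp (measurable_pi_apply i)).aemeasurable

/-- A product of finitely many measures with densities has the product density. -/
theorem pi_withDensity_fin {n : ℕ} {α : Fin n → Type*} [∀ i, MeasurableSpace (α i)]
    (μ : ∀ i, Measure (α i)) [∀ i, SigmaFinite (μ i)] (f : ∀ i, α i → ENNReal)
    (hf : ∀ i, AEMeasurable (f i) (μ i)) [∀ i, SigmaFinite ((μ i).withDensity (f i))] :
    Measure.pi (fun i => (μ i).withDensity (f i)) =
      (Measure.pi μ).withDensity (fun x => ∏ i, f i (x i)) := by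
  have hae : (fun x : ∀ i, α i => ∏ i, f i (x i)) =ᵐ[Measure.pi μ]
      fun x => ∏ i, (hf i).mk (f i) (x i) := by
    filter_upwards [Measure.ae_eq_pi (fun i => (hf i).ae_eq_mk)] with x hx
    exact Finset.prod_congr rfl fun i _ => congrFun hx i
  rw [withDensity_congr_ae hae]
  refine Measure.pi_eq fun s hs => ?_
  rw [withDensity_apply _ (MeasurableSet.univ_pi hs),
    ← lintegral_indicator (MeasurableSet.univ_pi hs)]
  have : ∀ x : ∀ i, α i, (univ.pi s).indicator (fun x => ∏ i, (hf i).mk (f i) (x i)) x =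
      ∏ i, (s i).indicator ((hf i).mk (f i)) (x i) := by
    intro x
    by_cases hx : x ∈ univ.pi s
    · rw [indicator_of_mem hx]
      exact Finset.prod_congr rfl fun i _ => (indicator_of_mem (hx i trivial) _).symm
    · rw [indicator_of_notMem hx]
      simp only [mem_univ_pi, not_forall] at hx
      obtain ⟨i, hi⟩ := hx
      exact (Finset.prod_eq_zero (Finset.mem_univ i) (indicator_of_notMem hi _)).symm
  rw [lintegral_congr this,
    lintegral_fin_prod_eq_prod μ _ fun i => ((hf i).measurable_mk).indicator (hs i)]
  refine Finset.prod_congr rfl fun i _ => ?_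
  rw [lintegral_indicator (hs i), withDensity_apply _ (hs i)]
  exact lintegral_congr_ae (ae_restrict_of_ae (hf i).ae_eq_mk.symm)

/-- Almost every point of `ℝ^z` has distinct coordinates. -/
theorem ae_injective_volume (z : ℕ) :
    ∀ᵐ t : Fin z → ℝ, Function.Injective t := by
  have : ∀ i j : Fin z, i ≠ j → ∀ᵐ t : Fin z → ℝ, t i ≠ t j := by
    intro i j hij
    let E : Submodule ℝ (Fin z → ℝ) :=
      LinearMap.ker (LinearMap.proj (R := ℝ) (φ := fun _ : Fin z => ℝ) i - LinearMap.proj j)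
    have hE : E ≠ ⊤ := by
      intro h
      have : (Pi.single i (1 : ℝ) : Fin z → ℝ) ∈ E := h ▸ Submodule.mem_top
      simp [E, hij.symm] at this
    have := Measure.addHaar_submodule (volume : Measure (Fin z → ℝ)) E hE
    rw [ae_iff]
    refine measure_mono_null ?_ this
    intro t ht
    simp only [ne_eq, not_not, mem_ofPred_eq] at ht
    simp [E, ht]
  have h2 : ∀ᵐ t : Fin z → ℝ, ∀ i j : Fin z, i ≠ j → t i ≠ t j := by
    simp only [ae_all_iff]
    exact this
  filter_upwards [h2] with t ht i j hij
  by_contra h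
  exact ht i j h hij

theorem measurableSet_strictMono (z : ℕ) : MeasurableSet {t : Fin z → ℝ | StrictMono t} := by
  have : {t : Fin z → ℝ | StrictMono t} = ⋂ (i : Fin z) (j : Fin z) (_ : i < j),
      {t : Fin z → ℝ | t i < t j} := by
    ext t
    simp [StrictMono]
  rw [this]
  exact MeasurableSet.iInter fun i => MeasurableSet.iInter fun j => MeasurableSet.iInter fun _ =>
    measurableSet_lt (measurable_pi_apply i) (measurable_pi_apply j)

/-- The ordered simplex carries a fraction `1 / z!` of a power of a diffuse measure. -/
theorem factorial_mul_pi_strictMono (κ : Measure ℝ) [SigmaFinite κ] (z : ℕ)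
    (hκ : Measure.pi (fun _ : Fin z => κ) ≪ volume) :
    (z.factorial : ENNReal) * Measure.pi (fun _ : Fin z => κ) {t | StrictMono t} = κ univ ^ z := by
  set μ := Measure.pi (fun _ : Fin z => κ)
  -- Permuting coordinates preserves a power of one measure, so all `z!` orderings have the same
  -- mass.
  have hperm : ∀ σ : Equiv.Perm (Fin z), μ {t | StrictMono (t ∘ σ)} = μ {t | StrictMono t} := by
    intro σ
    have := measurePreserving_piCongrLeft (fun _ : Fin z => κ) σ.symm
    rw [← this.measure_preimage (measurableSet_strictMono z).nullMeasurableSet]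
    congr 1
    ext t
    simp only [mem_ofPred_eq, mem_preimage]
    have : (MeasurableEquiv.piCongrLeft (fun _ : Fin z => ℝ) σ.symm) t = t ∘ σ := by
      funext i
      have := MeasurableEquiv.piCongrLeft_apply_apply (β := fun _ : Fin z => ℝ) σ.symm t (σ i)
      simpa using this
    rw [this]
  have hmeas : ∀ σ : Equiv.Perm (Fin z), MeasurableSet {t : Fin z → ℝ | StrictMono (t ∘ σ)} := by
    intro σ
    have h : Measurable fun t : Fin z → ℝ => t ∘ σ :=
      measurable_pi_lambda _ fun i => measurable_pi_apply (σ i)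
    exact h (measurableSet_strictMono z)
  have hU : μ (⋃ σ : Equiv.Perm (Fin z), {t | StrictMono (t ∘ σ)}) = κ univ ^ z := by
    have : μ (⋃ σ : Equiv.Perm (Fin z), {t | StrictMono (t ∘ σ)}) = μ univ := by
      refine measure_congr ?_
      rw [Filter.eventuallyEq_univ]
      filter_upwards [hκ.ae_le (ae_injective_volume z)] with t ht
      rw [mem_iUnion]
      exact ⟨Tuple.sort t, (Tuple.monotone_sort t).strictMono_of_injective
        (ht.comp (Tuple.sort t).injective)⟩
    rw [this, Measure.pi_univ]
    simp
  rw [← hU, measure_iUnion _ hmeas, tsum_congr hperm, tsum_fintype]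
  · simp [Fintype.card_perm]
  -- Two permutations that sort the same vector produce the same sorted vector, and a vector with
  -- distinct entries determines its sorting permutation.
  · intro σ τ hne
    rw [Function.onFun, Set.disjoint_left]
    intro t h1 h2
    apply hne
    have e1 : t ∘ σ = t ∘ Tuple.sort t := by
      have := Tuple.comp_sort_eq_comp_iff_monotone (f := t) (σ := σ)
      exact (this.2 h1.monotone)
    have e2 : t ∘ τ = t ∘ Tuple.sort t := by
      have := Tuple.comp_sort_eq_comp_iff_monotone (f := t) (σ := τ)
      exact (this.2 h2.monotone)
    have hinj : Function.Injective t := by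
      have := h1.injective
      exact (Equiv.injective_comp σ t).1 this
    ext i
    have := congrFun (e1.trans e2.symm) i
    exact congrArg _ (hinj this)

theorem measurableSet_orderedTimes (z : ℕ) (a b : ℝ) : MeasurableSet (orderedTimes z a b) := by
  have : orderedTimes z a b = {t | StrictMono t} ∩ univ.pi fun _ => Ioo a b := by
    ext t; simp [orderedTimes]
  rw [this]
  exact (measurableSet_strictMono z).inter (MeasurableSet.univ_pi fun _ => measurableSet_Ioo)

/-- Ordered products of half-open intervals. -/
def orderedBox (z : ℕ) (c d : ℕ → ℝ) : Set (Fin z → ℝ) := {t | ∀ i : Fin z, t i ∈ Ioc (c i) (d i)}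

theorem measurableSet_orderedBox (z : ℕ) (c d : ℕ → ℝ) : MeasurableSet (orderedBox z c d) := by
  have : orderedBox z c d = univ.pi fun i : Fin z => Ioc (c i) (d i) := by
    ext t; simp [orderedBox]
  rw [this]
  exact MeasurableSet.univ_pi fun _ => measurableSet_Ioc

theorem isPiSystem_pi_Iic (z : ℕ) :
    IsPiSystem (univ.pi '' univ.pi fun _ : Fin z => range (Iic : ℝ → Set ℝ)) :=
  IsPiSystem.pi fun _ => isPiSystem_Iic

theorem generateFrom_pi_Iic (z : ℕ) :
    (inferInstance : MeasurableSpace (Fin z → ℝ)) =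
      MeasurableSpace.generateFrom (univ.pi '' univ.pi fun _ : Fin z => range (Iic : ℝ → Set ℝ)) := by
  rw [← generateFrom_pi_eq]
  · rw [← borel_eq_generateFrom_Iic, ← BorelSpace.measurable_eq (α := ℝ)]
  · intro i
    refine ⟨fun n : ℕ => Iic (n : ℝ), fun n => ⟨n, rfl⟩, ?_⟩
    rw [eq_univ_iff_forall]
    intro x
    obtain ⟨n, hn⟩ := exists_nat_ge x
    exact mem_iUnion.2 ⟨n, hn⟩

/-- Two finite measures on `ℝ^z` of the same mass, one of which lives on increasing vectors, agree
as soon as they agree on ordered boxes. -/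
theorem measure_eq_of_orderedBox {z : ℕ} (μ ν : Measure (Fin z → ℝ)) [IsFiniteMeasure μ]
    (hν : ν {t | StrictMono t}ᶜ = 0) (hmass : μ univ = ν univ)
    (hbox : ∀ c d : ℕ → ℝ, (∀ i < z, c i ≤ d i) → (∀ i, i + 1 < z → d i ≤ c (i + 1)) →
      μ (orderedBox z c d) = ν (orderedBox z c d)) : μ = ν := by
  have : IsFiniteMeasure ν := ⟨by rw [← hmass]; exact measure_lt_top _ _⟩
  -- Rational endpoints keep the family of boxes countable, so that equality of the restrictions
  -- passes to their union; the boxes need not be disjoint.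
  let I := {p : (Fin z → ℚ) × (Fin z → ℚ) // (∀ i, p.1 i ≤ p.2 i) ∧ ∀ i j, i < j → p.2 i ≤ p.1 j}
  let ext : (Fin z → ℝ) → ℕ → ℝ := fun f n => if h : n < z then f ⟨n, h⟩ else 0
  let Q : I → Set (Fin z → ℝ) := fun p =>
    orderedBox z (ext fun i => p.1.1 i) (ext fun i => p.1.2 i)
  have hQ : ∀ p, μ.restrict (Q p) = ν.restrict (Q p) := by
    rintro ⟨p, hp1, hp2⟩
    -- Cutting an ordered box by lower half-lines gives either an ordered box again or the empty
    -- set. This makes the π-system of products of `Iic` sufficient inside each box.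
    have hb : ∀ b : Fin z → ℝ, μ (univ.pi (fun i => Iic (b i)) ∩ Q ⟨p, hp1, hp2⟩) =
        ν (univ.pi (fun i => Iic (b i)) ∩ Q ⟨p, hp1, hp2⟩) := by
      intro b
      by_cases hb : ∀ i, (p.1 i : ℝ) ≤ b i
      · have : univ.pi (fun i => Iic (b i)) ∩ Q ⟨p, hp1, hp2⟩ =
            orderedBox z (ext fun i => p.1 i) (ext fun i => min (p.2 i : ℝ) (b i)) := by
          ext t
          simp only [orderedBox, Q, ext, mem_inter_iff, mem_univ_pi, mem_Iic, mem_ofPred_eq, mem_Ioc,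
            Fin.is_lt, dif_pos, Fin.eta, le_min_iff]
          exact ⟨fun h i => ⟨(h.2 i).1, (h.2 i).2, h.1 i⟩,
            fun h => ⟨fun i => (h i).2.2, fun i => ⟨(h i).1, (h i).2.1⟩⟩⟩
        rw [this]
        apply hbox
        · intro i hi
          simp only [ext, hi, dif_pos]
          exact le_min (by exact_mod_cast hp1 _) (hb _)
        · intro i hi
          simp only [ext, hi, (Nat.lt_succ_self i).trans hi, dif_pos]
          refine (min_le_left _ _).trans ?_
          have := hp2 ⟨i, (Nat.lt_succ_self i).trans hi⟩ ⟨i + 1, hi⟩ (by simp)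
          exact_mod_cast this
      · have : univ.pi (fun i => Iic (b i)) ∩ Q ⟨p, hp1, hp2⟩ = ∅ := by
          push Not at hb
          obtain ⟨i, hi⟩ := hb
          rw [eq_empty_iff_forall_notMem]
          rintro t ⟨h1, h2⟩
          have h1' := h1 i trivial
          have h2' := (h2 i).1
          simp only [ext, Fin.is_lt, dif_pos, Fin.eta, mem_Iic] at h1' h2'
          linarith
        rw [this, measure_empty, measure_empty]
    refine ext_of_generate_finite _ (generateFrom_pi_Iic z) (isPiSystem_pi_Iic z) ?_ ?_
    · rintro _ ⟨s, hs, rfl⟩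
      choose b hb' using fun i => hs i trivial
      obtain rfl : (fun i => Iic (b i)) = s := funext hb'
      rw [Measure.restrict_apply (MeasurableSet.univ_pi fun _ => measurableSet_Iic),
        Measure.restrict_apply (MeasurableSet.univ_pi fun _ => measurableSet_Iic)]
      exact hb b
    · rw [Measure.restrict_apply_univ, Measure.restrict_apply_univ]
      have := hb fun i => p.2 i
      rwa [inter_eq_right.2] at this
      intro t ht i _
      have := (ht i).2
      simpa [ext] using this
  have hcover : {t : Fin z → ℝ | StrictMono t} ⊆ ⋃ p, Q p := by
    intro t ht
    cases z with
    | zero => exact mem_iUnion.2 ⟨⟨⟨Fin.elim0, Fin.elim0⟩, fun i => Fin.elim0 i, fun i => Fin.elim0 i⟩,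
        fun i => Fin.elim0 i⟩
    | succ z =>
      -- A rational `c (i + 1)` is placed strictly between consecutive coordinates and serves both
      -- as upper end of side `i` and as lower end of side `i + 1`; `c 0` lies below the first
      -- coordinate, and the last side ends at a separate rational.
      have hc : ∃ c : ℕ → ℚ, ∀ i : ℕ, (∀ h : i < z + 1, (c i : ℝ) < t ⟨i, h⟩) ∧
          ∀ h : i + 1 < z + 1, t ⟨i, (Nat.lt_succ_self i).trans h⟩ < c (i + 1) := by
        have h0 : ∃ q : ℚ, (q : ℝ) < t 0 := exists_rat_lt _
        have h1 : ∀ i : ℕ, ∃ q : ℚ, ∀ h : i + 1 < z + 1, (q : ℝ) < t ⟨i + 1, h⟩ ∧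
            t ⟨i, (Nat.lt_succ_self i).trans h⟩ < q := by
          intro i
          by_cases h : i + 1 < z + 1
          · obtain ⟨q, hq1, hq2⟩ := exists_rat_btwn (ht (show
              (⟨i, (Nat.lt_succ_self i).trans h⟩ : Fin (z + 1)) < ⟨i + 1, h⟩ by simp))
            exact ⟨q, fun _ => ⟨hq2, hq1⟩⟩
          · exact ⟨0, fun h' => absurd h' h⟩
        obtain ⟨q, hq⟩ := h0
        choose g hg using h1
        refine ⟨fun n => Nat.casesOn n q g, fun i => ⟨?_, ?_⟩⟩
        · cases i with
          | zero => intro _; exact hq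
          | succ i => intro h; exact (hg i h).1
        · intro h; exact (hg i h).2
      obtain ⟨c, hc⟩ := hc
      obtain ⟨q, hq⟩ := exists_rat_gt (t (Fin.last z))
      let d : Fin (z + 1) → ℚ := fun i => if (i : ℕ) + 1 < z + 1 then c (i + 1) else q
      have hcd : ∀ i : Fin (z + 1), (c i : ℝ) < t i ∧ t i < d i := by
        intro i
        refine ⟨(hc i).1 i.2, ?_⟩
        by_cases h : (i : ℕ) + 1 < z + 1
        · simp only [d, h, if_true]
          exact (hc i).2 h
        · simp only [d, h, if_false]
          have : i = Fin.last z := by ext; simp; omega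
          rw [this]; exact hq
      refine mem_iUnion.2 ⟨⟨⟨fun i => c i, d⟩, fun i => ?_, fun i j hij => ?_⟩, fun i => ?_⟩
      · exact_mod_cast ((hcd i).1.trans (hcd i).2).le
      · have h : (i : ℕ) + 1 < z + 1 := by
          have : (i : ℕ) < j := hij
          omega
        simp only [d, h, if_true]
        have key : ∀ k : ℕ, (i : ℕ) + 1 + k < z + 1 → c (i + 1) ≤ c (i + 1 + k) := by
          intro k
          induction k with
          | zero => intro _; exact le_rfl
          | succ k ih =>
            intro hk
            refine (ih (by omega)).trans ?_
            have h1 := (hc (i + 1 + k)).1 (by omega)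
            have h2 := (hc (i + 1 + k)).2 (by omega)
            exact_mod_cast (h1.trans h2).le
        have := key (j - (i + 1)) (by have : (i : ℕ) < j := hij; omega)
        rwa [show (i : ℕ) + 1 + (j - (i + 1)) = j by have : (i : ℕ) < j := hij; omega] at this
      · have := hcd i
        simp only [ext, Fin.is_lt, dif_pos, Fin.eta]
        exact ⟨this.1, this.2.le⟩
  have hO : μ.restrict {t | StrictMono t} = ν.restrict {t | StrictMono t} := by
    have h1 : μ.restrict (⋃ p, Q p) = ν.restrict (⋃ p, Q p) :=
      Measure.restrict_iUnion_congr.2 hQ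
    have h2 := congrArg (fun ρ : Measure (Fin z → ℝ) => ρ.restrict {t | StrictMono t}) h1
    simp only [Measure.restrict_restrict (measurableSet_strictMono z)] at h2
    rwa [inter_eq_left.2 hcover] at h2
  -- The measures agree on the increasing vectors and in total mass, hence on the complement, where
  -- `ν` vanishes.
  have hμ : μ {t | StrictMono t}ᶜ = 0 := by
    have h1 := congrArg (fun ρ : Measure (Fin z → ℝ) => ρ univ) hO
    simp only [Measure.restrict_apply_univ] at h1
    rw [measure_compl (measurableSet_strictMono z) (measure_ne_top _ _), h1, hmass,
      ← measure_compl (measurableSet_strictMono z) (measure_ne_top _ _), hν]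
  calc μ = μ.restrict {t | StrictMono t} := by
        rw [Measure.restrict_eq_self_of_ae_mem]
        exact hμ
    _ = ν.restrict {t | StrictMono t} := hO
    _ = ν := by
        rw [Measure.restrict_eq_self_of_ae_mem]
        exact hν

/-! ### The intensity measure `γ(x) dx` and its powers. -/

/-- The density `γ` on `[0, ∞)`, extended by zero, with values in `[0, ∞]`. -/
def rateDensity (γ : ℝ → ℝ) (x : ℝ) : ENNReal := ENNReal.ofReal ((Ici 0).indicator γ x)

/-- The measure `γ(x) dx` on `[0, ∞)`. -/
def rateMeasure (γ : ℝ → ℝ) : Measure ℝ := volume.withDensity (rateDensity γ)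

section rate
variable {γ : ℝ → ℝ}

theorem aemeasurable_indicator_rate (hγi : LocallyIntegrableOn γ (Ici 0)) :
    AEMeasurable ((Ici 0).indicator γ) volume :=
  (aemeasurable_indicator_iff measurableSet_Ici).2 hγi.aestronglyMeasurable.aemeasurable

theorem aemeasurable_rateDensity (hγi : LocallyIntegrableOn γ (Ici 0)) :
    AEMeasurable (rateDensity γ) volume :=
  (aemeasurable_indicator_rate hγi).ennreal_ofReal

instance sigmaFinite_rateMeasure : SigmaFinite (rateMeasure γ) :=
  SigmaFinite.withDensity_of_ne_top' fun _ => ENNReal.ofReal_ne_top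

theorem rate_integrableOn_Ioc (hγi : LocallyIntegrableOn γ (Ici 0)) {a b : ℝ} (ha : 0 ≤ a) :
    IntegrableOn γ (Ioc a b) := by
  refine IntegrableOn.mono_set ?_ Ioc_subset_Icc_self
  exact hγi.integrableOn_compact_subset (fun x hx => ha.trans hx.1) isCompact_Icc

theorem rate_intervalIntegrable (hγi : LocallyIntegrableOn γ (Ici 0)) {a b : ℝ} (ha : 0 ≤ a)
    (hb : 0 ≤ b) : IntervalIntegrable γ volume a b :=
  ⟨rate_integrableOn_Ioc hγi ha, rate_integrableOn_Ioc hγi hb⟩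

theorem rateMeasure_Ioc (hγ : ∀ x, 0 ≤ x → 0 ≤ γ x) (hγi : LocallyIntegrableOn γ (Ici 0)) {a b : ℝ}
    (ha : 0 ≤ a) (hab : a ≤ b) : rateMeasure γ (Ioc a b) = ENNReal.ofReal (∫ x in a..b, γ x) := by
  rw [rateMeasure, withDensity_apply _ measurableSet_Ioc, intervalIntegral.integral_of_le hab,
    ofReal_integral_eq_lintegral_ofReal (rate_integrableOn_Ioc hγi ha)]
  · refine setLIntegral_congr_fun measurableSet_Ioc fun x hx => ?_
    have : x ∈ Ici (0 : ℝ) := ha.trans hx.1.le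
    simp only [rateDensity, indicator_of_mem this]
  · exact (ae_restrict_iff' measurableSet_Ioc).2 (Filter.Eventually.of_forall fun x hx =>
      hγ x (ha.trans hx.1.le))

theorem rateMeasure_absolutelyContinuous : rateMeasure γ ≪ volume :=
  withDensity_absolutelyContinuous _ _

theorem rateMeasure_Ioo (hγ : ∀ x, 0 ≤ x → 0 ≤ γ x) (hγi : LocallyIntegrableOn γ (Ici 0)) {a b : ℝ}
    (ha : 0 ≤ a) (hab : a ≤ b) : rateMeasure γ (Ioo a b) = ENNReal.ofReal (∫ x in a..b, γ x) := by
  rw [← rateMeasure_Ioc hγ hγi ha hab]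
  exact measure_congr (rateMeasure_absolutelyContinuous.ae_le Ioo_ae_eq_Ioc)

theorem pi_rateMeasure (hγi : LocallyIntegrableOn γ (Ici 0)) (z : ℕ) :
    Measure.pi (fun _ : Fin z => rateMeasure γ) =
      volume.withDensity fun t => ∏ i, rateDensity γ (t i) := by
  exact @pi_withDensity_fin z (fun _ => ℝ) _ (fun _ => volume) _ (fun _ => rateDensity γ)
    (fun _ => aemeasurable_rateDensity hγi) (fun _ => sigmaFinite_rateMeasure)

/-- The symmetry argument, applied to the intensity measure restricted to `Ioo a b`; absolute
continuity ensures that ties between coordinates are negligible. -/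
theorem factorial_mul_pi_orderedTimes (hγ : ∀ x, 0 ≤ x → 0 ≤ γ x)
    (hγi : LocallyIntegrableOn γ (Ici 0)) {a b : ℝ} (ha : 0 ≤ a) (hab : a ≤ b) (z : ℕ) :
    (z.factorial : ENNReal) * Measure.pi (fun _ : Fin z => rateMeasure γ) (orderedTimes z a b) =
      ENNReal.ofReal ((∫ x in a..b, γ x) ^ z) := by
  have h0 : 0 ≤ ∫ x in a..b, γ x := intervalIntegral.integral_nonneg hab fun x hx =>
    hγ x (ha.trans hx.1)
  rw [ENNReal.ofReal_pow h0, ← rateMeasure_Ioo hγ hγi ha hab]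
  have hr := Measure.restrict_pi_pi (fun _ : Fin z => rateMeasure γ) (fun _ => Ioo a b)
  have hac : Measure.pi (fun _ : Fin z => (rateMeasure γ).restrict (Ioo a b)) ≪ volume := by
    rw [← hr, pi_rateMeasure hγi]
    exact Measure.absolutelyContinuous_of_le Measure.restrict_le_self |>.trans
      (withDensity_absolutelyContinuous _ _)
  have := factorial_mul_pi_strictMono ((rateMeasure γ).restrict (Ioo a b)) z hac
  rw [Measure.restrict_apply_univ, ← hr, Measure.restrict_apply (measurableSet_strictMono z)] at this
  rw [← this]
  congr 2
  ext t
  simp [orderedTimes]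

theorem pi_orderedTimes (hγ : ∀ x, 0 ≤ x → 0 ≤ γ x)
    (hγi : LocallyIntegrableOn γ (Ici 0)) {a b : ℝ} (ha : 0 ≤ a) (hab : a ≤ b) (z : ℕ) :
    Measure.pi (fun _ : Fin z => rateMeasure γ) (orderedTimes z a b) =
      ENNReal.ofReal ((∫ x in a..b, γ x) ^ z / z.factorial) := by
  rw [ENNReal.ofReal_div_of_pos (by positivity), ← factorial_mul_pi_orderedTimes hγ hγi ha hab,
    ENNReal.ofReal_natCast, mul_comm, ENNReal.mul_div_cancel_right]
  · exact_mod_cast z.factorial_ne_zero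
  · exact ENNReal.natCast_ne_top _

theorem measurableSet_orderedTimes_prod {z : ℕ} {B : Set (Fin z → ℝ)} (hB : MeasurableSet B) :
    MeasurableSet {x : (ℝ × ℝ) × (Fin z → ℝ) | x.2 ∈ B ∩ orderedTimes z x.1.1 x.1.2} := by
  have : {x : (ℝ × ℝ) × (Fin z → ℝ) | x.2 ∈ B ∩ orderedTimes z x.1.1 x.1.2} =
      Prod.snd ⁻¹' (B ∩ {t | StrictMono t}) ∩
        ⋂ i : Fin z, {x | x.1.1 < x.2 i} ∩ {x | x.2 i < x.1.2} := by
    ext x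
    simp only [orderedTimes, mem_inter_iff, mem_ofPred_eq, mem_preimage, mem_iInter, mem_Ioo]
    tauto
  rw [this]
  refine (measurable_snd (hB.inter (measurableSet_strictMono z))).inter
    (MeasurableSet.iInter fun i => ?_)
  have hi : Measurable fun x : (ℝ × ℝ) × (Fin z → ℝ) => x.2 i :=
    (measurable_pi_apply i).comp measurable_snd
  exact (measurableSet_lt measurable_fst.fst hi).inter (measurableSet_lt hi measurable_fst.snd)

/-- The endpoints will be random regime times, so joint measurability in both of them is needed. It
comes from measurability of the sections of one set. -/
theorem measurable_pi_orderedTimes {z : ℕ} {B : Set (Fin z → ℝ)} (hB : MeasurableSet B) :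
    Measurable fun p : ℝ × ℝ =>
      Measure.pi (fun _ : Fin z => rateMeasure γ) (B ∩ orderedTimes z p.1 p.2) :=
  measurable_measure_prodMk_left (measurableSet_orderedTimes_prod hB)

end rate

/-! ### Right-continuous paths and sampling at random times. -/

section paths

/-- The right-hand approximation of `x` by multiples of `1 / (j + 1)`. -/
def upperApprox (j : ℕ) (x : ℝ) : ℝ := (⌊(j + 1) * x⌋₊ + 1) / (j + 1)

theorem lt_upperApprox (j : ℕ) (x : ℝ) : x < upperApprox j x := by
  rw [upperApprox, lt_div_iff₀ (by positivity), mul_comm]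
  exact Nat.lt_floor_add_one _

theorem upperApprox_le (j : ℕ) {x : ℝ} (hx : 0 ≤ x) : upperApprox j x ≤ x + 1 / (j + 1) := by
  rw [upperApprox, add_div]
  have : (⌊(j + 1) * x⌋₊ : ℝ) ≤ (j + 1) * x := Nat.floor_le (by positivity)
  gcongr
  rw [div_le_iff₀ (by positivity)]
  linarith

theorem upperApprox_mono (j : ℕ) : Monotone (upperApprox j) := by
  intro x y h
  unfold upperApprox
  gcongr

/-- The limit is taken within `[x, ∞)`, the only side on which the paths are continuous. -/
theorem tendsto_upperApprox {x : ℝ} (hx : 0 ≤ x) :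
    Filter.Tendsto (fun j => upperApprox j x) Filter.atTop (nhdsWithin x (Ici x)) := by
  refine tendsto_nhdsWithin_of_tendsto_nhds_of_eventually_within _ ?_
    (Filter.Eventually.of_forall fun j => (lt_upperApprox j x).le)
  refine tendsto_of_tendsto_of_tendsto_of_le_of_le tendsto_const_nhds ?_
    (fun j => (lt_upperApprox j x).le) (fun j => upperApprox_le j hx)
  have := tendsto_one_div_add_atTop_nhds_zero_nat (𝕜 := ℝ)
  simpa using this.const_add x

variable {Ω β : Type*} [TopologicalSpace β] [DiscreteTopology β]

/-- A right-continuous path in a discrete space does not change right after a given time. -/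
theorem eventually_upperApprox_eq {X : ℝ → Ω → β}
    (hX : ∀ ω t, 0 ≤ t → ContinuousWithinAt (fun x => X x ω) (Ici t) t) (ω : Ω) {t : ℝ}
    (ht : 0 ≤ t) : ∀ᶠ j in Filter.atTop, X (upperApprox j t) ω = X t ω := by
  have h := (hX ω t ht).tendsto
  rw [nhds_discrete, Filter.tendsto_pure] at h
  exact (tendsto_upperApprox ht).eventually h

theorem exists_eq_Ico {X : ℝ → Ω → β}
    (hX : ∀ ω t, 0 ≤ t → ContinuousWithinAt (fun x => X x ω) (Ici t) t) (ω : Ω) {t : ℝ}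
    (ht : 0 ≤ t) : ∃ u, t < u ∧ ∀ x ∈ Ico t u, X x ω = X t ω := by
  have h := (hX ω t ht).tendsto
  rw [nhds_discrete, Filter.tendsto_pure] at h
  exact mem_nhdsGE_iff_exists_Ico_subset.1 h

/-- Sampling a right-continuous process at a measurable time. -/
theorem measurable_sample [Countable β] [MeasurableSpace β] [BorelSpace β]
    [TopologicalSpace.PseudoMetrizableSpace β] {X : ℝ → Ω → β}
    (hX : ∀ ω t, 0 ≤ t → ContinuousWithinAt (fun x => X x ω) (Ici t) t)
    {S : Type*} [MeasurableSpace S] {ρ : S → Ω} {τ : S → ℝ}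
    (hXm : ∀ t, 0 ≤ t → Measurable fun s => X t (ρ s)) (hτ : Measurable τ) (hτ0 : ∀ s, 0 ≤ τ s) :
    Measurable fun s => X (τ s) (ρ s) := by
  refine measurable_of_tendsto_metrizable (f := fun j s => X (upperApprox j (τ s)) (ρ s)) ?_ ?_
  · intro j
    -- For fixed `j` the sampling time runs through a countable grid, so measurability at each grid
    -- point suffices.
    have h1 : Measurable fun p : ℕ × S => X ((p.1 + 1) / (j + 1)) (ρ p.2) :=
      measurable_from_prod_countable_right fun n => hXm ((n + 1) / (j + 1)) (by
        have : (0 : ℝ) ≤ n := n.cast_nonneg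
        positivity)
    have h2 : Measurable fun s => ⌊(j + 1) * τ s⌋₊ := Nat.measurable_floor.comp (by fun_prop)
    exact h1.comp (h2.prodMk measurable_id)
  · rw [tendsto_pi_nhds]
    intro s
    rw [nhds_discrete, Filter.tendsto_pure]
    exact eventually_upperApprox_eq hX (ρ s) (hτ0 s)

end paths

/-! ### Poisson probabilities and cumulated rates along a path. -/

/-- The Poisson probability of `z` with mean `Λ`. -/
def poissonProb (Λ : ℝ) (z : ℕ) : ENNReal := ENNReal.ofReal (Real.exp (-Λ) * Λ ^ z / z.factorial)

/-- One term of the exponential series is at most its sum. The bound provides the domination in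
`IsMMNPP.measure_grid`. -/
theorem poissonProb_le_one {Λ : ℝ} (hΛ : 0 ≤ Λ) (z : ℕ) : poissonProb Λ z ≤ 1 := by
  rw [poissonProb, ENNReal.ofReal_le_one, mul_div_assoc]
  have := Real.pow_div_factorial_le_exp Λ hΛ z
  calc Real.exp (-Λ) * (Λ ^ z / z.factorial) ≤ Real.exp (-Λ) * Real.exp Λ := by gcongr
    _ = 1 := by rw [← Real.exp_add]; simp

theorem continuous_poissonProb (z : ℕ) : Continuous fun Λ => poissonProb Λ z := by
  unfold poissonProb
  exact ENNReal.continuous_ofReal.comp (by fun_prop)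

section cumRate
variable {Ω : Type*} {r : ℕ} {lam : Fin r → ℝ} {γ : ℝ → ℝ} {M : ℝ → Ω → Fin r}

/-- The cumulated arrival rate over `(s, t]` along a path of the chain. -/
def cumRate (lam : Fin r → ℝ) (γ : ℝ → ℝ) (M : ℝ → Ω → Fin r) (ω : Ω) (s t : ℝ) : ℝ :=
  ∫ x in s..t, lam (M x ω) * γ x

/-- Nothing is assumed about the path at negative times, hence the truncation at `0`. -/
theorem measurable_path (hM : ∀ ω t, 0 ≤ t → ContinuousWithinAt (fun x => M x ω) (Ici t) t) (ω : Ω) :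
    Measurable fun x : ℝ => M (max x 0) ω :=
  measurable_sample (ρ := fun _ => ω) hM (fun _ _ => measurable_const)
    (measurable_id.max measurable_const) fun _ => le_max_right _ _

theorem integrableOn_rate_path (hγi : LocallyIntegrableOn γ (Ici 0))
    (hM : ∀ ω t, 0 ≤ t → ContinuousWithinAt (fun x => M x ω) (Ici t) t) (ω : Ω) {a b : ℝ}
    (ha : 0 ≤ a) : IntegrableOn (fun x => lam (M x ω) * γ x) (Ioc a b) := by
  have h1 : IntegrableOn (fun x => lam (M (max x 0) ω) * γ x) (Ioc a b) := by
    refine Integrable.bdd_mul (c := ∑ i, |lam i|) (rate_integrableOn_Ioc hγi ha)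
      ((measurable_of_finite lam).comp (measurable_path hM ω)).aestronglyMeasurable ?_
    refine Filter.Eventually.of_forall fun x => ?_
    exact Finset.single_le_sum (f := fun i => |lam i|) (fun i _ => abs_nonneg _)
      (Finset.mem_univ _)
  refine h1.congr_fun (fun x hx => ?_) measurableSet_Ioc
  simp only [max_eq_left (ha.trans hx.1.le)]

theorem cumRate_nonneg (hlam : ∀ i, 0 ≤ lam i) (hγ : ∀ x, 0 ≤ x → 0 ≤ γ x) (ω : Ω) {s t : ℝ}
    (hs : 0 ≤ s) (hst : s ≤ t) : 0 ≤ cumRate lam γ M ω s t :=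
  intervalIntegral.integral_nonneg hst fun x hx => mul_nonneg (hlam _) (hγ x (hs.trans hx.1))

/-- The state is known only on the half-open interval, since the chain may jump at `t`; the endpoint
is null for the integral. -/
theorem cumRate_eq_of_const {ω : Ω} {s t : ℝ} {i : Fin r} (hst : s ≤ t)
    (h : ∀ x ∈ Ico s t, M x ω = i) : cumRate lam γ M ω s t = lam i * ∫ x in s..t, γ x := by
  rw [cumRate, ← intervalIntegral.integral_const_mul, intervalIntegral.integral_of_le hst,
    intervalIntegral.integral_of_le hst, integral_Ioc_eq_integral_Ioo, integral_Ioc_eq_integral_Ioo]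
  refine setIntegral_congr_fun measurableSet_Ioo fun x hx => ?_
  simp only [h x ⟨hx.1.le, hx.2⟩]

/-- Primitives of locally integrable functions are continuous. Extending the integrand by zero to
the negative half-line makes it integrable on every bounded interval, so the standard statement
applies. -/
theorem tendsto_cumRate (hγi : LocallyIntegrableOn γ (Ici 0))
    (hM : ∀ ω t, 0 ≤ t → ContinuousWithinAt (fun x => M x ω) (Ici t) t) (ω : Ω) {s t : ℝ}
    (hs : 0 ≤ s) (ht : 0 ≤ t) : Filter.Tendsto
      (fun j => cumRate lam γ M ω (upperApprox j s) (upperApprox j t)) Filter.atTop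
      (nhds (cumRate lam γ M ω s t)) := by
  let g := (Ici (0 : ℝ)).indicator fun x => lam (M x ω) * γ x
  have hloc : ∀ a b, IntervalIntegrable g volume a b := by
    intro a b
    have key : ∀ a b : ℝ, IntegrableOn g (Ioc a b) := by
      intro a b
      have h1 : IntegrableOn (fun x => lam (M x ω) * γ x) (Icc 0 b) := by
        rw [integrableOn_Icc_iff_integrableOn_Ioc]
        exact integrableOn_rate_path hγi hM ω le_rfl
      rw [integrableOn_indicator_iff measurableSet_Ici]
      exact h1.mono_set fun x hx => ⟨hx.1, hx.2.2⟩
    exact ⟨key a b, key b a⟩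
  have hcont : Continuous fun t => ∫ x in (0 : ℝ)..t, g x :=
    intervalIntegral.continuous_primitive hloc 0
  have heq : ∀ s t : ℝ, 0 ≤ s → 0 ≤ t →
      cumRate lam γ M ω s t = (∫ x in (0 : ℝ)..t, g x) - ∫ x in (0 : ℝ)..s, g x := by
    intro s t hs ht
    rw [intervalIntegral.integral_interval_sub_left (hloc _ _) (hloc _ _)]
    refine intervalIntegral.integral_congr fun x hx => ?_
    have : x ∈ Ici (0 : ℝ) := (le_min hs ht).trans hx.1
    simp only [g, indicator_of_mem this]
  rw [heq s t hs ht]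
  have h1 : ∀ {x : ℝ}, 0 ≤ x → Filter.Tendsto (fun j => upperApprox j x) Filter.atTop (nhds x) :=
    fun hx => (tendsto_upperApprox hx).mono_right nhdsWithin_le_nhds
  refine Filter.Tendsto.congr (fun j => (heq _ _ (hs.trans (lt_upperApprox j s).le)
    (ht.trans (lt_upperApprox j t).le)).symm) ?_
  exact ((hcont.tendsto t).comp (h1 ht)).sub ((hcont.tendsto s).comp (h1 hs))

theorem measurable_path_pathSigma {t : ℝ} (ht : 0 ≤ t) : Measurable[pathSigma M] (M t) := by
  have h : MeasurableSpace.comap (M t) inferInstance ≤ pathSigma M :=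
    le_iSup (fun t : {t : ℝ // 0 ≤ t} => MeasurableSpace.comap (M t) inferInstance) ⟨t, ht⟩
  exact (comap_measurable (M t)).mono h le_rfl

/-- The integral is a partial integral of a jointly measurable function on `Ω × ℝ`, with the random
interval as an indicator. Since `γ` is only almost everywhere measurable, a measurable
representative replaces it. -/
theorem measurable_cumRate (hγi : LocallyIntegrableOn γ (Ici 0))
    (hM : ∀ ω t, 0 ≤ t → ContinuousWithinAt (fun x => M x ω) (Ici t) t) {σ τ : Ω → ℝ}
    (hσ : Measurable[pathSigma M] σ) (hτ : Measurable[pathSigma M] τ) (h0 : ∀ ω, 0 ≤ σ ω)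
    (hστ : ∀ ω, σ ω ≤ τ ω) :
    Measurable[pathSigma M] fun ω => cumRate lam γ M ω (σ ω) (τ ω) := by
  let _ : MeasurableSpace Ω := pathSigma M
  have hae := aemeasurable_indicator_rate hγi
  let g := hae.mk _
  have hg : Measurable g := hae.measurable_mk
  have hS : MeasurableSet {p : Ω × ℝ | p.2 ∈ Ioc (σ p.1) (τ p.1)} :=
    (measurableSet_lt (hσ.comp measurable_fst) measurable_snd).inter
      (measurableSet_le measurable_snd (hτ.comp measurable_fst))
  have hMp : Measurable fun p : Ω × ℝ => M (max p.2 0) p.1 :=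
    measurable_sample (ρ := fun p : Ω × ℝ => p.1) hM
      (fun t ht => (measurable_path_pathSigma ht).comp measurable_fst)
      (measurable_snd.max measurable_const) fun _ => le_max_right _ _
  have hF : Measurable fun p : Ω × ℝ => {p : Ω × ℝ | p.2 ∈ Ioc (σ p.1) (τ p.1)}.indicator
      (fun p => lam (M (max p.2 0) p.1) * g p.2) p :=
    (((measurable_of_finite lam).comp hMp).mul (hg.comp measurable_snd)).indicator hS
  have hI := hF.stronglyMeasurable.integral_prod_right' (ν := (volume : Measure ℝ))
  convert hI.measurable using 2 with ω
  rw [cumRate, intervalIntegral.integral_of_le (hστ ω), ← integral_indicator measurableSet_Ioc]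
  refine integral_congr_ae ?_
  filter_upwards [hae.ae_eq_mk] with x hx
  by_cases hxm : x ∈ Ioc (σ ω) (τ ω)
  · have h1 : x ∈ Ici (0 : ℝ) := (h0 ω).trans hxm.1.le
    rw [indicator_of_mem hxm, indicator_of_mem (by exact hxm)]
    rw [indicator_of_mem h1] at hx
    simp only [g, ← hx, max_eq_left (mem_Ici.1 h1)]
  · rw [indicator_of_notMem hxm, indicator_of_notMem (by exact hxm)]

end cumRate

/-! ### Increments of `N` over grids of path-measurable times. -/

section grid
variable {Ω : Type*} {r : ℕ}

/-- Prescribed increments of `N` between successive random times. -/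
def gridEvent (N : ℝ → Ω → ℕ) (n : ℕ) (τ : ℕ → Ω → ℝ) (z : ℕ → ℕ) : Set Ω :=
  {ω | ∀ k < n, N (τ (k + 1) ω) ω = N (τ k ω) ω + z k}

variable [MeasurableSpace Ω] {P : Measure Ω}
    {π : Fin r → ℝ} {q : Fin r → Fin r → ℝ} {lam : Fin r → ℝ} {γ : ℝ → ℝ}
    {M : ℝ → Ω → Fin r} {N : ℝ → Ω → ℕ}

theorem IsMMNPP.pathSigma_le (h : IsMMNPP P π q lam γ M N) :
    pathSigma M ≤ (inferInstance : MeasurableSpace Ω) :=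
  iSup_le fun t => (h.chain.measurable t t.2).comap_le

theorem IsMMNPP.measurable_count (h : IsMMNPP P π q lam γ M N) {τ : Ω → ℝ} (hτ : Measurable τ)
    (h0 : ∀ ω, 0 ≤ τ ω) : Measurable fun ω => N (τ ω) ω :=
  measurable_sample (ρ := id) h.rightCont h.measurable hτ h0

theorem IsMMNPP.measurableSet_gridEvent (h : IsMMNPP P π q lam γ M N) (n : ℕ) {τ : ℕ → Ω → ℝ}
    (hτ : ∀ k ≤ n, Measurable (τ k)) (h0 : ∀ k ≤ n, ∀ ω, 0 ≤ τ k ω) (z : ℕ → ℕ) :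
    MeasurableSet (gridEvent N n τ z) := by
  have : gridEvent N n τ z =
      ⋂ (k : ℕ) (_ : k < n), {ω | N (τ (k + 1) ω) ω = N (τ k ω) ω + z k} := by
    ext; simp [gridEvent]
  rw [this]
  exact MeasurableSet.iInter fun k => MeasurableSet.iInter fun hk =>
    measurableSet_eq_fun (h.measurable_count (hτ _ hk) (h0 _ hk))
      ((h.measurable_count (hτ _ hk.le) (h0 _ hk.le)).add_const _)

theorem prod_poissonProb_eq {n : ℕ} {Λ : ℕ → ℝ} {z : ℕ → ℕ} (hΛ : ∀ k < n, 0 ≤ Λ k) :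
    ∏ k ∈ Finset.range n, poissonProb (Λ k) (z k) =
      ENNReal.ofReal (∏ k ∈ Finset.range n, Real.exp (-Λ k) * Λ k ^ z k / (z k).factorial) := by
  rw [ENNReal.ofReal_prod_of_nonneg]
  · rfl
  · intro k hk
    have := hΛ k (Finset.mem_range.1 hk)
    positivity

/-- This is the defining integral identity of the conditional expectation, rewritten with values in
`[0, ∞]`. -/
theorem IsMMNPP.measure_grid_deterministic [IsProbabilityMeasure P] (h : IsMMNPP P π q lam γ M N) (hlam : ∀ i, 0 ≤ lam i)
    (hγ : ∀ x, 0 ≤ x → 0 ≤ γ x) {A : Set Ω} (hA : MeasurableSet[pathSigma M] A) (n : ℕ)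
    {a : ℕ → ℝ} (h0 : 0 ≤ a 0) (ha : Monotone a) (z : ℕ → ℕ) :
    P (A ∩ gridEvent N n (fun k _ => a k) z) =
      ∫⁻ ω in A, ∏ k ∈ Finset.range n,
        poissonProb (cumRate lam γ M ω (a k) (a (k + 1))) (z k) ∂P := by
  have hnn : ∀ ω k, 0 ≤ cumRate lam γ M ω (a k) (a (k + 1)) := fun ω k =>
    cumRate_nonneg hlam hγ ω (h0.trans (ha k.zero_le)) (ha k.le_succ)
  have hE : MeasurableSet (gridEvent N n (fun k _ => a k) z) :=
    h.measurableSet_gridEvent n (fun _ _ => measurable_const)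
      (fun k _ _ => h0.trans (ha k.zero_le)) z
  have hc := h.condPoisson n a z h0 ha
  have hint : Integrable (fun ω => ∏ k ∈ Finset.range n,
      Real.exp (-cumRate lam γ M ω (a k) (a (k + 1))) *
          (cumRate lam γ M ω (a k) (a (k + 1))) ^ z k / (z k).factorial) P :=
    integrable_condExp.congr hc
  have h1 := setIntegral_condExp h.pathSigma_le
    ((integrable_const (1 : ℝ)).indicator hE : Integrable _ P) hA
  have h2 : ∫ ω in A, (∏ k ∈ Finset.range n,
      Real.exp (-cumRate lam γ M ω (a k) (a (k + 1))) *
          (cumRate lam γ M ω (a k) (a (k + 1))) ^ z k / (z k).factorial) ∂P =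
        P.real (A ∩ gridEvent N n (fun k _ => a k) z) := by
    calc _ = ∫ ω in A, (P⟦gridEvent N n (fun k _ => a k) z | pathSigma M⟧) ω ∂P :=
          integral_congr_ae (ae_restrict_of_ae hc.symm)
      _ = _ := by
        refine h1.trans ?_
        rw [setIntegral_indicator hE]
        simp
  rw [lintegral_congr fun ω => prod_poissonProb_eq fun k _ => hnn ω k,
    ← ofReal_integral_eq_lintegral_ofReal hint.integrableOn, h2, ofReal_measureReal]
  refine Filter.Eventually.of_forall fun ω => Finset.prod_nonneg fun k _ => ?_
  have := hnn ω k
  positivity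

/-- The variable `v` splits the space into countably many path events, on each of which the grid is
deterministic; intersecting `A` with them and summing gives the result. -/
theorem IsMMNPP.measure_grid_discrete [IsProbabilityMeasure P] (h : IsMMNPP P π q lam γ M N) (hlam : ∀ i, 0 ≤ lam i)
    (hγ : ∀ x, 0 ≤ x → 0 ≤ γ x) {A : Set Ω} (hA : MeasurableSet[pathSigma M] A) (n : ℕ)
    {τ : ℕ → Ω → ℝ} {V : Type*} [Countable V] (v : Ω → V)
    (hv : ∀ x, MeasurableSet[pathSigma M] (v ⁻¹' {x})) (a : V → ℕ → ℝ)
    (hτ : ∀ ω, ∀ k ≤ n, τ k ω = a (v ω) k) (h0 : ∀ ω, 0 ≤ a (v ω) 0)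
    (ha : ∀ ω, Monotone (a (v ω))) (z : ℕ → ℕ) (hE : MeasurableSet (gridEvent N n τ z)) :
    P (A ∩ gridEvent N n τ z) =
      ∫⁻ ω in A, ∏ k ∈ Finset.range n,
        poissonProb (cumRate lam γ M ω (τ k ω) (τ (k + 1) ω)) (z k) ∂P := by
  have hm := h.pathSigma_le
  have hU : A = ⋃ x, A ∩ v ⁻¹' {x} := by
    ext ω; simp
  have hdisj : Pairwise (Function.onFun Disjoint fun x => A ∩ v ⁻¹' {x}) := by
    intro x y hxy
    rw [Function.onFun, Set.disjoint_left]
    rintro ω ⟨_, h1⟩ ⟨_, h2⟩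
    exact hxy (h1.symm.trans h2)
  have hAm : ∀ x, MeasurableSet (A ∩ v ⁻¹' {x}) := fun x => (hm _ hA).inter (hm _ (hv x))
  conv_rhs => rw [hU, lintegral_iUnion hAm hdisj]
  conv_lhs => rw [hU, iUnion_inter]
  rw [measure_iUnion _ fun x => (hAm x).inter hE]
  · refine tsum_congr fun x => ?_
    -- The grid `a x` is known to be nonnegative and monotone only for values `x` that are attained,
    -- so a sample point is needed to use the deterministic case.
    rcases (A ∩ v ⁻¹' {x}).eq_empty_or_nonempty with he | ⟨ω₀, hω₀⟩
    · simp [he]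
    · have hx : v ω₀ = x := hω₀.2
      have := h.measure_grid_deterministic hlam hγ (hA.inter (hv x)) n (a := a x)
        (hx ▸ h0 ω₀) (hx ▸ ha ω₀) z
      have hset : A ∩ v ⁻¹' {x} ∩ gridEvent N n τ z =
          A ∩ v ⁻¹' {x} ∩ gridEvent N n (fun k _ => a x k) z := by
        ext ω
        refine and_congr_right fun hω => ?_
        have hωx : v ω = x := hω.2
        refine forall_congr' fun k => forall_congr' fun hk => ?_
        rw [hτ ω _ hk, hτ ω _ hk.le, hωx]
      rw [hset, this]
      refine setLIntegral_congr_fun (hAm x) fun ω hω => ?_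
      refine Finset.prod_congr rfl fun k hk => ?_
      have hωx : v ω = x := hω.2
      rw [hτ ω _ (Finset.mem_range.1 hk), hτ ω _ (Finset.mem_range.1 hk).le, hωx]
  · intro x y hxy
    exact (hdisj hxy).mono inter_subset_left inter_subset_left

/-- Conditionally on the path of the chain, the increments of `N` between random times depending
only on this path are independent and Poisson. -/
theorem IsMMNPP.measure_grid [IsProbabilityMeasure P] (h : IsMMNPP P π q lam γ M N) (hlam : ∀ i, 0 ≤ lam i)
    (hγ : ∀ x, 0 ≤ x → 0 ≤ γ x) (hγi : LocallyIntegrableOn γ (Ici 0))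
    {A : Set Ω} (hA : MeasurableSet[pathSigma M] A) (n : ℕ)
    {τ : ℕ → Ω → ℝ} (hτ : ∀ k, Measurable[pathSigma M] (τ k)) (h0 : ∀ ω, 0 ≤ τ 0 ω)
    (hmono : ∀ ω, Monotone fun k => τ k ω) (z : ℕ → ℕ) :
    P (A ∩ gridEvent N n τ z) =
      ∫⁻ ω in A, ∏ k ∈ Finset.range n,
        poissonProb (cumRate lam γ M ω (τ k ω) (τ (k + 1) ω)) (z k) ∂P := by
  have hm := h.pathSigma_le
  have hk0 : ∀ k ω, 0 ≤ τ k ω := fun k ω => (h0 ω).trans (hmono ω k.zero_le)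
  have hup : ∀ j k, Measurable[pathSigma M] fun ω => upperApprox j (τ k ω) := fun j k =>
    (upperApprox_mono j).measurable.comp (hτ k)
  have hup0 : ∀ j k ω, 0 ≤ upperApprox j (τ k ω) := fun j k ω =>
    (hk0 k ω).trans (lt_upperApprox j _).le
  have hEj : ∀ j, MeasurableSet (gridEvent N n (fun k ω => upperApprox j (τ k ω)) z) := fun j =>
    h.measurableSet_gridEvent n (fun k _ => (hup j k).mono hm le_rfl) (fun k _ => hup0 j k) z
  have hj : ∀ j : ℕ, P (A ∩ gridEvent N n (fun k ω => upperApprox j (τ k ω)) z) =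
      ∫⁻ ω in A, ∏ k ∈ Finset.range n, poissonProb (cumRate lam γ M ω
        (upperApprox j (τ k ω)) (upperApprox j (τ (k + 1) ω))) (z k) ∂P := by
    intro j
    -- Only the first `n + 1` floors are recorded, which keeps the value space countable; truncating
    -- the index at `n` extends the grid to a monotone sequence on `ℕ`.
    refine h.measure_grid_discrete hlam hγ hA n
      (fun ω => fun i : Fin (n + 1) => ⌊(j + 1) * τ i ω⌋₊) (fun x => ?_)
      (fun x k => ((x ⟨min k n, by omega⟩ : ℝ) + 1) / (j + 1)) (fun ω k hk => ?_) (fun ω => ?_)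
      (fun ω k l hkl => ?_) z (hEj j)
    · let _ : MeasurableSpace Ω := pathSigma M
      have : Measurable fun ω => fun i : Fin (n + 1) => ⌊(j + 1) * τ i ω⌋₊ := by
        refine measurable_pi_lambda _ fun i => Nat.measurable_floor.comp ?_
        exact (hτ i).const_mul _
      exact this (measurableSet_singleton x)
    · simp only [min_eq_left hk]
      rfl
    · positivity
    · have := hmono ω (min_le_min_right n hkl)
      simp only at this ⊢
      gcongr
  -- For each outcome the counts at the approximating times eventually equal those at the limiting
  -- times, so the indicators converge pointwise.
  have hLHS : Filter.Tendsto
      (fun j => P (A ∩ gridEvent N n (fun k ω => upperApprox j (τ k ω)) z)) Filter.atTop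
      (nhds (P (A ∩ gridEvent N n τ z))) := by
    refine tendsto_measure_of_tendsto_indicator_of_isFiniteMeasure Filter.atTop P
      (fun j => (hm _ hA).inter (hEj j)) ?_
    intro ω
    have h1 : ∀ᶠ j in Filter.atTop, ∀ k ∈ Finset.range (n + 1),
        N (upperApprox j (τ k ω)) ω = N (τ k ω) ω :=
      (Filter.eventually_all_finset _).2 fun k _ =>
        eventually_upperApprox_eq h.rightCont ω (hk0 k ω)
    filter_upwards [h1] with j hj
    refine and_congr_right fun _ => forall_congr' fun k => forall_congr' fun hk => ?_
    rw [hj k (Finset.mem_range.2 (by omega)), hj (k + 1) (Finset.mem_range.2 (by omega))]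
  -- Dominated convergence, with the constant `1` as bound.
  have hRHS : Filter.Tendsto (fun j => ∫⁻ ω in A, ∏ k ∈ Finset.range n, poissonProb
      (cumRate lam γ M ω (upperApprox j (τ k ω)) (upperApprox j (τ (k + 1) ω))) (z k) ∂P)
      Filter.atTop (nhds (∫⁻ ω in A, ∏ k ∈ Finset.range n,
        poissonProb (cumRate lam γ M ω (τ k ω) (τ (k + 1) ω)) (z k) ∂P)) := by
    refine tendsto_lintegral_of_dominated_convergence (fun _ => 1) (fun j => ?_) (fun j => ?_) ?_ ?_
    · refine Finset.measurable_prod _ fun k _ => (continuous_poissonProb _).measurable.comp ?_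
      exact (measurable_cumRate hγi h.chain.rightCont (hup j k) (hup j (k + 1)) (hup0 j k)
        fun ω => upperApprox_mono j (hmono ω k.le_succ)).mono hm le_rfl
    · exact Filter.Eventually.of_forall fun ω => Finset.prod_le_one' fun k _ =>
        poissonProb_le_one (cumRate_nonneg hlam hγ ω (hup0 j k ω)
          (upperApprox_mono j (hmono ω k.le_succ))) _
    · simp
    · refine Filter.Eventually.of_forall fun ω => ENNReal.tendsto_finsetProd_of_ne_top _ (fun k _ => ?_)
        fun k _ => ENNReal.ofReal_ne_top
      exact ((continuous_poissonProb _).tendsto _).comp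
        (tendsto_cumRate hγi h.chain.rightCont ω (hk0 _ ω) (hk0 _ ω))
  simp only [hj] at hLHS
  exact tendsto_nhds_unique hLHS hRHS

end grid

/-! ### Arrival times expressed through counts. -/

section counting
variable {Ω : Type*} {N : ℝ → Ω → ℕ}

/-- Right-continuity makes the infimum a minimum. It cannot equal `a`, since the count there is
still too small. -/
theorem arrivalTime_mem (hN : ∀ ω t, 0 ≤ t → ContinuousWithinAt (fun x => N x ω) (Ici t) t)
    {ω : Ω} {a b : ℝ} {i : ℕ} (ha : 0 ≤ a) (hab : a ≤ b) (hb : N a ω + (i + 1) ≤ N b ω) :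
    N a ω + (i + 1) ≤ N (arrivalTime N a i ω) ω ∧ a < arrivalTime N a i ω ∧
      arrivalTime N a i ω ≤ b := by
  have hbdd : BddBelow {t : ℝ | a ≤ t ∧ N a ω + (i + 1) ≤ N t ω} := ⟨a, fun t ht => ht.1⟩
  have hne : {t : ℝ | a ≤ t ∧ N a ω + (i + 1) ≤ N t ω}.Nonempty := ⟨b, hab, hb⟩
  have h1 : a ≤ arrivalTime N a i ω := le_csInf hne fun t ht => ht.1
  have h2 : N a ω + (i + 1) ≤ N (arrivalTime N a i ω) ω := by
    obtain ⟨u, hu, hconst⟩ := exists_eq_Ico hN ω (ha.trans h1)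
    obtain ⟨t, ht, htu⟩ := exists_lt_of_csInf_lt hne hu
    rw [← hconst t ⟨csInf_le hbdd ht, htu⟩]
    exact ht.2
  refine ⟨h2, lt_of_le_of_ne h1 fun h => ?_, csInf_le hbdd ⟨hab, hb⟩⟩
  rw [← h] at h2
  omega

/-- The dictionary between arrival times and counts: the infimum is attained and counts are
monotone. The bound `hb` excludes the case where the arrival never occurs. -/
theorem arrivalTime_le_iff (hN : ∀ ω t, 0 ≤ t → ContinuousWithinAt (fun x => N x ω) (Ici t) t)
    (hmono : ∀ ω, MonotoneOn (fun t => N t ω) (Ici 0))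
    {ω : Ω} {a b t : ℝ} {i : ℕ} (ha : 0 ≤ a) (hab : a ≤ b) (hb : N a ω + (i + 1) ≤ N b ω)
    (hat : a ≤ t) : arrivalTime N a i ω ≤ t ↔ N a ω + (i + 1) ≤ N t ω := by
  obtain ⟨h1, h2, _⟩ := arrivalTime_mem hN ha hab hb
  refine ⟨fun h => h1.trans ?_, fun h => csInf_le ⟨a, fun t ht => ht.1⟩ ⟨hat, h⟩⟩
  exact hmono ω (ha.trans h2.le) (ha.trans hat) h

theorem measurable_arrivalTime [MeasurableSpace Ω]
    (hN : ∀ ω t, 0 ≤ t → ContinuousWithinAt (fun x => N x ω) (Ici t) t)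
    (hmono : ∀ ω, MonotoneOn (fun t => N t ω) (Ici 0)) (hm : ∀ t, 0 ≤ t → Measurable (N t))
    {U : Ω → ℝ} (hU : Measurable U) (hU0 : ∀ ω, 0 ≤ U ω) (i : ℕ) :
    Measurable fun ω => arrivalTime N (U ω) i ω := by
  have hs : ∀ {τ : Ω → ℝ}, Measurable τ → (∀ ω, 0 ≤ τ ω) → Measurable fun ω => N (τ ω) ω :=
    fun hτ h0 => measurable_sample (ρ := id) hN hm hτ h0
  refine measurable_of_Iic fun c => ?_
  -- The second piece collects the outcomes with no such arrival at all: there the infimum of the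
  -- empty set is `0` by convention, so membership depends only on the sign of `c`.
  have : (fun ω => arrivalTime N (U ω) i ω) ⁻¹' Iic c =
      ({ω | U ω ≤ c} ∩ {ω | N (U ω) ω + (i + 1) ≤ N (max (U ω) c) ω}) ∪
      ((⋂ n : ℕ, {ω | N (U ω + n) ω < N (U ω) ω + (i + 1)}) ∩ {_ω | 0 ≤ c}) := by
    ext ω
    simp only [mem_preimage, mem_Iic, mem_union, mem_inter_iff, mem_ofPred_eq, mem_iInter]
    by_cases hne : ∃ n : ℕ, N (U ω) ω + (i + 1) ≤ N (U ω + n) ω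
    · obtain ⟨n, hn⟩ := hne
      have hle : U ω ≤ U ω + n := le_add_of_nonneg_right n.cast_nonneg
      have h2 : ¬ ((∀ n : ℕ, N (U ω + n) ω < N (U ω) ω + (i + 1)) ∧ 0 ≤ c) := fun h =>
        absurd (h.1 n) hn.not_gt
      simp only [h2, or_false]
      constructor
      · intro h
        have hlt := (arrivalTime_mem hN (hU0 ω) hle hn).2.1
        have hc : U ω ≤ c := hlt.le.trans h
        exact ⟨hc, by rw [max_eq_right hc]; exact
          (arrivalTime_le_iff hN hmono (hU0 ω) hle hn hc).1 h⟩
      · rintro ⟨hc, h⟩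
        rw [max_eq_right hc] at h
        exact (arrivalTime_le_iff hN hmono (hU0 ω) hle hn hc).2 h
    · push Not at hne
      have hempty : {t : ℝ | U ω ≤ t ∧ N (U ω) ω + (i + 1) ≤ N t ω} = ∅ := by
        rw [eq_empty_iff_forall_notMem]
        rintro t ⟨h1, h2⟩
        obtain ⟨n, hn⟩ := exists_nat_ge (t - U ω)
        have := hmono ω (show t ∈ Ici 0 from (hU0 ω).trans h1)
          (show U ω + n ∈ Ici 0 by have := hU0 ω; simp only [mem_Ici]; positivity)
          (show t ≤ U ω + n by linarith)
        have h3 := hne n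
        simp only at this
        omega
      have h1 : arrivalTime N (U ω) i ω = 0 := by
        rw [arrivalTime, hempty, Real.sInf_empty]
      have h2 : ¬ (U ω ≤ c ∧ N (U ω) ω + (i + 1) ≤ N (max (U ω) c) ω) := by
        rintro ⟨_, h⟩
        have : max (U ω) c ∈ ({t : ℝ | U ω ≤ t ∧ N (U ω) ω + (i + 1) ≤ N t ω} : Set ℝ) :=
          ⟨le_max_left _ _, h⟩
        rw [hempty] at this
        exact this
      rw [h1]
      simp only [h2, false_or]
      exact ⟨fun h => ⟨hne, h⟩, fun h => h.2⟩
  rw [this]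
  refine MeasurableSet.union (MeasurableSet.inter (hU measurableSet_Iic) ?_)
    (MeasurableSet.inter (MeasurableSet.iInter fun n => ?_) (MeasurableSet.const _))
  · exact measurableSet_le ((hs hU hU0).add_const _)
      (hs (hU.max measurable_const) fun ω => (hU0 ω).trans (le_max_left _ _))
  · exact measurableSet_lt (hs (hU.add_const _) fun ω => add_nonneg (hU0 ω) n.cast_nonneg)
      ((hs hU hU0).add_const _)

theorem measurable_arrivals [MeasurableSpace Ω]
    (hN : ∀ ω t, 0 ≤ t → ContinuousWithinAt (fun x => N x ω) (Ici t) t)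
    (hmono : ∀ ω, MonotoneOn (fun t => N t ω) (Ici 0)) (hm : ∀ t, 0 ≤ t → Measurable (N t))
    {U : Ω → ℝ} (hU : Measurable U) (hU0 : ∀ ω, 0 ≤ U ω) (z : ℕ) :
    Measurable fun ω => arrivals N (U ω) z ω :=
  measurable_pi_lambda _ fun i => measurable_arrivalTime hN hmono hm hU hU0 i

/-- The point of `[u, v]` closest to `x`. -/
def clamp (u v x : ℝ) : ℝ := max u (min x v)

theorem le_clamp (u v x : ℝ) : u ≤ clamp u v x := le_max_left _ _

theorem clamp_le {u v : ℝ} (huv : u ≤ v) (x : ℝ) : clamp u v x ≤ v := max_le huv (min_le_right _ _)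

theorem clamp_mono (u v : ℝ) : Monotone (clamp u v) := fun _ _ h =>
  max_le_max_left _ (min_le_min_right _ h)

/-- The arrivals lie in an ordered box iff the counting process has suitable increments over its
sides. -/
theorem arrivals_mem_orderedBox_iff
    (hN : ∀ ω t, 0 ≤ t → ContinuousWithinAt (fun x => N x ω) (Ici t) t)
    (hmono : ∀ ω, MonotoneOn (fun t => N t ω) (Ici 0)) {ω : Ω} {u v : ℝ} (hu : 0 ≤ u) (huv : u ≤ v)
    {z : ℕ} {c d : ℕ → ℝ} (hdc : ∀ i, i + 1 < z → d i ≤ c (i + 1)) :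
    (N v ω = N u ω + z ∧ arrivals N u z ω ∈ orderedBox z c d) ↔
      N v ω = N u ω + z ∧ ∀ i < z, N (clamp u v (c i)) ω = N u ω + i ∧
        N (clamp u v (d i)) ω = N u ω + i + 1 := by
  refine and_congr_right fun hv => ?_
  have hpos : ∀ x, clamp u v x ∈ Ici (0 : ℝ) := fun x => hu.trans (le_clamp u v x)
  have hmem : ∀ i < z, N u ω + (i + 1) ≤ N v ω := fun i hi => by omega
  constructor
  · intro hbox
    have h1 : ∀ i < z, N (clamp u v (c i)) ω < N u ω + (i + 1) := by
      intro i hi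
      by_contra hcon
      push Not at hcon
      have h2 := (arrivalTime_le_iff hN hmono hu huv (hmem i hi) (le_clamp u v (c i))).2 hcon
      have h3 : c i < arrivalTime N u i ω := (hbox ⟨i, hi⟩).1
      have h4 := (arrivalTime_mem hN hu huv (hmem i hi)).2.1
      have h5 : clamp u v (c i) < arrivalTime N u i ω :=
        max_lt h4 ((min_le_left _ _).trans_lt h3)
      exact absurd h2 h5.not_ge
    have h2 : ∀ i < z, N u ω + (i + 1) ≤ N (clamp u v (d i)) ω := by
      intro i hi
      refine (arrivalTime_le_iff hN hmono hu huv (hmem i hi) (le_clamp u v (d i))).1 ?_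
      have h3 : arrivalTime N u i ω ≤ d i := (hbox ⟨i, hi⟩).2
      have h4 := (arrivalTime_mem hN hu huv (hmem i hi)).2.2
      exact (le_min h3 h4).trans (le_max_right _ _)
    intro i hi
    have hc1 := h1 i hi
    have hd1 := h2 i hi
    -- Arrival `i` gives only one-sided bounds at each endpoint. The missing lower bound at `c i`
    -- comes from the preceding side, which ends no later; the missing upper bound at `d i` comes
    -- from the following side, or from the total count for the last side.
    have hc2 : N u ω + i ≤ N (clamp u v (c i)) ω := by
      cases i with
      | zero => exact hmono ω hu (hpos _) (le_clamp u v _)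
      | succ i =>
        exact (h2 i (by omega)).trans (hmono ω (hpos _) (hpos _) (clamp_mono u v (hdc i hi)))
    have hd2 : N (clamp u v (d i)) ω ≤ N u ω + (i + 1) := by
      by_cases hi' : i + 1 < z
      · have := h1 (i + 1) hi'
        have h3 : N (clamp u v (d i)) ω ≤ N (clamp u v (c (i + 1))) ω :=
          hmono ω (hpos _) (hpos _) (clamp_mono u v (hdc i hi'))
        omega
      · have h3 : N (clamp u v (d i)) ω ≤ N v ω :=
          hmono ω (hpos _) (hu.trans huv) (clamp_le huv _)
        omega
    omega
  · rintro h ⟨i, hi⟩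
    obtain ⟨h1, h2⟩ := h i hi
    have e1 := arrivalTime_le_iff hN hmono hu huv (hmem i hi) (le_clamp u v (c i))
    have e2 := arrivalTime_le_iff hN hmono hu huv (hmem i hi) (le_clamp u v (d i))
    constructor
    · have h3 : clamp u v (c i) < arrivalTime N u i ω := by
        rw [← not_le, e1]; omega
      change c i < arrivalTime N u i ω
      -- If `c i` exceeded `v`, clamping would give `v`, where all `z > i` arrivals are already
      -- counted.
      by_cases hcv : c i ≤ v
      · refine lt_of_le_of_lt ?_ h3
        rw [clamp, min_eq_left hcv]
        exact le_max_right _ _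
      · have : clamp u v (c i) = v := by
          rw [clamp, min_eq_right (le_of_not_ge hcv), max_eq_right huv]
        rw [this] at h1
        omega
    · have h3 : arrivalTime N u i ω ≤ clamp u v (d i) := by
        rw [e2]; omega
      change arrivalTime N u i ω ≤ d i
      by_cases hdu : u ≤ d i
      · refine h3.trans ?_
        exact max_le hdu (min_le_left _ _)
      · have : clamp u v (d i) = u := by
          rw [clamp, max_eq_left ((min_le_left _ _).trans (le_of_not_ge hdu))]
        rw [this] at h2
        omega

end counting

theorem ordered_chain {z : ℕ} {c d : ℕ → ℝ} (hcd : ∀ i < z, c i ≤ d i)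
    (hdc : ∀ i, i + 1 < z → d i ≤ c (i + 1)) {i j : ℕ} (hij : i < j) (hj : j < z) : d i ≤ c j := by
  induction j, hij using Nat.le_induction with
  | base => exact hdc i hj
  | succ j hij ih =>
    exact (ih (by omega)).trans ((hcd j (by omega)).trans (hdc j hj))

/-- Because the sides are ordered, monotonicity of the coordinates is automatic and the intersection
is a plain product of intervals. Clamping computes each side inside `[u, v]`, up to a null endpoint.
-/
theorem pi_orderedBox {γ : ℝ → ℝ} (hγ : ∀ x, 0 ≤ x → 0 ≤ γ x)
    (hγi : LocallyIntegrableOn γ (Ici 0)) {u v : ℝ} (hu : 0 ≤ u)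
    {z : ℕ} {c d : ℕ → ℝ} (hcd : ∀ i < z, c i ≤ d i) (hdc : ∀ i, i + 1 < z → d i ≤ c (i + 1)) :
    Measure.pi (fun _ : Fin z => rateMeasure γ) (orderedBox z c d ∩ orderedTimes z u v) =
      ∏ i ∈ Finset.range z, ENNReal.ofReal (∫ x in (clamp u v (c i))..(clamp u v (d i)), γ x) := by
  have hset : orderedBox z c d ∩ orderedTimes z u v =
      univ.pi fun i : Fin z => Ioc (c i) (d i) ∩ Ioo u v := by
    ext t
    simp only [orderedBox, orderedTimes, mem_inter_iff, mem_ofPred_eq, mem_univ_pi]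
    refine ⟨fun h i => ⟨h.1 i, h.2.2 i⟩, fun h => ⟨fun i => (h i).1, fun i j hij => ?_,
      fun i => (h i).2⟩⟩
    exact ((h i).1.2.trans (ordered_chain hcd hdc hij j.2)).trans_lt (h j).1.1
  rw [hset, Measure.pi_pi, ← Fin.prod_univ_eq_prod_range
    (fun i => ENNReal.ofReal (∫ x in (clamp u v (c i))..(clamp u v (d i)), γ x))]
  refine Finset.prod_congr rfl fun i _ => ?_
  rw [← rateMeasure_Ioc hγ hγi (hu.trans (le_clamp _ _ _)) (clamp_mono u v (hcd i i.2))]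
  have h1 : (Ioc (c i) (d i) ∩ Ioo u v : Set ℝ) =ᵐ[rateMeasure γ] (Ioc (c i) (d i) ∩ Ioc u v : Set ℝ) :=
    Filter.EventuallyEq.rfl.inter (rateMeasure_absolutelyContinuous.ae_le Ioo_ae_eq_Ioc)
  rw [measure_congr h1]
  congr 1
  ext x
  simp only [clamp, mem_inter_iff, mem_Ioc, max_lt_iff, min_lt_iff, le_max_iff, le_min_iff]
  constructor
  · rintro ⟨⟨h1, h2⟩, h3, h4⟩
    exact ⟨⟨h3, Or.inl h1⟩, Or.inr ⟨h2, h4⟩⟩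
  · rintro ⟨⟨h1, h2⟩, h3⟩
    rcases h3 with h3 | ⟨h3, h4⟩
    · exact absurd h1 h3.not_gt
    · exact ⟨⟨h2.resolve_right h4.not_gt, h3⟩, h1, h4⟩

/-! ### The Poisson property after a path-measurable time. -/

section
variable {Ω : Type*} {r : ℕ} [MeasurableSpace Ω]

/-- The event `S` concerns the path of the chain and the arrivals up to the random time `U`, which
depends only on the path; its conditional probability given the path is `f`, and given the path and
`S` the arrivals after `U` still form a Poisson process. -/
structure PoissonAfter (P : Measure Ω) (lam : Fin r → ℝ) (γ : ℝ → ℝ) (M : ℝ → Ω → Fin r)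
    (N : ℝ → Ω → ℕ) (S : Set Ω) (U : Ω → ℝ) (f : Ω → ENNReal) : Prop where
  measurable_time : Measurable[pathSigma M] U
  nonneg : ∀ ω, 0 ≤ U ω
  measurable_weight : Measurable[pathSigma M] f
  measure_eq : ∀ A, MeasurableSet[pathSigma M] A → ∀ (n : ℕ) (τ : ℕ → Ω → ℝ) (z : ℕ → ℕ),
    (∀ k, Measurable[pathSigma M] (τ k)) → τ 0 = U → (∀ ω, Monotone fun k => τ k ω) →
    P (A ∩ (S ∩ gridEvent N n τ z)) = ∫⁻ ω in A, f ω * ∏ k ∈ Finset.range n,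
        poissonProb (cumRate lam γ M ω (τ k ω) (τ (k + 1) ω)) (z k) ∂P

variable {P : Measure Ω} {π : Fin r → ℝ} {q : Fin r → Fin r → ℝ} {lam : Fin r → ℝ} {γ : ℝ → ℝ}
    {M : ℝ → Ω → Fin r} {N : ℝ → Ω → ℕ} {S : Set Ω} {U V : Ω → ℝ} {f : Ω → ENNReal}

theorem IsMMNPP.poissonAfter [IsProbabilityMeasure P] (h : IsMMNPP P π q lam γ M N)
    (hlam : ∀ i, 0 ≤ lam i) (hγ : ∀ x, 0 ≤ x → 0 ≤ γ x) (hγi : LocallyIntegrableOn γ (Ici 0))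
    (hU : Measurable[pathSigma M] U) (hU0 : ∀ ω, 0 ≤ U ω) :
    PoissonAfter P lam γ M N univ U 1 where
  measurable_time := hU
  nonneg := hU0
  measurable_weight := measurable_const
  measure_eq A hA n τ z hτ h0 hmono := by
    simpa using h.measure_grid hlam hγ hγi hA n hτ (fun ω => by rw [h0]; exact hU0 ω) hmono z

/-- The invariant is quantified over all path events, so a further path event can be absorbed into
`A`. -/
theorem PoissonAfter.inter_path (hm : pathSigma M ≤ (inferInstance : MeasurableSpace Ω))
    (hS : PoissonAfter P lam γ M N S U f) {C : Set Ω} (hC : MeasurableSet[pathSigma M] C) :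
    PoissonAfter P lam γ M N (S ∩ C) U (C.indicator f) where
  measurable_time := hS.measurable_time
  nonneg := hS.nonneg
  measurable_weight := hS.measurable_weight.indicator hC
  measure_eq A hA n τ z hτ h0 hmono := by
    have h1 := hS.measure_eq (A ∩ C) (hA.inter hC) n τ z hτ h0 hmono
    have h2 : A ∩ (S ∩ C ∩ gridEvent N n τ z) = A ∩ C ∩ (S ∩ gridEvent N n τ z) := by
      ext; simp only [mem_inter_iff]; tauto
    rw [h2, h1, inter_comm A C, ← setLIntegral_indicator (hm _ hC)]
    refine lintegral_congr fun ω => ?_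
    by_cases hω : ω ∈ C <;> simp [hω]

/-- Prepending `U` to a grid that starts at `V` turns the new condition into the first increment of
a longer grid that starts at `U`. -/
theorem PoissonAfter.increment (hlamγ : ∀ {σ τ : Ω → ℝ}, Measurable[pathSigma M] σ →
      Measurable[pathSigma M] τ → (∀ ω, 0 ≤ σ ω) → (∀ ω, σ ω ≤ τ ω) →
      Measurable[pathSigma M] fun ω => cumRate lam γ M ω (σ ω) (τ ω))
    (hS : PoissonAfter P lam γ M N S U f) (hV : Measurable[pathSigma M] V)
    (hUV : ∀ ω, U ω ≤ V ω) (j : ℕ) :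
    PoissonAfter P lam γ M N (S ∩ {ω | N (V ω) ω = N (U ω) ω + j}) V
      (fun ω => f ω * poissonProb (cumRate lam γ M ω (U ω) (V ω)) j) where
  measurable_time := hV
  nonneg ω := (hS.nonneg ω).trans (hUV ω)
  measurable_weight := hS.measurable_weight.mul ((continuous_poissonProb j).measurable.comp
    (hlamγ hS.measurable_time hV hS.nonneg hUV))
  measure_eq A hA n τ z hτ h0 hmono := by
    let τ' : ℕ → Ω → ℝ := fun k => Nat.casesOn k U τ
    let z' : ℕ → ℕ := fun k => Nat.casesOn k j z
    have h1 := hS.measure_eq A hA (n + 1) τ' z'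
      (fun k => by cases k with
        | zero => exact hS.measurable_time
        | succ k => exact hτ k) rfl
      (fun ω => monotone_nat_of_le_succ fun k => by
        cases k with
        | zero => change U ω ≤ τ 0 ω; rw [h0]; exact hUV ω
        | succ k => exact hmono ω k.le_succ)
    have h2 : S ∩ {ω | N (V ω) ω = N (U ω) ω + j} ∩ gridEvent N n τ z =
        S ∩ gridEvent N (n + 1) τ' z' := by
      rw [inter_assoc]
      congr 1
      ext ω
      refine ⟨fun ⟨ha, hb⟩ k hk => ?_, fun hg => ⟨?_, fun k hk => hg (k + 1) (by omega)⟩⟩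
      · cases k with
        | zero => change N (τ 0 ω) ω = N (U ω) ω + j; rw [h0]; exact ha
        | succ k => exact hb k (by omega)
      · have := hg 0 (by omega)
        change N (τ 0 ω) ω = N (U ω) ω + j at this
        rwa [h0] at this
    rw [h2, h1]
    refine lintegral_congr fun ω => ?_
    rw [Finset.prod_range_succ', mul_assoc]
    congr 1
    rw [mul_comm]
    congr 1
    change poissonProb (cumRate lam γ M ω (U ω) (τ 0 ω)) j = _
    rw [h0]

/-- The probability of `z` arrivals at times in `B`, over the interval from `u` to `v` in a state
with arrival factor `l`. -/
def segmentWeight (γ : ℝ → ℝ) (l : ℝ) (z : ℕ) (B : Set (Fin z → ℝ)) (u v : ℝ) : ENNReal :=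
  ENNReal.ofReal (Real.exp (-(l * ∫ x in u..v, γ x)) * l ^ z) *
    Measure.pi (fun _ : Fin z => rateMeasure γ) (B ∩ orderedTimes z u v)

/-- The simplex mass `(∫γ)^z / z!` supplies the missing part of the Poisson probability. -/
theorem segmentWeight_univ (hγ : ∀ x, 0 ≤ x → 0 ≤ γ x) (hγi : LocallyIntegrableOn γ (Ici 0))
    {l : ℝ} (hl : 0 ≤ l) (z : ℕ) {u v : ℝ} (hu : 0 ≤ u) (huv : u ≤ v) :
    segmentWeight γ l z univ u v = poissonProb (l * ∫ x in u..v, γ x) z := by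
  rw [segmentWeight, univ_inter, pi_orderedTimes hγ hγi hu huv, ← ENNReal.ofReal_mul (by positivity),
    poissonProb]
  congr 1
  rw [mul_pow]
  ring

/-- The primitive of `γ`, frozen at its value at `0` on the negative half-line. -/
theorem measurable_integral_rate (hγi : LocallyIntegrableOn γ (Ici 0)) :
    Measurable fun p : ℝ × ℝ => ∫ x in (max p.1 0)..(max p.2 0), γ x := by
  let g := (Ici (0 : ℝ)).indicator γ
  have hloc : ∀ a b, IntervalIntegrable g volume a b := by
    intro a b
    have key : ∀ a b : ℝ, IntegrableOn g (Ioc a b) := by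
      intro a b
      have h1 : IntegrableOn γ (Icc 0 b) := by
        rw [integrableOn_Icc_iff_integrableOn_Ioc]
        exact rate_integrableOn_Ioc hγi le_rfl
      rw [integrableOn_indicator_iff measurableSet_Ici]
      exact h1.mono_set fun x hx => ⟨hx.1, hx.2.2⟩
    exact ⟨key a b, key b a⟩
  have hcont : Continuous fun t => ∫ x in (0 : ℝ)..t, g x :=
    intervalIntegral.continuous_primitive hloc 0
  have : (fun p : ℝ × ℝ => ∫ x in (max p.1 0)..(max p.2 0), γ x) = fun p =>
      (∫ x in (0 : ℝ)..(max p.2 0), g x) - ∫ x in (0 : ℝ)..(max p.1 0), g x := by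
    funext p
    rw [intervalIntegral.integral_interval_sub_left (hloc _ _) (hloc _ _)]
    refine intervalIntegral.integral_congr fun x hx => ?_
    have : x ∈ Ici (0 : ℝ) := (le_min (le_max_right _ _) (le_max_right _ _)).trans hx.1
    simp only [g, indicator_of_mem this]
  rw [this]
  exact (Continuous.sub (hcont.comp (by fun_prop)) (hcont.comp (by fun_prop))).measurable

theorem measurable_segmentWeight (hγi : LocallyIntegrableOn γ (Ici 0)) (l : ℝ) {z : ℕ}
    {B : Set (Fin z → ℝ)} (hB : MeasurableSet B) {S : Type*} [MeasurableSpace S] {σ τ : S → ℝ}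
    (hσ : Measurable σ) (hτ : Measurable τ) (hσ0 : ∀ ω, 0 ≤ σ ω) (hτ0 : ∀ ω, 0 ≤ τ ω) :
    Measurable fun ω => segmentWeight γ l z B (σ ω) (τ ω) := by
  have h1 := (measurable_integral_rate hγi).comp (hσ.prodMk hτ)
  have h2 : Measurable fun ω => ∫ x in (σ ω)..(τ ω), γ x := by
    simpa [Function.comp_def, max_eq_left (hσ0 _), max_eq_left (hτ0 _)] using h1
  have h3 := (measurable_pi_orderedTimes (γ := γ) hB).comp (hσ.prodMk hτ)
  refine Measurable.mul (ENNReal.measurable_ofReal.comp ?_) h3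
  exact (Real.measurable_exp.comp (h2.const_mul l).neg).mul_const _

/-- The arithmetic of one induction step: a gap without arrival extends the exponential, and an
interval with one arrival also contributes its mean. -/
theorem ofReal_exp_neg_mul_poissonProb {a b c p : ℝ} (hp : 0 ≤ p) :
    ENNReal.ofReal (Real.exp (-a) * p) * poissonProb b 0 * poissonProb c 1 =
      ENNReal.ofReal (Real.exp (-(a + b + c)) * (p * c)) := by
  rw [poissonProb, poissonProb, ← ENNReal.ofReal_mul (by positivity),
    ← ENNReal.ofReal_mul (by positivity)]
  congr 1
  rw [neg_add, neg_add, Real.exp_add, Real.exp_add]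
  simp
  ring

theorem PoissonAfter.congr (hS : PoissonAfter P lam γ M N S U f) {S' : Set Ω} {f' : Ω → ENNReal}
    (hSS : S = S') (hff : ∀ ω, f ω = f' ω) : PoissonAfter P lam γ M N S' U f' := by
  obtain rfl : f = f' := funext hff
  exact hSS ▸ hS

/-- Induction on the number of sides already passed. Each one adds an increment `0` over the gap
before it and an increment `1` over the side; the exponents add up to the integral over everything
from `U` to the current end. -/
theorem PoissonAfter.orderedBox_prefix
    (hcr : ∀ {σ τ : Ω → ℝ}, Measurable[pathSigma M] σ →
      Measurable[pathSigma M] τ → (∀ ω, 0 ≤ σ ω) → (∀ ω, σ ω ≤ τ ω) →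
      Measurable[pathSigma M] fun ω => cumRate lam γ M ω (σ ω) (τ ω))
    (hlam : ∀ i, 0 ≤ lam i) (hγ : ∀ x, 0 ≤ x → 0 ≤ γ x) (hγi : LocallyIntegrableOn γ (Ici 0))
    (hm : pathSigma M ≤ (inferInstance : MeasurableSpace Ω))
    (hS : PoissonAfter P lam γ M N S U f) (hV : Measurable[pathSigma M] V)
    (hUV : ∀ ω, U ω ≤ V ω) {C : Set Ω} (hC : MeasurableSet[pathSigma M] C) {s : Fin r}
    (hCs : ∀ ω ∈ C, ∀ x ∈ Ico (U ω) (V ω), M x ω = s) {z : ℕ} {c d : ℕ → ℝ}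
    (hcd : ∀ i < z, c i ≤ d i) (hdc : ∀ i, i + 1 < z → d i ≤ c (i + 1)) (j : ℕ) (hj : j ≤ z) :
    PoissonAfter P lam γ M N
      (S ∩ C ∩ {ω | ∀ i < j, N (clamp (U ω) (V ω) (c i)) ω = N (U ω) ω + i ∧
        N (clamp (U ω) (V ω) (d i)) ω = N (U ω) ω + i + 1})
      (fun ω => Nat.casesOn j (U ω) fun i => clamp (U ω) (V ω) (d i))
      (C.indicator fun ω => f ω * ENNReal.ofReal
        (Real.exp (-(lam s * ∫ x in (U ω)..(Nat.casesOn j (U ω) fun i => clamp (U ω) (V ω) (d i)),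
          γ x)) * ∏ i ∈ Finset.range j,
            (lam s * ∫ x in (clamp (U ω) (V ω) (c i))..(clamp (U ω) (V ω) (d i)), γ x))) := by
  have hcl : ∀ x, Measurable[pathSigma M] fun ω => clamp (U ω) (V ω) x := fun x => by
    have hUm := hS.measurable_time
    let _ : MeasurableSpace Ω := pathSigma M
    exact hUm.max (measurable_const.min hV)
  induction j with
  | zero =>
    refine (hS.inter_path hm hC).congr (by simp) fun ω => ?_
    simp
  | succ j ih =>
    -- The end of the part already treated: `U` when no side has been passed, otherwise the clamped
    -- upper end of side `j - 1`.
    let D : Ω → ℝ := fun ω => Nat.casesOn j (U ω) fun i => clamp (U ω) (V ω) (d i)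
    have hDc : ∀ ω, D ω ≤ clamp (U ω) (V ω) (c j) := by
      intro ω
      cases j with
      | zero => exact le_clamp _ _ _
      | succ i => exact clamp_mono _ _ (hdc i (by omega))
    have hUD : ∀ ω, U ω ≤ D ω := by
      intro ω
      cases j with
      | zero => exact le_rfl
      | succ i => exact le_clamp _ _ _
    have hcdj : ∀ ω, clamp (U ω) (V ω) (c j) ≤ clamp (U ω) (V ω) (d j) := fun ω =>
      clamp_mono _ _ (hcd j (by omega))
    have h2 := ((ih (by omega)).increment hcr (hcl (c j)) hDc 0).increment hcr (hcl (d j)) hcdj 1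
    refine h2.congr ?_ fun ω => ?_
    -- Knowing the count at `D` converts counts relative to `U` into increments from `D`.
    · have hND : ∀ ω, (∀ i < j, N (clamp (U ω) (V ω) (c i)) ω = N (U ω) ω + i ∧
          N (clamp (U ω) (V ω) (d i)) ω = N (U ω) ω + i + 1) → N (D ω) ω = N (U ω) ω + j := by
        intro ω hω
        cases j with
        | zero => rfl
        | succ i => exact (hω i (by omega)).2
      ext ω
      simp only [mem_inter_iff, mem_ofPred_eq, and_assoc]
      refine and_congr_right fun _ => and_congr_right fun _ => ?_
      constructor
      · rintro ⟨h1, h3, h4⟩ i hi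
        have h3' : N (clamp (U ω) (V ω) (c j)) ω = N (D ω) ω + 0 := h3
        rcases Nat.lt_succ_iff_lt_or_eq.1 hi with hi | rfl
        · exact h1 i hi
        · have := hND ω h1
          omega
      · intro h1
        have h0 := hND ω fun i hi => h1 i (by omega)
        have h3 := h1 j (by omega)
        refine ⟨fun i hi => h1 i (by omega), ?_, by omega⟩
        change N (clamp (U ω) (V ω) (c j)) ω = N (D ω) ω + 0
        omega
    · by_cases hω : ω ∈ C
      · simp only [indicator_of_mem hω]
        have h0 := hS.nonneg ω
        have hle : ∀ x, clamp (U ω) (V ω) x ≤ V ω := clamp_le (hUV ω)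
        have e1 : cumRate lam γ M ω (D ω) (clamp (U ω) (V ω) (c j)) =
            lam s * ∫ x in (D ω)..(clamp (U ω) (V ω) (c j)), γ x :=
          cumRate_eq_of_const (hDc ω) fun x hx =>
            hCs ω hω x ⟨(hUD ω).trans hx.1, hx.2.trans_le (hle _)⟩
        have e2 : cumRate lam γ M ω (clamp (U ω) (V ω) (c j)) (clamp (U ω) (V ω) (d j)) =
            lam s * ∫ x in (clamp (U ω) (V ω) (c j))..(clamp (U ω) (V ω) (d j)), γ x :=
          cumRate_eq_of_const (hcdj ω) fun x hx =>
            hCs ω hω x ⟨(le_clamp _ _ _).trans hx.1, hx.2.trans_le (hle _)⟩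
        change f ω * ENNReal.ofReal (Real.exp (-(lam s * ∫ x in (U ω)..(D ω), γ x)) * _) *
          poissonProb (cumRate lam γ M ω (D ω) (clamp (U ω) (V ω) (c j))) 0 * _ = _
        rw [e1, e2, mul_assoc, mul_assoc, ← mul_assoc (ENNReal.ofReal _),
          ofReal_exp_neg_mul_poissonProb, Finset.prod_range_succ]
        · congr 5
          rw [← mul_add, ← mul_add]
          have hi : ∀ {a b : ℝ}, U ω ≤ a → U ω ≤ b → IntervalIntegrable γ volume a b :=
            fun ha hb => rate_intervalIntegrable hγi (h0.trans ha) (h0.trans hb)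
          rw [intervalIntegral.integral_add_adjacent_intervals (hi le_rfl (hUD ω))
            (hi (hUD ω) (le_clamp _ _ _)), intervalIntegral.integral_add_adjacent_intervals
            (hi le_rfl (le_clamp _ _ _)) (hi (le_clamp _ _ _) (le_clamp _ _ _))]
        · refine Finset.prod_nonneg fun i hi => mul_nonneg (hlam s) ?_
          refine intervalIntegral.integral_nonneg (clamp_mono _ _ (hcd i ?_)) fun x hx =>
            hγ x (h0.trans ((le_clamp _ _ _).trans hx.1))
          have := Finset.mem_range.1 hi
          omega
      · simp [indicator_of_notMem hω]

/-- After the last side no arrival may occur before `V`, which completes the exponent to the whole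
interval. The factors `λ_s` collect into a power and the integrals into the mass of the box. -/
theorem PoissonAfter.orderedBox
    (hcr : ∀ {σ τ : Ω → ℝ}, Measurable[pathSigma M] σ →
      Measurable[pathSigma M] τ → (∀ ω, 0 ≤ σ ω) → (∀ ω, σ ω ≤ τ ω) →
      Measurable[pathSigma M] fun ω => cumRate lam γ M ω (σ ω) (τ ω))
    (hlam : ∀ i, 0 ≤ lam i) (hγ : ∀ x, 0 ≤ x → 0 ≤ γ x) (hγi : LocallyIntegrableOn γ (Ici 0))
    (hm : pathSigma M ≤ (inferInstance : MeasurableSpace Ω))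
    (hN : ∀ ω t, 0 ≤ t → ContinuousWithinAt (fun x => N x ω) (Ici t) t)
    (hmono : ∀ ω, MonotoneOn (fun t => N t ω) (Ici 0))
    (hS : PoissonAfter P lam γ M N S U f) (hV : Measurable[pathSigma M] V)
    (hUV : ∀ ω, U ω ≤ V ω) {C : Set Ω} (hC : MeasurableSet[pathSigma M] C) {s : Fin r}
    (hCs : ∀ ω ∈ C, ∀ x ∈ Ico (U ω) (V ω), M x ω = s) {z : ℕ} {c d : ℕ → ℝ}
    (hcd : ∀ i < z, c i ≤ d i) (hdc : ∀ i, i + 1 < z → d i ≤ c (i + 1)) :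
    PoissonAfter P lam γ M N
      (S ∩ (C ∩ {ω | N (V ω) ω = N (U ω) ω + z ∧ arrivals N (U ω) z ω ∈ orderedBox z c d})) V
      (fun ω => f ω * C.indicator
        (fun ω => segmentWeight γ (lam s) z (MMNPP.orderedBox z c d) (U ω) (V ω)) ω) := by
  let D : Ω → ℝ := fun ω => Nat.casesOn z (U ω) fun i => clamp (U ω) (V ω) (d i)
  have hDV : ∀ ω, D ω ≤ V ω := by
    intro ω
    cases z with
    | zero => exact hUV ω
    | succ i => exact clamp_le (hUV ω) _
  have hUD : ∀ ω, U ω ≤ D ω := by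
    intro ω
    cases z with
    | zero => exact le_rfl
    | succ i => exact le_clamp _ _ _
  have h1 := (PoissonAfter.orderedBox_prefix hcr hlam hγ hγi hm hS hV hUV hC hCs hcd hdc z
    le_rfl).increment hcr hV hDV 0
  refine h1.congr ?_ fun ω => ?_
  · have hND : ∀ ω, (∀ i < z, N (clamp (U ω) (V ω) (c i)) ω = N (U ω) ω + i ∧
        N (clamp (U ω) (V ω) (d i)) ω = N (U ω) ω + i + 1) → N (D ω) ω = N (U ω) ω + z := by
      intro ω hω
      cases z with
      | zero => rfl
      | succ i => exact (hω i (by omega)).2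
    ext ω
    simp only [mem_inter_iff, mem_ofPred_eq, and_assoc]
    refine and_congr_right fun _ => and_congr_right fun _ => ?_
    rw [arrivals_mem_orderedBox_iff hN hmono (hS.nonneg ω) (hUV ω) hdc, and_comm]
    refine and_congr_left fun hω => ?_
    change N (V ω) ω = N (D ω) ω + 0 ↔ _
    rw [hND ω hω, add_zero]
  · by_cases hω : ω ∈ C
    · simp only [indicator_of_mem hω]
      have h0 := hS.nonneg ω
      have e1 : cumRate lam γ M ω (D ω) (V ω) = lam s * ∫ x in (D ω)..(V ω), γ x :=
        cumRate_eq_of_const (hDV ω) fun x hx => hCs ω hω x ⟨(hUD ω).trans hx.1, hx.2⟩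
      have hnn : ∀ i ∈ Finset.range z,
          0 ≤ ∫ x in (clamp (U ω) (V ω) (c i))..(clamp (U ω) (V ω) (d i)), γ x := fun i hi =>
        intervalIntegral.integral_nonneg (clamp_mono _ _ (hcd i (Finset.mem_range.1 hi)))
          fun x hx => hγ x (h0.trans ((le_clamp _ _ _).trans hx.1))
      change f ω * ENNReal.ofReal (Real.exp (-(lam s * ∫ x in (U ω)..(D ω), γ x)) * _) *
          poissonProb (cumRate lam γ M ω (D ω) (V ω)) 0 = _
      rw [e1, mul_assoc, segmentWeight, pi_orderedBox hγ hγi h0 hcd hdc,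
        ← ENNReal.ofReal_prod_of_nonneg hnn, poissonProb, ← ENNReal.ofReal_mul,
        ← ENNReal.ofReal_mul]
      · congr 2
        rw [← intervalIntegral.integral_add_adjacent_intervals
          (rate_intervalIntegrable hγi h0 (h0.trans (hUD ω)))
          (rate_intervalIntegrable hγi (h0.trans (hUD ω)) (h0.trans (hUV ω))), mul_add, neg_add,
          Real.exp_add, Finset.prod_mul_distrib]
        simp
        ring
      · have := hlam s
        positivity
      · have := hlam s
        exact mul_nonneg (Real.exp_nonneg _) (Finset.prod_nonneg fun i hi =>
          mul_nonneg this (hnn i hi))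
    · simp [indicator_of_notMem hω]

/-- Given the path of the chain, which is constant between the random times `U` and `V`, the
arrivals between these times have the ordered density, and what follows `V` stays Poisson. -/
theorem PoissonAfter.arrivals [IsProbabilityMeasure P] (h : IsMMNPP P π q lam γ M N)
    (hlam : ∀ i, 0 ≤ lam i) (hγ : ∀ x, 0 ≤ x → 0 ≤ γ x) (hγi : LocallyIntegrableOn γ (Ici 0))
    (hS : PoissonAfter P lam γ M N S U f) (hV : Measurable[pathSigma M] V)
    (hUV : ∀ ω, U ω ≤ V ω) {C : Set Ω} (hC : MeasurableSet[pathSigma M] C) {s : Fin r}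
    (hCs : ∀ ω ∈ C, ∀ x ∈ Ico (U ω) (V ω), M x ω = s) {z : ℕ} {B : Set (Fin z → ℝ)}
    (hB : MeasurableSet B) :
    PoissonAfter P lam γ M N
      (S ∩ (C ∩ {ω | N (V ω) ω = N (U ω) ω + z ∧ MMNPP.arrivals N (U ω) z ω ∈ B})) V
      (fun ω => f ω * C.indicator (fun ω => segmentWeight γ (lam s) z B (U ω) (V ω)) ω) := by
  have hm := h.pathSigma_le
  have hcr : ∀ {σ τ : Ω → ℝ}, Measurable[pathSigma M] σ →
      Measurable[pathSigma M] τ → (∀ ω, 0 ≤ σ ω) → (∀ ω, σ ω ≤ τ ω) →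
      Measurable[pathSigma M] fun ω => cumRate lam γ M ω (σ ω) (τ ω) :=
    fun h1 h2 h3 h4 => measurable_cumRate hγi h.chain.rightCont h1 h2 h3 h4
  have hV0 : ∀ ω, 0 ≤ V ω := fun ω => (hS.nonneg ω).trans (hUV ω)
  refine ⟨hV, hV0, ?_, ?_⟩
  · have hUm := hS.measurable_time
    have hfm := hS.measurable_weight
    have hU0 := hS.nonneg
    let _ : MeasurableSpace Ω := pathSigma M
    exact hfm.mul ((measurable_segmentWeight hγi _ hB hUm hV hU0 hV0).indicator hC)
  intro A hA n τ zz hτ h0 hmono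
  have harr : Measurable fun ω => MMNPP.arrivals N (U ω) z ω :=
    measurable_arrivals h.rightCont h.mono h.measurable (hS.measurable_time.mono hm le_rfl)
      hS.nonneg z
  let g : Ω → ENNReal := fun ω => ∏ k ∈ Finset.range n,
    poissonProb (cumRate lam γ M ω (τ k ω) (τ (k + 1) ω)) (zz k)
  have hτ0 : ∀ k ω, 0 ≤ τ k ω := fun k ω => by
    have := hmono ω k.zero_le
    simp only [h0] at this
    exact (hV0 ω).trans this
  have hg : Measurable g := Finset.measurable_prod _ fun k _ =>
    (continuous_poissonProb _).measurable.comp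
      ((hcr (hτ k) (hτ (k + 1)) (hτ0 k) fun ω => hmono ω k.le_succ).mono hm le_rfl)
  let E : Set Ω := A ∩ (S ∩ (C ∩ {ω | N (V ω) ω = N (U ω) ω + z}) ∩ gridEvent N n τ zz)
  let w : Ω → ENNReal := fun ω => f ω * C.indicator (fun ω => ENNReal.ofReal
    (Real.exp (-(lam s * ∫ x in (U ω)..(V ω), γ x)) * lam s ^ z)) ω * g ω
  let κ : Ω → Measure (Fin z → ℝ) := fun ω =>
    (Measure.pi fun _ : Fin z => rateMeasure γ).restrict (orderedTimes z (U ω) (V ω))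
  have hU' := hS.measurable_time.mono hm le_rfl
  have hV' := hV.mono hm le_rfl
  have hκ : Measurable κ := by
    refine Measure.measurable_of_measurable_coe _ fun B hB => ?_
    simp only [κ, Measure.restrict_apply hB]
    exact (measurable_pi_orderedTimes hB).comp (hU'.prodMk hV')
  have hw : Measurable w := by
    refine ((hS.measurable_weight.mono hm le_rfl).mul (Measurable.indicator ?_ (hm _ hC))).mul hg
    have h1 := (measurable_integral_rate hγi).comp (hU'.prodMk hV')
    have h2 : Measurable fun ω => ∫ x in (U ω)..(V ω), γ x := by
      simpa [Function.comp_def, max_eq_left (hS.nonneg _), max_eq_left (hV0 _)] using h1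
    exact ENNReal.measurable_ofReal.comp ((Real.measurable_exp.comp (h2.const_mul _).neg).mul_const _)
  let μ := (P.restrict E).map fun ω => MMNPP.arrivals N (U ω) z ω
  let ν := Measure.bind ((P.restrict A).withDensity w) κ
  have hμ : ∀ {B : Set (Fin z → ℝ)}, MeasurableSet B → μ B =
      P (A ∩ (S ∩ (C ∩ {ω | N (V ω) ω = N (U ω) ω + z ∧ MMNPP.arrivals N (U ω) z ω ∈ B}) ∩
        gridEvent N n τ zz)) := by
    intro B hB
    rw [Measure.map_apply harr hB, Measure.restrict_apply (harr hB)]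
    congr 1
    ext ω
    simp only [E, mem_inter_iff, mem_preimage, mem_ofPred_eq]
    tauto
  have hν : ∀ {B : Set (Fin z → ℝ)}, MeasurableSet B → ν B =
      ∫⁻ ω in A, f ω * C.indicator (fun ω => segmentWeight γ (lam s) z B (U ω) (V ω)) ω * g ω ∂P := by
    intro B hB
    rw [Measure.bind_apply hB hκ.aemeasurable]
    refine (lintegral_withDensity_eq_lintegral_mul _ hw
      ((Measure.measurable_coe hB).comp hκ)).trans (lintegral_congr fun ω => ?_)
    by_cases hω : ω ∈ C
    · simp only [Pi.mul_apply, Function.comp_apply, w, κ, indicator_of_mem hω, segmentWeight,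
        Measure.restrict_apply hB]
      ring
    · simp [w, indicator_of_notMem hω]
  have hmain : μ = ν := by
    refine measure_eq_of_orderedBox μ ν ?_ ?_ fun c d hcd hdc => ?_
    · rw [Measure.bind_apply (measurableSet_strictMono z).compl hκ.aemeasurable]
      refine (lintegral_congr fun ω => ?_).trans lintegral_zero
      rw [Measure.restrict_apply (measurableSet_strictMono z).compl]
      refine measure_mono_null ?_ measure_empty
      rintro t ⟨h1, h2⟩
      exact h1 h2.1
    · rw [hμ MeasurableSet.univ, hν MeasurableSet.univ]
      -- Total mass needs only the number of arrivals, hence a single increment from `U` to `V`.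
      have := ((hS.inter_path hm hC).increment hcr hV hUV z).measure_eq A hA n τ zz hτ h0 hmono
      convert this using 1
      · congr 1
        ext ω
        simp only [mem_inter_iff, mem_ofPred_eq, mem_univ, and_true]
        tauto
      · refine lintegral_congr fun ω => ?_
        congr 1
        by_cases hω : ω ∈ C
        · simp only [indicator_of_mem hω]
          rw [segmentWeight_univ hγ hγi (hlam s) z (hS.nonneg ω) (hUV ω),
            cumRate_eq_of_const (hUV ω) (hCs ω hω)]
        · simp [indicator_of_notMem hω]
    · rw [hμ (measurableSet_orderedBox z c d), hν (measurableSet_orderedBox z c d)]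
      exact (PoissonAfter.orderedBox hcr hlam hγ hγi hm h.rightCont h.mono hS hV hUV hC hCs hcd
        hdc).measure_eq A hA n τ zz hτ h0 hmono
  rw [← hμ hB, hmain, hν hB]

end

/-! ### Jump times: strict growth and path measurability. -/

section jumps
variable {Ω : Type*} {r : ℕ} {M : ℝ → Ω → Fin r}

theorem jumpTime_zero (ω : Ω) : jumpTime M ω 0 = 0 := rfl

theorem jumpTime_succ (ω : Ω) (n : ℕ) : jumpTime M ω (n + 1) = sInf ((fun t : ℝ => (t : EReal)) ''
    {t : ℝ | jumpTime M ω n ≤ (t : EReal) ∧ M t ω ≠ M (jumpTime M ω n).toReal ω}) := rfl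

theorem jumpTime_le_succ (ω : Ω) (n : ℕ) : jumpTime M ω n ≤ jumpTime M ω (n + 1) := by
  rw [jumpTime_succ]
  refine le_sInf ?_
  rintro _ ⟨t, ht, rfl⟩
  exact ht.1

theorem jumpTime_mono (ω : Ω) : Monotone (jumpTime M ω) :=
  monotone_nat_of_le_succ (jumpTime_le_succ ω)

theorem jumpTime_nonneg (ω : Ω) (n : ℕ) : 0 ≤ jumpTime M ω n :=
  (jumpTime_zero (M := M) ω).symm.le.trans (jumpTime_mono ω n.zero_le)

theorem jumpTime_ne_bot (ω : Ω) (n : ℕ) : jumpTime M ω n ≠ ⊥ :=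
  fun h => absurd (jumpTime_nonneg (M := M) ω n) (by rw [h]; simp)

theorem coe_toReal_jumpTime {ω : Ω} {n : ℕ} (h : jumpTime M ω n ≠ ⊤) :
    ((jumpTime M ω n).toReal : EReal) = jumpTime M ω n :=
  EReal.coe_toReal h (jumpTime_ne_bot ω n)

theorem toReal_jumpTime_nonneg (ω : Ω) (n : ℕ) : 0 ≤ (jumpTime M ω n).toReal :=
  EReal.toReal_nonneg (jumpTime_nonneg ω n)

theorem eq_of_lt_jumpTime_succ {ω : Ω} {n : ℕ} {x : ℝ} (h1 : jumpTime M ω n ≤ x)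
    (h2 : (x : EReal) < jumpTime M ω (n + 1)) : M x ω = M (jumpTime M ω n).toReal ω := by
  by_contra hne
  refine absurd h2 (not_lt.2 ?_)
  rw [jumpTime_succ]
  exact sInf_le ⟨x, ⟨h1, hne⟩, rfl⟩

/-- A right-continuous path with discrete values keeps its state for a positive time. -/
theorem jumpTime_lt_succ
    (hM : ∀ ω t, 0 ≤ t → ContinuousWithinAt (fun x => M x ω) (Ici t) t)
    {ω : Ω} {n : ℕ} (h : jumpTime M ω n ≠ ⊤) :
    jumpTime M ω n < jumpTime M ω (n + 1) := by
  obtain ⟨u, hu, hconst⟩ := exists_eq_Ico hM ω (toReal_jumpTime_nonneg ω n)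
  rw [← EReal.coe_lt_coe_iff, coe_toReal_jumpTime h] at hu
  refine hu.trans_le ?_
  rw [jumpTime_succ]
  refine le_sInf ?_
  rintro _ ⟨t, ht, rfl⟩
  by_contra hlt
  have h1 : t < u := EReal.coe_lt_coe_iff.1 (not_le.1 hlt)
  refine ht.2 (hconst t ⟨?_, h1⟩)
  rw [← EReal.coe_le_coe_iff, coe_toReal_jumpTime h]
  exact ht.1

/-- By right-continuity a witness of a change of state can be moved slightly to the right to a
rational time, which makes the event a countable union. -/
theorem jumpTime_succ_lt_iff
    (hM : ∀ ω t, 0 ≤ t → ContinuousWithinAt (fun x => M x ω) (Ici t) t)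
    {ω : Ω} {n : ℕ} {c : EReal} : jumpTime M ω (n + 1) < c ↔
    ∃ p : ℚ, (0 : ℝ) ≤ p ∧ ((p : ℝ) : EReal) < c ∧ jumpTime M ω n ≤ ((p : ℝ) : EReal) ∧
      M p ω ≠ M (jumpTime M ω n).toReal ω := by
  constructor
  · intro h
    rw [jumpTime_succ, sInf_lt_iff] at h
    obtain ⟨_, ⟨t, ht, rfl⟩, htc⟩ := h
    have ht0 : (0 : ℝ) ≤ t := by
      have := (jumpTime_nonneg ω n).trans ht.1
      exact_mod_cast this
    obtain ⟨u, hu, hconst⟩ := exists_eq_Ico hM ω ht0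
    obtain ⟨p, hp1, hp2⟩ := EReal.lt_iff_exists_rat_btwn.1
      (lt_min htc (EReal.coe_lt_coe_iff.2 hu))
    have hp3 : t < p := EReal.coe_lt_coe_iff.1 hp1
    have hp4 : (p : ℝ) < u := EReal.coe_lt_coe_iff.1 (hp2.trans_le (min_le_right _ _))
    refine ⟨p, ht0.trans hp3.le, hp2.trans_le (min_le_left _ _), ht.1.trans hp1.le, ?_⟩
    rw [hconst p ⟨hp3.le, hp4⟩]
    exact ht.2
  · rintro ⟨p, _, hpc, hp, hne⟩
    refine lt_of_le_of_lt ?_ hpc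
    rw [jumpTime_succ]
    exact sInf_le ⟨p, ⟨hp, hne⟩, rfl⟩

theorem measurable_state_at
    (hM : ∀ ω t, 0 ≤ t → ContinuousWithinAt (fun x => M x ω) (Ici t) t)
    {τ : Ω → ℝ} (hτ : Measurable[pathSigma M] τ) (h0 : ∀ ω, 0 ≤ τ ω) :
    Measurable[pathSigma M] fun ω => M (τ ω) ω := by
  let _ : MeasurableSpace Ω := pathSigma M
  exact measurable_sample (ρ := id) hM (fun t ht => measurable_path_pathSigma ht) hτ h0

theorem measurable_jumpTime
    (hM : ∀ ω t, 0 ≤ t → ContinuousWithinAt (fun x => M x ω) (Ici t) t)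
    (n : ℕ) : Measurable[pathSigma M] fun ω => jumpTime M ω n := by
  let _ : MeasurableSpace Ω := pathSigma M
  induction n with
  | zero => exact measurable_const
  | succ n ih =>
    have h1 : Measurable fun ω => M (jumpTime M ω n).toReal ω :=
      measurable_state_at hM ih.ereal_toReal fun ω => toReal_jumpTime_nonneg ω n
    refine measurable_of_Iio fun c => ?_
    have : (fun ω => jumpTime M ω (n + 1)) ⁻¹' Iio c = ⋃ p : ℚ, ⋃ _ : (0 : ℝ) ≤ p,
        ⋃ _ : ((p : ℝ) : EReal) < c, {ω | jumpTime M ω n ≤ ((p : ℝ) : EReal)} ∩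
          {ω | M p ω = M (jumpTime M ω n).toReal ω}ᶜ := by
      ext ω
      simp only [mem_preimage, mem_Iio, jumpTime_succ_lt_iff hM, mem_iUnion, mem_inter_iff,
        mem_ofPred_eq, mem_compl_iff, exists_prop, ne_eq]
    rw [this]
    refine MeasurableSet.iUnion fun p => MeasurableSet.iUnion fun hp => MeasurableSet.iUnion
      fun _ => (measurableSet_le ih measurable_const).inter (MeasurableSet.compl ?_)
    exact measurableSet_eq_fun (measurable_path_pathSigma hp) h1

theorem measurable_regimeTime
    (hM : ∀ ω t, 0 ≤ t → ContinuousWithinAt (fun x => M x ω) (Ici t) t)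
    (T : ℝ) (k : ℕ) : Measurable[pathSigma M] (regimeTime M T k) := by
  have h1 := measurable_jumpTime hM k
  let _ : MeasurableSpace Ω := pathSigma M
  exact (h1.min measurable_const).ereal_toReal

/-- Rational times suffice: the state at `x` is seen at a rational just after `x` and still before
`b`. -/
theorem measurableSet_const_on (hM : ∀ ω t, 0 ≤ t → ContinuousWithinAt (fun x => M x ω) (Ici t) t)
    {a : ℝ} (b : ℝ) (ha : 0 ≤ a) (s : Fin r) :
    MeasurableSet[pathSigma M] {ω | ∀ x ∈ Ico a b, M x ω = s} := by
  have : {ω | ∀ x ∈ Ico a b, M x ω = s} =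
      ⋂ p : ℚ, ⋂ _ : (p : ℝ) ∈ Ico a b, {ω | M p ω = s} := by
    ext ω
    simp only [mem_ofPred_eq, mem_iInter]
    refine ⟨fun h p hp => h p hp, fun h x hx => ?_⟩
    obtain ⟨u, hu, hconst⟩ := exists_eq_Ico hM ω (ha.trans hx.1)
    obtain ⟨p, hp1, hp2⟩ := exists_rat_btwn (lt_min hu hx.2)
    rw [← hconst p ⟨hp1.le, hp2.trans_le (min_le_left _ _)⟩]
    exact h p ⟨hx.1.trans hp1.le, hp2.trans_le (min_le_right _ _)⟩
  rw [this]
  exact MeasurableSet.iInter fun p => MeasurableSet.iInter fun hp =>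
    measurable_path_pathSigma (ha.trans hp.1) (measurableSet_singleton s)

end jumps

/-! ### Regime boundaries inside the observation window. -/

section regimes
variable {Ω : Type*} {r : ℕ} {M : ℝ → Ω → Fin r} {T : ℝ}

theorem coe_regimeTime (hT : 0 ≤ T) (k : ℕ) (ω : Ω) :
    (regimeTime M T k ω : EReal) = min (jumpTime M ω k) T := by
  refine EReal.coe_toReal ?_ ?_
  · exact ((min_le_right _ _).trans_lt (EReal.coe_lt_top T)).ne
  · refine (lt_of_lt_of_le EReal.bot_lt_zero (le_min (jumpTime_nonneg ω k) ?_)).ne'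
    exact_mod_cast hT

theorem regimeTime_mono (hT : 0 ≤ T) (ω : Ω) : Monotone fun k => regimeTime M T k ω := by
  intro k l h
  rw [← EReal.coe_le_coe_iff, coe_regimeTime hT, coe_regimeTime hT]
  exact min_le_min_right _ (jumpTime_mono ω h)

theorem regimeTime_nonneg (hT : 0 ≤ T) (k : ℕ) (ω : Ω) : 0 ≤ regimeTime M T k ω := by
  rw [← EReal.coe_le_coe_iff, coe_regimeTime hT]
  exact le_min (jumpTime_nonneg ω k) (by exact_mod_cast hT)

theorem regimeTime_of_lt {k : ℕ} {ω : Ω} (h : jumpTime M ω k < T) :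
    regimeTime M T k ω = (jumpTime M ω k).toReal := by
  rw [regimeTime, min_eq_left h.le]

theorem regimeTime_of_ge {k : ℕ} {ω : Ω} (h : (T : EReal) ≤ jumpTime M ω k) :
    regimeTime M T k ω = T := by
  rw [regimeTime, min_eq_right h, EReal.toReal_coe]

theorem eq_on_regime (hT : 0 ≤ T) {k : ℕ} {ω : Ω} {x : ℝ}
    (hx : x ∈ Ico (regimeTime M T k ω) (regimeTime M T (k + 1) ω)) :
    M x ω = M (regimeTime M T k ω) ω := by
  obtain ⟨h1, h2⟩ := hx
  rw [← EReal.coe_lt_coe_iff, coe_regimeTime hT] at h2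
  rw [← EReal.coe_le_coe_iff, coe_regimeTime hT] at h1
  have hxJ := h2.trans_le (min_le_left _ _)
  -- A nonempty regime interval must start at a genuine jump time before `T`, not at the cap.
  have hJ : jumpTime M ω k < T := by
    by_contra hge
    rw [min_eq_right (not_lt.1 hge)] at h1
    exact absurd (h2.trans_le (min_le_right _ _)) h1.not_gt
  rw [regimeTime_of_lt hJ]
  rw [min_eq_left hJ.le] at h1
  exact eq_of_lt_jumpTime_succ h1 hxJ

end regimes

/-! ### The conditional law of arrivals on a fixed interval. -/

section conditional
variable {Ω : Type*} {r : ℕ} [MeasurableSpace Ω] {P : Measure Ω}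
    {π : Fin r → ℝ} {q : Fin r → Fin r → ℝ} {lam : Fin r → ℝ} {γ : ℝ → ℝ}
    {M : ℝ → Ω → Fin r} {N : ℝ → Ω → ℕ}

theorem setLIntegral_prod_ofReal (hγi : LocallyIntegrableOn γ (Ici 0)) {a b : ℝ} (ha : 0 ≤ a)
    {z : ℕ} {B : Set (Fin z → ℝ)} (hB : MeasurableSet B) :
    ∫⁻ t in B ∩ orderedTimes z a b, ∏ i, ENNReal.ofReal (γ (t i)) =
      Measure.pi (fun _ : Fin z => rateMeasure γ) (B ∩ orderedTimes z a b) := by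
  have hm := hB.inter (measurableSet_orderedTimes z a b)
  rw [pi_rateMeasure hγi, withDensity_apply _ hm]
  refine setLIntegral_congr_fun hm fun t ht => Finset.prod_congr rfl fun i _ => ?_
  have : t i ∈ Ici (0 : ℝ) := ha.trans (ht.2.2 i).1.le
  rw [rateDensity, indicator_of_mem this]

theorem ofReal_arrivalDensity (hγ : ∀ x, 0 ≤ x → 0 ≤ γ x) {a b : ℝ} (ha : 0 ≤ a) (hab : a ≤ b)
    {z : ℕ} {t : Fin z → ℝ} (ht : t ∈ orderedTimes z a b) :
    ENNReal.ofReal (arrivalDensity γ a b z t) =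
      ENNReal.ofReal (z.factorial / (∫ x in a..b, γ x) ^ z) * ∏ i, ENNReal.ofReal (γ (t i)) := by
  have h0 : 0 ≤ ∫ x in a..b, γ x :=
    intervalIntegral.integral_nonneg hab fun x hx => hγ x (ha.trans hx.1)
  rw [arrivalDensity, ENNReal.ofReal_mul (by positivity), ENNReal.ofReal_prod_of_nonneg]
  exact fun i _ => hγ _ (ha.trans (ht.2 i).1.le)

theorem setLIntegral_arrivalDensity (hγ : ∀ x, 0 ≤ x → 0 ≤ γ x)
    (hγi : LocallyIntegrableOn γ (Ici 0)) {a b : ℝ} (ha : 0 ≤ a) (hab : a ≤ b)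
    {z : ℕ} {B : Set (Fin z → ℝ)} (hB : MeasurableSet B) :
    ∫⁻ t in B ∩ orderedTimes z a b, ENNReal.ofReal (arrivalDensity γ a b z t) =
      ENNReal.ofReal (z.factorial / (∫ x in a..b, γ x) ^ z) *
        Measure.pi (fun _ : Fin z => rateMeasure γ) (B ∩ orderedTimes z a b) := by
  rw [← setLIntegral_prod_ofReal hγi ha hB, ← lintegral_const_mul' _ _ ENNReal.ofReal_ne_top]
  exact setLIntegral_congr_fun (hB.inter (measurableSet_orderedTimes z a b)) fun t ht =>
    ofReal_arrivalDensity hγ ha hab ht.2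

theorem setIntegral_arrivalDensity (hγ : ∀ x, 0 ≤ x → 0 ≤ γ x)
    (hγi : LocallyIntegrableOn γ (Ici 0)) {a b : ℝ} (ha : 0 ≤ a) (hab : a ≤ b)
    {z : ℕ} {B : Set (Fin z → ℝ)} (hB : MeasurableSet B) :
    ∫ t in B ∩ orderedTimes z a b, arrivalDensity γ a b z t =
      (ENNReal.ofReal (z.factorial / (∫ x in a..b, γ x) ^ z) *
        Measure.pi (fun _ : Fin z => rateMeasure γ) (B ∩ orderedTimes z a b)).toReal := by
  have hm := hB.inter (measurableSet_orderedTimes z a b)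
  have h0 : 0 ≤ ∫ x in a..b, γ x :=
    intervalIntegral.integral_nonneg hab fun x hx => hγ x (ha.trans hx.1)
  rw [← setLIntegral_arrivalDensity hγ hγi ha hab hB, integral_eq_lintegral_of_nonneg_ae]
  · refine (ae_restrict_iff' hm).2 (Filter.Eventually.of_forall fun t ht => ?_)
    exact mul_nonneg (by positivity) (Finset.prod_nonneg fun i _ =>
      hγ _ (ha.trans (ht.2.2 i).1.le))
  · have h1 : AEMeasurable (fun t : Fin z → ℝ => ∏ i, (Ici (0 : ℝ)).indicator γ (t i)) volume :=
      Finset.aemeasurable_fun_prod _ fun i _ => (aemeasurable_indicator_rate hγi).comp_quasiMeasurePreserving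
        (Measure.quasiMeasurePreserving_eval (μ := fun _ : Fin z => (volume : Measure ℝ)) i)
    refine ((h1.restrict.const_mul (z.factorial / (∫ x in a..b, γ x) ^ z)).congr ((ae_restrict_iff' hm).2
      (Filter.Eventually.of_forall fun t ht => ?_))).aestronglyMeasurable
    simp only [arrivalDensity]
    congr 1
    refine Finset.prod_congr rfl fun i _ => ?_
    have : t i ∈ Ici (0 : ℝ) := ha.trans (ht.2.2 i).1.le
    rw [indicator_of_mem this]

/-- The probability of arrival times in `B`, given that there are `z` arrivals. -/
theorem arrivalDensity_mul_segmentWeight_univ (hγ : ∀ x, 0 ≤ x → 0 ≤ γ x)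
    (hγi : LocallyIntegrableOn γ (Ici 0)) {a b : ℝ} (ha : 0 ≤ a) (hab : a ≤ b) {l : ℝ}
    {z : ℕ} {B : Set (Fin z → ℝ)} :
    ENNReal.ofReal (z.factorial / (∫ x in a..b, γ x) ^ z) *
        Measure.pi (fun _ : Fin z => rateMeasure γ) (B ∩ orderedTimes z a b) *
        segmentWeight γ l z univ a b = segmentWeight γ l z B a b := by
  have h0 : 0 ≤ ∫ x in a..b, γ x :=
    intervalIntegral.integral_nonneg hab fun x hx => hγ x (ha.trans hx.1)
  have hord := pi_orderedTimes hγ hγi ha hab z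
  -- Here division by zero makes the coefficient `0`, but the simplex is then null and both sides
  -- vanish. With `z = 0` the power is `1`, so the other case applies.
  by_cases hz : (∫ x in a..b, γ x) ^ z = 0
  · have h1 : Measure.pi (fun _ : Fin z => rateMeasure γ) (B ∩ orderedTimes z a b) = 0 := by
      refine measure_mono_null inter_subset_right ?_
      rw [hord, hz]
      simp
    simp [segmentWeight, h1]
  · rw [segmentWeight, segmentWeight, univ_inter, hord]
    have h2 : ENNReal.ofReal (z.factorial / (∫ x in a..b, γ x) ^ z) *
        ENNReal.ofReal ((∫ x in a..b, γ x) ^ z / z.factorial) = 1 := by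
      rw [← ENNReal.ofReal_mul (by positivity), div_mul_div_comm, mul_comm, div_self]
      · simp
      · exact mul_ne_zero hz (by exact_mod_cast z.factorial_ne_zero)
    calc _ = (ENNReal.ofReal (z.factorial / (∫ x in a..b, γ x) ^ z) *
          ENNReal.ofReal ((∫ x in a..b, γ x) ^ z / z.factorial)) *
          (ENNReal.ofReal (Real.exp (-(l * ∫ x in a..b, γ x)) * l ^ z) *
          Measure.pi (fun _ : Fin z => rateMeasure γ) (B ∩ orderedTimes z a b)) := by ring
      _ = _ := by rw [h2, one_mul]

theorem count_sub_eq_iff (h : IsMMNPP P π q lam γ M N) {ω : Ω} {a b : ℝ} (ha : 0 ≤ a) (hab : a ≤ b)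
    {z : ℕ} : N b ω - N a ω = z ↔ N b ω = N a ω + z := by
  have : N a ω ≤ N b ω := h.mono ω ha (ha.trans hab) hab
  omega

theorem PoissonAfter.measure_inter {S : Set Ω} {U : Ω → ℝ} {f : Ω → ENNReal}
    (hS : PoissonAfter P lam γ M N S U f) {A : Set Ω} (hA : MeasurableSet[pathSigma M] A) :
    P (A ∩ S) = ∫⁻ ω in A, f ω ∂P := by
  have := hS.measure_eq A hA 0 (fun _ => U) (fun _ => 0) (fun _ => hS.measurable_time) rfl
    fun ω => monotone_const
  simpa [gridEvent] using this

/-- The law of the arrival times in a fixed interval, given a constant state and the number of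
arrivals. -/
theorem IsMMNPP.cond_arrivals [IsProbabilityMeasure P] (h : IsMMNPP P π q lam γ M N)
    (hlam : ∀ i, 0 ≤ lam i) (hγ : ∀ x, 0 ≤ x → 0 ≤ γ x) (hγi : LocallyIntegrableOn γ (Ici 0))
    {a b : ℝ} {s : Fin r} {z : ℕ} (ha : 0 ≤ a) (hab : a < b)
    (hpos : P ({ω | ∀ x ∈ Ico a b, M x ω = s} ∩ {ω | N b ω - N a ω = z}) ≠ 0)
    {B : Set (Fin z → ℝ)} (hB : MeasurableSet B) :
    P[{ω | arrivals N a z ω ∈ B} |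
        {ω | ∀ x ∈ Ico a b, M x ω = s} ∩ {ω | N b ω - N a ω = z}] =
      ∫⁻ t in B ∩ orderedTimes z a b, ENNReal.ofReal (arrivalDensity γ a b z t) := by
  have hm := h.pathSigma_le
  let C := {ω | ∀ x ∈ Ico a b, M x ω = s}
  have hC : MeasurableSet[pathSigma M] C := measurableSet_const_on h.chain.rightCont b ha s
  -- With deterministic endpoints the weight is constant on `C`, so the probability factors.
  have key : ∀ {B : Set (Fin z → ℝ)}, MeasurableSet B →
      P (C ∩ {ω | N b ω - N a ω = z} ∩ {ω | arrivals N a z ω ∈ B}) =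
        segmentWeight γ (lam s) z B a b * P C := by
    intro B hB
    have hG := (h.poissonAfter hlam hγ hγi (U := fun _ => a) measurable_const fun _ => ha).arrivals h
      hlam hγ hγi (V := fun _ => b) measurable_const (fun _ => hab.le) hC (fun ω hω => hω) hB
    have := hG.measure_inter MeasurableSet.univ
    simp only [univ_inter, Measure.restrict_univ, Pi.one_apply, one_mul] at this
    rw [lintegral_indicator_const (hm _ hC)] at this
    rw [← this]
    congr 1
    ext ω
    simp only [mem_inter_iff, mem_ofPred_eq, count_sub_eq_iff h ha hab.le, and_assoc]
  have hE : MeasurableSet (C ∩ {ω | N b ω - N a ω = z}) := by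
    refine (hm _ hC).inter ?_
    exact measurableSet_eq_fun ((h.measurable b (ha.trans hab.le)).sub (h.measurable a ha))
      measurable_const
  have huniv := key (B := univ) MeasurableSet.univ
  simp only [mem_univ, ofPred_true, inter_univ] at huniv
  rw [cond_apply hE, key hB, huniv, setLIntegral_arrivalDensity hγ hγi ha hab.le hB,
    ← arrivalDensity_mul_segmentWeight_univ (B := B) hγ hγi ha hab.le]
  have h0 : segmentWeight γ (lam s) z univ a b * P C ≠ 0 := by rwa [← huniv]
  have ht : segmentWeight γ (lam s) z univ a b * P C ≠ ⊤ := by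
    rw [← huniv]; exact measure_ne_top _ _
  rw [mul_assoc, mul_comm, mul_assoc, ENNReal.mul_inv_cancel h0 ht, mul_one]

end conditional

/-! ### The conditional law of arrivals in a random regime interval. -/

section regimeLaw
variable {Ω : Type*} {r : ℕ} [mΩ : MeasurableSpace Ω] {P : Measure Ω}
    {π : Fin r → ℝ} {q : Fin r → Fin r → ℝ} {lam : Fin r → ℝ} {γ : ℝ → ℝ}
    {M : ℝ → Ω → Fin r} {N : ℝ → Ω → ℕ}

/-- If `w` is the conditional probability of `Q`, it can be integrated in place of its indicator. -/
theorem setLIntegral_eq_lintegral_mul {m : MeasurableSpace Ω} (hm : m ≤ mΩ) {Q : Set Ω}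
    {w : Ω → ENNReal} (hw : Measurable[m] w)
    (hQ : ∀ A, MeasurableSet[m] A → P (A ∩ Q) = ∫⁻ ω in A, w ω ∂P)
    {φ : Ω → ENNReal} (hφ : Measurable[m] φ) :
    ∫⁻ ω in Q, φ ω ∂P = ∫⁻ ω, w ω * φ ω ∂P := by
  have h1 : (P.restrict Q).trim hm = (P.withDensity w).trim hm := by
    refine @Measure.ext _ m _ _ fun A hA => ?_
    rw [trim_measurableSet_eq hm hA, trim_measurableSet_eq hm hA,
      Measure.restrict_apply (hm _ hA), withDensity_apply _ (hm _ hA), hQ A hA]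
  rw [← lintegral_trim hm hφ, h1, lintegral_trim hm hφ]
  exact lintegral_withDensity_eq_lintegral_mul _ (hw.mono hm le_rfl) (hφ.mono hm le_rfl)

/-- The sets with this property form a σ-algebra containing `m` and every preimage under `X`. Thus,
on a fibre of `X`, adding `X` to the conditioning creates no new events. -/
theorem exists_measurable_inter {Ω : Type*} {m : MeasurableSpace Ω} {β : Type*} {X : Ω → β} {z : β} {G : Set Ω}
    (hG : MeasurableSet[m ⊔ MeasurableSpace.comap X ⊤] G) :
    ∃ A, MeasurableSet[m] A ∧ G ∩ X ⁻¹' {z} = A ∩ X ⁻¹' {z} := by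
  let m' : MeasurableSpace Ω :=
    { MeasurableSet' := fun G => ∃ A, MeasurableSet[m] A ∧ G ∩ X ⁻¹' {z} = A ∩ X ⁻¹' {z}
      measurableSet_empty := ⟨∅, MeasurableSet.empty, rfl⟩
      measurableSet_compl := by
        rintro G ⟨A, hA, h⟩
        refine ⟨Aᶜ, m.measurableSet_compl A hA, ?_⟩
        ext ω
        have := Set.ext_iff.1 h ω
        simp only [mem_inter_iff, mem_compl_iff] at this ⊢
        tauto
      measurableSet_iUnion := by
        intro G hG
        choose A hA h using hG
        exact ⟨⋃ i, A i, m.measurableSet_iUnion A hA, by rw [iUnion_inter, iUnion_inter, iUnion_congr h]⟩ }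
  have hle : m ⊔ MeasurableSpace.comap X ⊤ ≤ m' := by
    refine sup_le (fun A hA => ⟨A, hA, rfl⟩) ?_
    rintro _ ⟨B, -, rfl⟩
    by_cases hz : z ∈ B
    · refine ⟨univ, @MeasurableSet.univ _ m, ?_⟩
      ext ω
      simp only [mem_inter_iff, mem_preimage, mem_singleton_iff, mem_univ, true_and,
        and_iff_right_iff_imp]
      rintro rfl
      exact hz
    · refine ⟨∅, @MeasurableSet.empty _ m, ?_⟩
      ext ω
      simp only [mem_inter_iff, mem_preimage, mem_singleton_iff, mem_empty_iff_false, false_and,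
        iff_false, not_and]
      rintro h rfl
      exact hz h
  exact hle _ hG

variable {T : ℝ}

theorem regimeCount_eq_iff (h : IsMMNPP P π q lam γ M N) (hT : 0 ≤ T) {k z : ℕ} {ω : Ω} :
    regimeCount M N T k ω = z ↔
      N (regimeTime M T (k + 1) ω) ω = N (regimeTime M T k ω) ω + z :=
  count_sub_eq_iff h (regimeTime_nonneg hT k ω) (regimeTime_mono hT ω k.le_succ)

theorem IsMMNPP.measurable_regimeTime (h : IsMMNPP P π q lam γ M N) (T : ℝ) (k : ℕ) :
    Measurable (regimeTime M T k) :=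
  (MMNPP.measurable_regimeTime h.chain.rightCont T k).mono h.pathSigma_le le_rfl

theorem IsMMNPP.measurable_regimeCount (h : IsMMNPP P π q lam γ M N) (hT : 0 ≤ T) (k : ℕ) :
    Measurable (regimeCount M N T k) :=
  (h.measurable_count (h.measurable_regimeTime T (k + 1)) (regimeTime_nonneg hT _)).sub
    (h.measurable_count (h.measurable_regimeTime T k) (regimeTime_nonneg hT _))

theorem IsMMNPP.measurable_regimeArrivals (h : IsMMNPP P π q lam γ M N) (hT : 0 ≤ T) (k z : ℕ) :
    Measurable (regimeArrivals M N T k z) :=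
  measurable_arrivals h.rightCont h.mono h.measurable (h.measurable_regimeTime T k)
    (regimeTime_nonneg hT k) z

/-- The `k`-th regime starts before `T`, in state `s`. -/
def regimeState (M : ℝ → Ω → Fin r) (T : ℝ) (k : ℕ) (s : Fin r) : Set Ω :=
  {ω | jumpTime M ω k < (T : EReal) ∧ M (regimeTime M T k ω) ω = s}

theorem measurableSet_regimeState {Ω : Type*} {M : ℝ → Ω → Fin r}
    (hM : ∀ ω t, 0 ≤ t → ContinuousWithinAt (fun x => M x ω) (Ici t) t) (hT : 0 ≤ T) (k : ℕ)
    (s : Fin r) : MeasurableSet[pathSigma M] (regimeState M T k s) := by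
  have h1 := measurable_jumpTime hM k
  have h2 := measurable_state_at hM (measurable_regimeTime hM T k) (regimeTime_nonneg hT k)
  exact MeasurableSet.inter (h1 measurableSet_Iio) (h2 (measurableSet_singleton s))

theorem PoissonAfter.regime [IsProbabilityMeasure P] (h : IsMMNPP P π q lam γ M N)
    (hlam : ∀ i, 0 ≤ lam i) (hγ : ∀ x, 0 ≤ x → 0 ≤ γ x) (hγi : LocallyIntegrableOn γ (Ici 0))
    (hT : 0 ≤ T) {S : Set Ω} {k : ℕ} {f : Ω → ENNReal}
    (hS : PoissonAfter P lam γ M N S (regimeTime M T k) f) (s : Fin r) {z : ℕ}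
    {B : Set (Fin z → ℝ)} (hB : MeasurableSet B) :
    PoissonAfter P lam γ M N
      (S ∩ (regimeState M T k s ∩ {ω | regimeCount M N T k ω = z ∧ regimeArrivals M N T k z ω ∈ B}))
      (regimeTime M T (k + 1))
      (fun ω => f ω * (regimeState M T k s).indicator
        (fun ω => segmentWeight γ (lam s) z B (regimeTime M T k ω) (regimeTime M T (k + 1) ω)) ω) := by
  have := hS.arrivals h hlam hγ hγi (MMNPP.measurable_regimeTime h.chain.rightCont T (k + 1))
    (fun ω => regimeTime_mono hT ω k.le_succ)
    (measurableSet_regimeState h.chain.rightCont hT k s)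
    (fun ω hω x hx => (eq_on_regime hT hx).trans hω.2) hB
  simp only [regimeCount_eq_iff h hT]
  exact this

/-- The conditional probability of arrival times in `B` over the interval from `u` to `v`. -/
def arrivalProb (γ : ℝ → ℝ) (z : ℕ) (B : Set (Fin z → ℝ)) (u v : ℝ) : ENNReal :=
  ENNReal.ofReal (z.factorial / (∫ x in u..v, γ x) ^ z) *
    Measure.pi (fun _ : Fin z => rateMeasure γ) (B ∩ orderedTimes z u v)

theorem measurable_arrivalProb (hγi : LocallyIntegrableOn γ (Ici 0)) {z : ℕ}
    {B : Set (Fin z → ℝ)} (hB : MeasurableSet B) {S : Type*} [MeasurableSpace S] {σ τ : S → ℝ}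
    (hσ : Measurable σ) (hτ : Measurable τ) (hσ0 : ∀ ω, 0 ≤ σ ω) (hτ0 : ∀ ω, 0 ≤ τ ω) :
    Measurable fun ω => arrivalProb γ z B (σ ω) (τ ω) := by
  have h1 := (measurable_integral_rate hγi).comp (hσ.prodMk hτ)
  have h2 : Measurable fun ω => ∫ x in (σ ω)..(τ ω), γ x := by
    simpa [Function.comp_def, max_eq_left (hσ0 _), max_eq_left (hτ0 _)] using h1
  exact (ENNReal.measurable_ofReal.comp (measurable_const.div (h2.pow_const z))).mul
    ((measurable_pi_orderedTimes hB).comp (hσ.prodMk hτ))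

/-- The regime is split according to its state `s`. Given the path, the probability of `z` arrivals
is a weight involving `λ_s`, and multiplying it by the conditional probability of `B` gives the
weight of `B`. The conditional probability is the same expression for all `s`, so the pieces can be
summed. -/
theorem IsMMNPP.setLIntegral_arrivalProb [IsProbabilityMeasure P] (h : IsMMNPP P π q lam γ M N)
    (hlam : ∀ i, 0 ≤ lam i) (hγ : ∀ x, 0 ≤ x → 0 ≤ γ x) (hγi : LocallyIntegrableOn γ (Ici 0))
    (hT : 0 ≤ T) (k z : ℕ) {B : Set (Fin z → ℝ)} (hB : MeasurableSet B) {A : Set Ω}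
    (hA : MeasurableSet[pathSigma M] A) :
    ∫⁻ ω in A ∩ ({ω | jumpTime M ω k < (T : EReal)} ∩ regimeCount M N T k ⁻¹' {z}),
      arrivalProb γ z B (regimeTime M T k ω) (regimeTime M T (k + 1) ω) ∂P =
    P (A ∩ ({ω | jumpTime M ω k < (T : EReal)} ∩ regimeCount M N T k ⁻¹' {z}) ∩
      {ω | regimeArrivals M N T k z ω ∈ B}) := by
  have hm := h.pathSigma_le
  have hM := h.chain.rightCont
  set X := regimeCount M N T k ⁻¹' {z} with hXdef
  set E := {ω | regimeArrivals M N T k z ω ∈ B}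
  have hX : MeasurableSet X := h.measurable_regimeCount hT k (measurableSet_singleton z)
  have hE : MeasurableSet E := h.measurable_regimeArrivals hT k z hB
  have hu0 : ∀ j ω, 0 ≤ regimeTime M T j ω := fun j => regimeTime_nonneg hT j
  have hum : ∀ j, Measurable[pathSigma M] (regimeTime M T j) := MMNPP.measurable_regimeTime hM T
  have hΦ : Measurable[pathSigma M] fun ω =>
      arrivalProb γ z B (regimeTime M T k ω) (regimeTime M T (k + 1) ω) :=
    @measurable_arrivalProb _ hγi z B hB Ω (pathSigma M) _ _ (hum k) (hum (k + 1)) (hu0 k)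
      (hu0 (k + 1))
  have hstate : ∀ s, ∫⁻ ω in A ∩ (regimeState M T k s ∩ X),
      arrivalProb γ z B (regimeTime M T k ω) (regimeTime M T (k + 1) ω) ∂P =
      P (A ∩ (regimeState M T k s ∩ X) ∩ E) := by
    intro s
    have hC := measurableSet_regimeState hM hT k s
    have h0 := h.poissonAfter hlam hγ hγi (hum k) (hu0 k)
    have hB' := h0.regime h hlam hγ hγi hT s hB
    have hU' := h0.regime h hlam hγ hγi hT s (z := z) MeasurableSet.univ
    have e1 : A ∩ (regimeState M T k s ∩ X) ∩ E = A ∩ (univ ∩ (regimeState M T k s ∩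
        {ω | regimeCount M N T k ω = z ∧ regimeArrivals M N T k z ω ∈ B})) := by
      ext ω
      simp only [mem_inter_iff, mem_ofPred_eq, mem_univ, true_and, X, E, mem_preimage,
        mem_singleton_iff]
      tauto
    have e2 : regimeState M T k s ∩ X = univ ∩ (regimeState M T k s ∩
        {ω | regimeCount M N T k ω = z ∧ regimeArrivals M N T k z ω ∈ univ}) := by
      ext ω
      simp only [mem_inter_iff, mem_ofPred_eq, mem_univ, true_and, and_true, X, mem_preimage,
        mem_singleton_iff]
    rw [e1, hB'.measure_inter hA, e2, ← setLIntegral_indicator (hm _ hA),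
      setLIntegral_eq_lintegral_mul hm hU'.measurable_weight (fun A hA => hU'.measure_inter hA)
      (hΦ.indicator hA), ← lintegral_indicator (hm _ hA)]
    refine lintegral_congr fun ω => ?_
    by_cases hωA : ω ∈ A
    · by_cases hω : ω ∈ regimeState M T k s
      · simp only [indicator_of_mem hωA, indicator_of_mem hω, Pi.one_apply, one_mul]
        rw [mul_comm]
        exact arrivalDensity_mul_segmentWeight_univ hγ hγi (hu0 k ω)
          (regimeTime_mono hT ω k.le_succ)
      · simp [indicator_of_mem hωA, indicator_of_notMem hω]
    · simp [indicator_of_notMem hωA]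
  have hU : {ω | jumpTime M ω k < (T : EReal)} = ⋃ s, regimeState M T k s := by
    ext ω
    simp [regimeState]
  have hdisj : Pairwise (Function.onFun Disjoint fun s => A ∩ (regimeState M T k s ∩ X)) := by
    intro s t hst
    rw [Function.onFun, Set.disjoint_left]
    rintro ω ⟨_, h1, _⟩ ⟨_, h2, _⟩
    exact hst (h1.2.symm.trans h2.2)
  have hms : ∀ s, MeasurableSet (A ∩ (regimeState M T k s ∩ X)) := fun s =>
    (hm _ hA).inter ((hm _ (measurableSet_regimeState hM hT k s)).inter hX)
  rw [hU, iUnion_inter, inter_iUnion, lintegral_iUnion hms hdisj, iUnion_inter, measure_iUnion]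
  · exact tsum_congr hstate
  · intro s t hst
    exact (hdisj hst).mono inter_subset_left inter_subset_left
  · exact fun s => (hms s).inter hE

/-- A conditional probability given `G` can be identified on an event of `G`. -/
theorem condExp_indicator_eq_on {Ω : Type*} {G mΩ : MeasurableSpace Ω} {P : Measure Ω}
    [IsProbabilityMeasure P] (hG : G ≤ mΩ) {F E : Set Ω} (hF : MeasurableSet[G] F)
    (hE : MeasurableSet E) {Φ : Ω → ENNReal} (hΦ : Measurable[G] Φ)
    (h : ∀ A, MeasurableSet[G] A → ∫⁻ ω in A ∩ F, Φ ω ∂P = P (A ∩ F ∩ E)) :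
    ∀ᵐ ω ∂P, ω ∈ F → (P⟦E | G⟧) ω = (Φ ω).toReal := by
  have hΦfin : ∀ A, MeasurableSet[G] A → ∫⁻ ω in A ∩ F, Φ ω ∂P ≠ ⊤ := fun A hA => by
    rw [h A hA]; exact measure_ne_top _ _
  have hΦm : Measurable Φ := hΦ.mono hG le_rfl
  have hIE : Integrable (E.indicator fun _ => (1 : ℝ)) P := (integrable_const 1).indicator hE
  have hint : Integrable (F.indicator fun ω => (Φ ω).toReal) P := by
    rw [integrable_indicator_iff (hG _ hF)]
    refine integrable_toReal_of_lintegral_ne_top hΦm.aemeasurable.restrict ?_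
    simpa using hΦfin univ MeasurableSet.univ
  -- Uniqueness of the conditional expectation is applied to the event localised to `F`; since `F`
  -- belongs to `G`, its indicator can be pulled out afterwards.
  have hmain : F.indicator (fun ω => (Φ ω).toReal) =ᵐ[P]
      P[F.indicator (E.indicator fun _ => (1 : ℝ)) | G] := by
    refine ae_eq_condExp_of_forall_setIntegral_eq hG (hIE.indicator (hG _ hF))
      (fun _ _ _ => hint.integrableOn) (fun A hA _ => ?_) ?_
    · rw [setIntegral_indicator (hG _ hF), setIntegral_indicator (hG _ hF),
        setIntegral_indicator hE, integral_toReal hΦm.aemeasurable.restrict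
        (ae_lt_top' hΦm.aemeasurable.restrict (hΦfin A hA)), h A hA]
      simp [Measure.real]
    · have : Measurable[G] (F.indicator fun ω => (Φ ω).toReal) :=
        Measurable.indicator hΦ.ennreal_toReal hF
      exact this.stronglyMeasurable.aestronglyMeasurable
  filter_upwards [hmain, condExp_indicator hIE hF] with ω h1 h2 hω
  rw [h2, indicator_of_mem hω, indicator_of_mem hω] at h1
  exact h1.symm

/-- The law of the arrival times in a regime interval, given the path of the chain and the number of
arrivals. -/
theorem IsMMNPP.condExp_regimeArrivals [IsProbabilityMeasure P] (h : IsMMNPP P π q lam γ M N)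
    (hlam : ∀ i, 0 ≤ lam i) (hγ : ∀ x, 0 ≤ x → 0 ≤ γ x) (hγi : LocallyIntegrableOn γ (Ici 0))
    (hT : 0 ≤ T) (k z : ℕ) {B : Set (Fin z → ℝ)} (hB : MeasurableSet B) :
    ∀ᵐ ω ∂P, jumpTime M ω k < (T : EReal) → regimeCount M N T k ω = z →
        (P⟦{ω' | regimeArrivals M N T k z ω' ∈ B} |
            pathSigma M ⊔ MeasurableSpace.comap (regimeCount M N T k) ⊤⟧) ω =
          ∫ t in B ∩ orderedTimes z (regimeTime M T k ω) (regimeTime M T (k + 1) ω),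
            arrivalDensity γ (regimeTime M T k ω) (regimeTime M T (k + 1) ω) z t := by
  have hM := h.chain.rightCont
  have hum : ∀ j, Measurable[pathSigma M] (regimeTime M T j) := MMNPP.measurable_regimeTime hM T
  have hΦ : Measurable[pathSigma M] fun ω =>
      arrivalProb γ z B (regimeTime M T k ω) (regimeTime M T (k + 1) ω) :=
    @measurable_arrivalProb _ hγi z B hB Ω (pathSigma M) _ _ (hum k) (hum (k + 1))
      (regimeTime_nonneg hT k) (regimeTime_nonneg hT (k + 1))
  have hJ : MeasurableSet[pathSigma M] {ω | jumpTime M ω k < (T : EReal)} :=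
    measurable_jumpTime hM k measurableSet_Iio
  have hX : MeasurableSet[MeasurableSpace.comap (regimeCount M N T k) ⊤]
      (regimeCount M N T k ⁻¹' {z}) := ⟨{z}, trivial, rfl⟩
  have hle1 : pathSigma M ≤ pathSigma M ⊔ MeasurableSpace.comap (regimeCount M N T k) ⊤ :=
    le_sup_left
  have hle2 : MeasurableSpace.comap (regimeCount M N T k) ⊤ ≤
      pathSigma M ⊔ MeasurableSpace.comap (regimeCount M N T k) ⊤ := le_sup_right
  have key := condExp_indicator_eq_on (P := P)
    (sup_le h.pathSigma_le (h.measurable_regimeCount hT k).comap_le)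
    (MeasurableSet.inter (hle1 _ hJ) (hle2 _ hX)) (h.measurable_regimeArrivals hT k z hB)
    (hΦ.mono hle1 le_rfl) fun A hA => by
      -- On the event of `z` arrivals the conditioning event may be replaced by a pure path event.
      obtain ⟨A', hA', he⟩ := exists_measurable_inter (z := z) hA
      rw [inter_left_comm, he, inter_left_comm]
      exact h.setLIntegral_arrivalProb hlam hγ hγi hT k z hB hA'
  filter_upwards [key] with ω hω hω1 hω2
  rw [setIntegral_arrivalDensity hγ hγi (regimeTime_nonneg hT k ω)
    (regimeTime_mono hT ω k.le_succ) hB]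
  exact hω ⟨hω1, hω2⟩

end regimeLaw

/-! ### Censored exponential times. -/

theorem expMeasure_Ioi {c : ℝ} (hc : 0 < c) (a : ℝ) :
    expMeasure c (Ioi a) = ENNReal.ofReal (Real.exp (-(c * max a 0))) := by
  have := isProbabilityMeasure_expMeasure hc
  rw [← compl_Iic, measure_compl measurableSet_Iic (measure_ne_top _ _), measure_univ,
    ← ofReal_cdf, cdf_expMeasure_eq hc]
  by_cases ha : 0 ≤ a
  · rw [if_pos ha, max_eq_left ha, ← ENNReal.ofReal_one, ← ENNReal.ofReal_sub, sub_sub_cancel]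
    rw [sub_nonneg, Real.exp_le_one_iff]
    have := mul_nonneg hc.le ha
    linarith
  · rw [if_neg ha, max_eq_right (le_of_not_ge ha)]
    simp

/-- The law of an exponential time of rate `c ≥ 0` censored at `T`. -/
theorem exists_censored_exponential {c : ℝ} (hc : 0 ≤ c) (T : ℝ) :
    ∃ ρ : Measure ℝ, IsProbabilityMeasure ρ ∧ ∀ b, ρ (Ioi b) =
      if b < T then ENNReal.ofReal (Real.exp (-(c * max b 0))) else 0 := by
  -- Rate zero belongs to a state that is never left: the holding time is infinite, and censoring
  -- puts all its mass at `T`.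
  rcases hc.eq_or_lt with rfl | hc
  · refine ⟨Measure.dirac T, inferInstance, fun b => ?_⟩
    rw [Measure.dirac_apply' _ measurableSet_Ioi]
    by_cases hb : b < T <;> simp [hb]
  · have := isProbabilityMeasure_expMeasure hc
    have hm : Measurable fun x : ℝ => min x T := measurable_id.min measurable_const
    refine ⟨(expMeasure c).map fun x => min x T, Measure.isProbabilityMeasure_map hm.aemeasurable,
      fun b => ?_⟩
    rw [Measure.map_apply hm measurableSet_Ioi]
    by_cases hb : b < T
    · rw [if_pos hb, ← expMeasure_Ioi hc]
      congr 1
      ext x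
      simp [hb]
    · have : (fun x : ℝ => min x T) ⁻¹' Ioi b = ∅ := by
        ext x
        simp [hb]
      rw [if_neg hb, this, measure_empty]

/-- Closed half-lines are reached from open ones by continuity from above. The case `y = T` is
included and gives the atom at `T`. -/
theorem censored_exponential_Ici {c T : ℝ} {ρ : Measure ℝ} [IsProbabilityMeasure ρ]
    (hρ : ∀ b, ρ (Ioi b) = if b < T then ENNReal.ofReal (Real.exp (-(c * max b 0))) else 0)
    {y : ℝ} (hy : 0 < y) (hyT : y ≤ T) :
    ρ (Ici y) = ENNReal.ofReal (Real.exp (-(c * y))) := by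
  have hI : Ici y = ⋂ n : ℕ, Ioi (y - y / (n + 1)) := by
    ext x
    simp only [mem_Ici, mem_iInter, mem_Ioi]
    refine ⟨fun h n => lt_of_lt_of_le (sub_lt_self _ (by positivity)) h, fun h => ?_⟩
    refine le_of_tendsto (f := fun n : ℕ => y - y / ((n : ℝ) + 1)) (x := Filter.atTop) ?_
      (Filter.Eventually.of_forall fun n => (h n).le)
    have := (tendsto_one_div_add_atTop_nhds_zero_nat (𝕜 := ℝ)).const_mul y
    have h2 := this.const_sub y
    simpa [div_eq_mul_inv] using h2
  have hanti : Antitone fun n : ℕ => Ioi (y - y / ((n : ℝ) + 1)) := by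
    intro n k hnk
    refine Ioi_subset_Ioi ?_
    have : (n : ℝ) ≤ k := by exact_mod_cast hnk
    gcongr
  have h1 := tendsto_measure_iInter_atTop (μ := ρ) (s := fun n : ℕ => Ioi (y - y / ((n : ℝ) + 1)))
    (fun n => measurableSet_Ioi.nullMeasurableSet) hanti ⟨0, measure_ne_top _ _⟩
  rw [← hI] at h1
  have h2 : ∀ n : ℕ, ρ (Ioi (y - y / ((n : ℝ) + 1))) =
      ENNReal.ofReal (Real.exp (-(c * (y - y / ((n : ℝ) + 1))))) := by
    intro n
    have hle : y / ((n : ℝ) + 1) ≤ y := div_le_self hy.le (by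
      have : (0 : ℝ) ≤ n := n.cast_nonneg
      linarith)
    have hpos : 0 < y / ((n : ℝ) + 1) := by positivity
    rw [hρ, if_pos (by linarith), max_eq_left (by linarith)]
  have h3 : Filter.Tendsto (fun n : ℕ => ENNReal.ofReal (Real.exp (-(c * (y - y / ((n : ℝ) + 1))))))
      Filter.atTop (nhds (ENNReal.ofReal (Real.exp (-(c * y))))) := by
    have h4 := (tendsto_one_div_add_atTop_nhds_zero_nat (𝕜 := ℝ)).const_mul y
    have h5 := h4.const_sub y
    have h6 : Filter.Tendsto (fun n : ℕ => y - y / ((n : ℝ) + 1)) Filter.atTop (nhds y) := by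
      simpa [div_eq_mul_inv] using h5
    exact (ENNReal.continuous_ofReal.tendsto _).comp ((Real.continuous_exp.tendsto _).comp
      (h6.const_mul c).neg)
  exact tendsto_nhds_unique h1 (h3.congr fun n => (h2 n).symm)

/-! ### Partial sums, and measures determined by upper half-lines. -/

section partialSums
variable {m : ℕ}

/-- The sum of the first `k` coordinates. -/
def prefixSum (x : Fin m → ℝ) (k : ℕ) : ℝ := ∑ j : Fin m, if (j : ℕ) < k then x j else 0

/-- The vector of partial sums. -/
def partialSums (x : Fin m → ℝ) : Fin m → ℝ := fun k => prefixSum x (k + 1)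

theorem prefixSum_zero (x : Fin m → ℝ) : prefixSum x 0 = 0 := by simp [prefixSum]

theorem prefixSum_succ (x : Fin m → ℝ) (k : Fin m) : prefixSum x (k + 1) = prefixSum x k + x k := by
  have : ∀ j : Fin m, (if (j : ℕ) < k + 1 then x j else 0) =
      (if (j : ℕ) < k then x j else 0) + if j = k then x j else 0 := by
    intro j
    by_cases h : j = k
    · subst h; simp
    · have h' : (j : ℕ) ≠ k := fun e => h (Fin.ext e)
      by_cases h2 : (j : ℕ) < k
      · simp [h, h2, Nat.lt_succ_of_lt h2]
      · have : ¬ (j : ℕ) < k + 1 := by omega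
        simp [h, h2, this]
  simp only [prefixSum, this, Finset.sum_add_distrib]
  simp

theorem prefixSum_nonneg {x : Fin m → ℝ} (hx : ∀ k, 0 ≤ x k) (k : ℕ) : 0 ≤ prefixSum x k :=
  Finset.sum_nonneg fun j _ => by split_ifs; exacts [hx j, le_rfl]

theorem knot_partialSums (T : ℝ) (x : Fin m → ℝ) {k : ℕ} (hk : k ≤ m) :
    knot T (partialSums x) k = prefixSum x k := by
  cases k with
  | zero => simp [knot, prefixSum_zero]
  | succ k =>
    have : k < m := hk
    simp [knot, this, partialSums]

theorem measurable_prefixSum (k : ℕ) : Measurable fun x : Fin m → ℝ => prefixSum x k :=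
  Finset.measurable_fun_sum _ fun j _ => by
    by_cases h : (j : ℕ) < k
    · simpa [h] using measurable_pi_apply j
    · simp [h]

theorem measurable_partialSums : Measurable (partialSums : (Fin m → ℝ) → Fin m → ℝ) :=
  measurable_pi_lambda _ fun k => measurable_prefixSum (k + 1)

/-- The matrix of this linear map is lower triangular with unit diagonal, so its determinant is `1`.
-/
theorem measurePreserving_partialSums :
    MeasurePreserving (partialSums : (Fin m → ℝ) → Fin m → ℝ) := by
  refine ⟨measurable_partialSums, ?_⟩
  let A : Matrix (Fin m) (Fin m) ℝ := fun i j => if (j : ℕ) < i + 1 then 1 else 0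
  have hdet : A.det = 1 := by
    rw [Matrix.det_of_isLowerTriangular]
    · simp [A]
    · intro i j hij
      have : (i : ℕ) < j := hij
      simpa [A] using this
  have hfun : (partialSums : (Fin m → ℝ) → Fin m → ℝ) = Matrix.toLin' A := by
    funext x k
    rw [Matrix.toLin'_apply]
    simp only [Matrix.mulVec, dotProduct, A, partialSums, prefixSum, ite_mul, one_mul, zero_mul]
  have := Real.map_matrix_volume_pi_eq_smul_volume_pi (M := A) (by rw [hdet]; norm_num)
  rw [hfun, this, hdet]
  simp

end partialSums

/-- Measures on a product which agree on products of upper half-lines are equal. -/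
theorem measure_eq_of_Ioi {m : ℕ} {μ ν : Measure ((Fin m → ℝ) × ℝ)} [IsFiniteMeasure μ]
    (h : ∀ (a : Fin m → ℝ) (b : ℝ),
      μ ((univ.pi fun i => Ioi (a i)) ×ˢ Ioi b) = ν ((univ.pi fun i => Ioi (a i)) ×ˢ Ioi b)) :
    μ = ν := by
  have hu : ⋃ n : ℕ, Ioi (-(n : ℝ)) = univ := by
    rw [eq_univ_iff_forall]
    intro x
    obtain ⟨n, hn⟩ := exists_nat_gt (-x)
    exact mem_iUnion.2 ⟨n, by simp only [mem_Ioi]; linarith⟩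
  have hsp : IsCountablySpanning (range (Ioi : ℝ → Set ℝ)) :=
    ⟨fun n : ℕ => Ioi (-(n : ℝ)), fun n => ⟨_, rfl⟩, hu⟩
  have hsp2 : IsCountablySpanning (univ.pi '' univ.pi fun _ : Fin m => range (Ioi : ℝ → Set ℝ)) :=
    IsCountablySpanning.pi fun _ => hsp
  have hgR : MeasurableSpace.generateFrom (range (Ioi : ℝ → Set ℝ)) =
      (inferInstance : MeasurableSpace ℝ) := by
    rw [← borel_eq_generateFrom_Ioi, ← BorelSpace.measurable_eq (α := ℝ)]
  have hg1 : MeasurableSpace.generateFrom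
      (univ.pi '' univ.pi fun _ : Fin m => range (Ioi : ℝ → Set ℝ)) =
      (inferInstance : MeasurableSpace (Fin m → ℝ)) := by
    rw [← generateFrom_pi_eq fun _ => hsp, hgR]
  refine Measure.ext_of_generateFrom_of_iUnion _
    (fun n : ℕ => (univ.pi fun _ => Ioi (-(n : ℝ))) ×ˢ Ioi (-(n : ℝ)))
    (generateFrom_eq_prod hg1 hgR hsp2 hsp).symm
    ((IsPiSystem.pi fun _ => isPiSystem_Ioi).prod isPiSystem_Ioi) ?_ (fun n => ?_)
    (fun n => measure_ne_top _ _) ?_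
  · rw [eq_univ_iff_forall]
    rintro ⟨x, y⟩
    obtain ⟨n, hn⟩ := exists_nat_gt (∑ i, |x i| + |y|)
    have hs : ∀ i, |x i| ≤ ∑ i, |x i| := fun i =>
      Finset.single_le_sum (f := fun i => |x i|) (fun i _ => abs_nonneg _) (Finset.mem_univ i)
    have hs0 : 0 ≤ ∑ i, |x i| := Finset.sum_nonneg fun i _ => abs_nonneg _
    refine mem_iUnion.2 ⟨n, fun i _ => ?_, ?_⟩
    · have h1 := neg_abs_le (x i)
      have h2 := hs i
      have h3 := abs_nonneg y
      simp only [mem_Ioi]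
      linarith
    · have h1 := neg_abs_le y
      simp only [mem_Ioi]
      linarith
  · exact ⟨_, ⟨fun _ => Ioi (-(n : ℝ)), fun _ _ => ⟨_, rfl⟩, rfl⟩, _, ⟨_, rfl⟩, rfl⟩
  · rintro _ ⟨_, ⟨s, hs, rfl⟩, _, ⟨b, rfl⟩, rfl⟩
    choose a ha using fun i => hs i trivial
    obtain rfl : (fun i => Ioi (a i)) = s := funext ha
    exact h a b

/-! ### Jump times in terms of holding times. -/

section holding
variable {Ω : Type*} {r : ℕ} {M : ℝ → Ω → Fin r}

/-- The chain makes at least `m` jumps, and its first states are `s`. -/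
def stateEvent (M : ℝ → Ω → Fin r) {m : ℕ} (s : Fin (m + 1) → Fin r) : Set Ω :=
  {ω | jumpTime M ω m ≠ ⊤ ∧ ∀ k : Fin (m + 1), M (jumpTime M ω k).toReal ω = s k}

/-- The holding times in the first `m` states. -/
def holdingTimes (M : ℝ → Ω → Fin r) (m : ℕ) (ω : Ω) : Fin m → ℝ :=
  fun k => (jumpTime M ω (k + 1)).toReal - (jumpTime M ω k).toReal

/-- The holding time after the `m`-th jump, censored at `T`. -/
def censoredHolding (M : ℝ → Ω → Fin r) (T : ℝ) (m : ℕ) (ω : Ω) : ℝ :=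
  (min (jumpTime M ω (m + 1)) (jumpTime M ω m + T)).toReal - (jumpTime M ω m).toReal

theorem jumpTime_ne_top_of_le {ω : Ω} {k m : ℕ} (h : jumpTime M ω m ≠ ⊤) (hk : k ≤ m) :
    jumpTime M ω k ≠ ⊤ :=
  ((jumpTime_mono ω hk).trans_lt h.lt_top).ne

/-- Censoring keeps the last holding time real even if the chain never leaves its last state, so
passing to reals loses nothing. -/
theorem coe_censored {T : ℝ} (hT : 0 < T) {m : ℕ} {ω : Ω} (h : jumpTime M ω m ≠ ⊤) :
    (((min (jumpTime M ω (m + 1)) (jumpTime M ω m + T)).toReal : ℝ) : EReal) =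
      min (jumpTime M ω (m + 1)) (jumpTime M ω m + T) := by
  rw [← coe_toReal_jumpTime h, ← EReal.coe_add]
  refine EReal.coe_toReal ?_ ?_
  · exact ((min_le_right _ _).trans_lt (EReal.coe_lt_top _)).ne
  · refine (lt_of_lt_of_le EReal.bot_lt_zero (le_min (jumpTime_nonneg ω _) ?_)).ne'
    have := toReal_jumpTime_nonneg (M := M) ω m
    exact_mod_cast (by linarith : (0 : ℝ) ≤ (jumpTime M ω m).toReal + T)

theorem measurable_holdingTimes
    (hM : ∀ ω t, 0 ≤ t → ContinuousWithinAt (fun x => M x ω) (Ici t) t) (m : ℕ) :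
    Measurable[pathSigma M] (holdingTimes M m) := by
  have h1 := measurable_jumpTime hM
  let _ : MeasurableSpace Ω := pathSigma M
  exact measurable_pi_lambda _ fun k => (h1 (k + 1)).ereal_toReal.sub (h1 k).ereal_toReal

theorem measurable_censoredHolding
    (hM : ∀ ω t, 0 ≤ t → ContinuousWithinAt (fun x => M x ω) (Ici t) t) (T : ℝ) (m : ℕ) :
    Measurable[pathSigma M] (censoredHolding M T m) := by
  have h1 := measurable_jumpTime hM
  let _ : MeasurableSpace Ω := pathSigma M
  exact ((h1 (m + 1)).min ((h1 m).add measurable_const)).ereal_toReal.sub (h1 m).ereal_toReal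

theorem holdingTimes_pos
    (hM : ∀ ω t, 0 ≤ t → ContinuousWithinAt (fun x => M x ω) (Ici t) t) {m : ℕ} {ω : Ω}
    (h : jumpTime M ω m ≠ ⊤) (k : Fin m) : 0 < holdingTimes M m ω k := by
  have h1 := jumpTime_lt_succ hM (jumpTime_ne_top_of_le h k.2.le)
  rw [← coe_toReal_jumpTime (jumpTime_ne_top_of_le h k.2.le),
    ← coe_toReal_jumpTime (jumpTime_ne_top_of_le h k.2), EReal.coe_lt_coe_iff] at h1
  exact sub_pos.2 h1

theorem censoredHolding_pos
    (hM : ∀ ω t, 0 ≤ t → ContinuousWithinAt (fun x => M x ω) (Ici t) t) {T : ℝ} (hT : 0 < T)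
    {m : ℕ} {ω : Ω} (h : jumpTime M ω m ≠ ⊤) : 0 < censoredHolding M T m ω := by
  rw [censoredHolding, sub_pos, ← EReal.coe_lt_coe_iff, coe_censored hT h,
    coe_toReal_jumpTime h, lt_min_iff]
  refine ⟨jumpTime_lt_succ hM h, ?_⟩
  rw [← coe_toReal_jumpTime h, ← EReal.coe_add, EReal.coe_lt_coe_iff]
  linarith

theorem prefixSum_holdingTimes {m : ℕ} {ω : Ω} {k : ℕ} (hk : k ≤ m) :
    prefixSum (holdingTimes M m ω) k = (jumpTime M ω k).toReal := by
  induction k with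
  | zero => rw [prefixSum_zero, jumpTime_zero, EReal.toReal_zero]
  | succ k ih =>
    have := prefixSum_succ (holdingTimes M m ω) ⟨k, hk⟩
    simp only [ih (Nat.le_of_succ_le hk), holdingTimes] at this
    rw [this]
    ring

/-- The event in the definition of the chain, in terms of holding times. -/
theorem holding_event_eq
    (hM : ∀ ω t, 0 ≤ t → ContinuousWithinAt (fun x => M x ω) (Ici t) t) {T : ℝ} (hT : 0 < T)
    {m : ℕ} (s : Fin (m + 1) → Fin r) (a : Fin m → ℝ) {b : ℝ} (hb : b < T)
    {i : ℕ → Fin r} (hi : ∀ k : Fin (m + 1), i k = s k) {g : ℕ → ℝ}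
    (hga : ∀ k : Fin m, g k = max (a k) 0) (hgb : g m = max b 0) :
    {ω | ω ∈ stateEvent M s ∧ (∀ k, a k < holdingTimes M m ω k) ∧ b < censoredHolding M T m ω} =
      {ω | ∀ k ≤ m, M (jumpTime M ω k).toReal ω = i k ∧
        jumpTime M ω k + (g k : EReal) < jumpTime M ω (k + 1)} := by
  -- Holding times are positive, so raising a negative threshold to `0`, as the definition of the
  -- chain requires, does not change the event.
  have hhold : ∀ {ω : Ω}, jumpTime M ω m ≠ ⊤ → ∀ k : Fin m,
      (jumpTime M ω k + (g k : EReal) < jumpTime M ω (k + 1) ↔ a k < holdingTimes M m ω k) := by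
    intro ω h k
    have hpos := holdingTimes_pos hM h k
    rw [← coe_toReal_jumpTime (jumpTime_ne_top_of_le h k.2.le),
      ← coe_toReal_jumpTime (jumpTime_ne_top_of_le h k.2), ← EReal.coe_add, EReal.coe_lt_coe_iff,
      hga, ← lt_sub_iff_add_lt']
    change max (a k) 0 < holdingTimes M m ω k ↔ _
    simp [hpos]
  have hlast : ∀ {ω : Ω}, jumpTime M ω m ≠ ⊤ →
      (jumpTime M ω m + (g m : EReal) < jumpTime M ω (m + 1) ↔ b < censoredHolding M T m ω) := by
    intro ω h
    have hgT : g m < T := by rw [hgb]; exact max_lt hb hT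
    have e1 : jumpTime M ω m + (g m : EReal) < jumpTime M ω (m + 1) ↔
        jumpTime M ω m + (g m : EReal) < min (jumpTime M ω (m + 1)) (jumpTime M ω m + T) := by
      rw [lt_min_iff]
      refine ⟨fun h1 => ⟨h1, ?_⟩, fun h1 => h1.1⟩
      rw [← coe_toReal_jumpTime h, ← EReal.coe_add, ← EReal.coe_add, EReal.coe_lt_coe_iff]
      linarith
    have hpos := censoredHolding_pos hM hT h
    rw [e1, ← coe_censored hT h, ← coe_toReal_jumpTime h, ← EReal.coe_add, EReal.coe_lt_coe_iff,
      hgb, ← lt_sub_iff_add_lt', coe_toReal_jumpTime h]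
    change max b 0 < censoredHolding M T m ω ↔ _
    simp [hpos]
  ext ω
  simp only [mem_ofPred_eq, stateEvent]
  constructor
  · rintro ⟨⟨hne, hst⟩, hh, hl⟩ k hk
    refine ⟨by rw [hi ⟨k, Nat.lt_succ_of_le hk⟩]; exact hst ⟨k, Nat.lt_succ_of_le hk⟩, ?_⟩
    rcases hk.lt_or_eq with hk | rfl
    · exact (hhold hne ⟨k, hk⟩).2 (hh ⟨k, hk⟩)
    · exact (hlast hne).2 hl
  · intro hω
    -- The strict inequality at index `m` already encodes that the `m`-th jump time is finite.
    have hne : jumpTime M ω m ≠ ⊤ := by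
      intro htop
      have := (hω m le_rfl).2
      rw [htop, EReal.top_add_coe] at this
      exact absurd this (not_top_lt)
    refine ⟨⟨hne, fun k => ?_⟩, fun k => ?_, ?_⟩
    · rw [← hi]; exact (hω k (Nat.le_of_lt_succ k.2)).1
    · exact (hhold hne k).1 (hω k k.2.le).2
    · exact (hlast hne).1 (hω m le_rfl).2

theorem censoredHolding_le {T : ℝ} (hT : 0 < T) {m : ℕ} {ω : Ω} (h : jumpTime M ω m ≠ ⊤) :
    censoredHolding M T m ω ≤ T := by
  rw [censoredHolding, sub_le_iff_le_add', ← EReal.coe_le_coe_iff, coe_censored hT h,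
    EReal.coe_add, coe_toReal_jumpTime h]
  exact min_le_right _ _

/-- The chain jumps exactly `m` times in `(0, T)` and visits the states `s`. -/
def regimeEvent (M : ℝ → Ω → Fin r) (T : ℝ) {m : ℕ} (s : Fin (m + 1) → Fin r) : Set Ω :=
  {ω | jumpTime M ω m < (T : EReal) ∧ (T : EReal) ≤ jumpTime M ω (m + 1) ∧
    ∀ k : Fin (m + 1), M (regimeTime M T k ω) ω = s k}

/-- The time left after the `m`-th jump is at most `T`, so a holding time censored at `T` still
decides whether the next jump comes before `T`. -/
theorem mem_regimeEvent_iff {T : ℝ} (hT : 0 < T) {m : ℕ} (s : Fin (m + 1) → Fin r) {ω : Ω} :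
    ω ∈ regimeEvent M T s ↔ ω ∈ stateEvent M s ∧ prefixSum (holdingTimes M m ω) m < T ∧
      T - prefixSum (holdingTimes M m ω) m ≤ censoredHolding M T m ω := by
  have key : jumpTime M ω m < (T : EReal) →
      ((T : EReal) ≤ jumpTime M ω (m + 1) ↔
        T - prefixSum (holdingTimes M m ω) m ≤ censoredHolding M T m ω) := by
    intro h1
    have h := (h1.trans (EReal.coe_lt_top T)).ne
    rw [prefixSum_holdingTimes le_rfl, censoredHolding, sub_le_sub_iff_right,
      ← EReal.coe_le_coe_iff, coe_censored hT h, le_min_iff]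
    refine ⟨fun h2 => ⟨h2, ?_⟩, fun h2 => h2.1⟩
    have := toReal_jumpTime_nonneg (M := M) ω m
    rw [← coe_toReal_jumpTime h, ← EReal.coe_add, EReal.coe_le_coe_iff]
    linarith
  have hreg : jumpTime M ω m < (T : EReal) → ∀ k : Fin (m + 1),
      regimeTime M T k ω = (jumpTime M ω k).toReal := fun h1 k =>
    regimeTime_of_lt ((jumpTime_mono ω (Nat.le_of_lt_succ k.2)).trans_lt h1)
  constructor
  · rintro ⟨h1, h2, h3⟩
    have h := (h1.trans (EReal.coe_lt_top T)).ne
    refine ⟨⟨h, fun k => ?_⟩, ?_, (key h1).1 h2⟩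
    · rw [← hreg h1]; exact h3 k
    · rw [prefixSum_holdingTimes le_rfl, ← EReal.coe_lt_coe_iff, coe_toReal_jumpTime h]
      exact h1
  · rintro ⟨⟨h, h3⟩, h1, h2⟩
    rw [prefixSum_holdingTimes le_rfl, ← EReal.coe_lt_coe_iff, coe_toReal_jumpTime h] at h1
    exact ⟨h1, (key h1).2 h2, fun k => by rw [hreg h1]; exact h3 k⟩

theorem regimeTimes_eq_partialSums {T : ℝ} {m : ℕ} {s : Fin (m + 1) → Fin r} {ω : Ω}
    (h : ω ∈ regimeEvent M T s) :
    (fun k : Fin m => regimeTime M T (k + 1) ω) = partialSums (holdingTimes M m ω) := by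
  funext k
  rw [partialSums, prefixSum_holdingTimes k.2]
  exact regimeTime_of_lt ((jumpTime_mono ω k.2).trans_lt h.1)

end holding

/-! ### The joint law of the jump times of the chain. -/

/-- The joint density of the jump times of the chain on `[0, T]`, for the states `s`. -/
def chainDensity {r : ℕ} (π : Fin r → ℝ) (q : Fin r → Fin r → ℝ) (T : ℝ) {m : ℕ}
    (s : Fin (m + 1) → Fin r) (u : Fin m → ℝ) : ℝ :=
  π (s 0) *
    (∏ k : Fin m, Real.exp (-(exitRate q (s k.castSucc) * (knot T u (k + 1) - knot T u k))) *
      q (s k.castSucc) (s k.succ)) *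
    Real.exp (-(exitRate q (s (Fin.last m)) * (T - knot T u m)))

/-- The increasing sequences of `m` times in `(0, T)`. -/
def increasingTimes (T : ℝ) (m : ℕ) : Set (Fin m → ℝ) :=
  {u | ∀ k : Fin (m + 1), knot T u k < knot T u (k + 1)}

theorem measurable_knot (T : ℝ) {m : ℕ} (k : ℕ) : Measurable fun u : Fin m → ℝ => knot T u k := by
  cases k with
  | zero => exact measurable_const
  | succ k =>
    by_cases h : k < m
    · simpa [knot, h] using measurable_pi_apply _
    · simp [knot, h]

theorem measurableSet_increasingTimes (T : ℝ) (m : ℕ) : MeasurableSet (increasingTimes T m) := by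
  have : increasingTimes T m = ⋂ k : Fin (m + 1), {u | knot T u k < knot T u (k + 1)} := by
    ext; simp [increasingTimes]
  rw [this]
  exact MeasurableSet.iInter fun k => measurableSet_lt (measurable_knot T k) (measurable_knot T _)

theorem partialSums_mem_increasingTimes_iff {T : ℝ} {m : ℕ} {x : Fin m → ℝ} :
    partialSums x ∈ increasingTimes T m ↔ (∀ k, 0 < x k) ∧ prefixSum x m < T := by
  have hlast : knot T (partialSums x) (m + 1) = T := by simp [knot]
  have hm : knot T (partialSums x) m = prefixSum x m := knot_partialSums T x le_rfl
  have hk : ∀ k : Fin m, knot T (partialSums x) k < knot T (partialSums x) (k + 1) ↔ 0 < x k := by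
    intro k
    rw [knot_partialSums T x k.2.le, knot_partialSums T x k.2, prefixSum_succ]
    exact lt_add_iff_pos_right _
  constructor
  · intro h
    refine ⟨fun k => (hk k).1 (h k.castSucc), ?_⟩
    have := h (Fin.last m)
    rwa [Fin.val_last, hlast, hm] at this
  · rintro ⟨h1, h2⟩ k
    refine Fin.lastCases ?_ (fun k => ?_) k
    · rwa [Fin.val_last, hlast, hm]
    · exact (hk k).2 (h1 k)

section law
variable {Ω : Type*} {r : ℕ} [MeasurableSpace Ω] {P : Measure Ω}
    {π : Fin r → ℝ} {q : Fin r → Fin r → ℝ} {M : ℝ → Ω → Fin r} {T : ℝ}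

theorem exitRate_nonneg (hq : ∀ i j, i ≠ j → 0 ≤ q i j) (i : Fin r) : 0 ≤ exitRate q i :=
  Finset.sum_nonneg fun j hj => hq i j (Finset.ne_of_mem_erase hj).symm

theorem rate_le_exitRate (hq : ∀ i j, i ≠ j → 0 ≤ q i j) {i j : Fin r} (hij : i ≠ j) :
    q i j ≤ exitRate q i :=
  Finset.single_le_sum (f := fun j => q i j)
    (fun k hk => hq i k (Finset.ne_of_mem_erase hk).symm)
    (Finset.mem_erase.2 ⟨hij.symm, Finset.mem_univ j⟩)

/-- The probability of the jump chain following `s`, up to the last holding time. -/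
def jumpProb (π : Fin r → ℝ) (q : Fin r → Fin r → ℝ) {m : ℕ} (s : Fin (m + 1) → Fin r) : ℝ :=
  π (s 0) * ∏ k : Fin m, q (s k.castSucc) (s k.succ) / exitRate q (s k.castSucc)

/-- The law from the definition of the chain, arranged as a product of one-dimensional tails so that
`IsMarkovChain.map_holding` can recognise a product measure. -/
theorem IsMarkovChain.measure_holding (hM : IsMarkovChain P π q M) (hπ : ∀ i, 0 ≤ π i)
    (hq : ∀ i j, i ≠ j → 0 ≤ q i j) (hT : 0 < T) {m : ℕ} {s : Fin (m + 1) → Fin r}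
    (hs : ∀ k : Fin m, s k.castSucc ≠ s k.succ) (a : Fin m → ℝ) (b : ℝ) :
    P {ω | ω ∈ stateEvent M s ∧ (∀ k, a k < holdingTimes M m ω k) ∧
        b < censoredHolding M T m ω} =
      ENNReal.ofReal (jumpProb π q s) *
        ((∏ k : Fin m, ENNReal.ofReal (Real.exp (-(exitRate q (s k.castSucc) * max (a k) 0)))) *
        (if b < T then ENNReal.ofReal (Real.exp (-(exitRate q (s (Fin.last m)) * max b 0)))
          else 0)) := by
  by_cases hb : b < T
  · let i : ℕ → Fin r := fun n => s ⟨min n m, by omega⟩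
    let g : ℕ → ℝ := fun n => if h : n < m then max (a ⟨n, h⟩) 0 else max b 0
    have hi : ∀ k : Fin (m + 1), i k = s k := fun k => by
      simp only [i]; congr 1; ext; simp [Nat.le_of_lt_succ k.2]
    have hi1 : ∀ k : Fin m, i k = s k.castSucc := fun k => hi k.castSucc
    have hi2 : ∀ k : Fin m, i (k + 1) = s k.succ := fun k => hi k.succ
    have hga : ∀ k : Fin m, g k = max (a k) 0 := fun k => by simp [g]
    have hgb : g m = max b 0 := by simp [g]
    rw [holding_event_eq hM.rightCont hT s a hb hi hga hgb, hM.law m i g, if_pos hb,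
      ← ENNReal.ofReal_prod_of_nonneg, ← ENNReal.ofReal_mul, ← ENNReal.ofReal_mul]
    · congr 1
      rw [← Fin.prod_univ_eq_prod_range (fun k => Real.exp (-(exitRate q (i k) * g k)) *
          (q (i k) (i (k + 1)) / exitRate q (i k)))]
      simp only [hi1, hi2, hga, hgb, Finset.prod_mul_distrib, jumpProb]
      rw [show i m = s (Fin.last m) from hi (Fin.last m), show i 0 = s 0 from hi 0]
      ring
    · exact mul_nonneg (hπ _) (Finset.prod_nonneg fun k _ =>
        div_nonneg (hq _ _ (hs k)) (exitRate_nonneg hq _))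
    · positivity
    · intro k _
      positivity
    · intro k
      simp only [g]
      split_ifs <;> exact le_max_right _ _
    · intro k hk
      have := hs ⟨k, hk⟩
      rwa [← hi1, ← hi2] at this
  · have : {ω | ω ∈ stateEvent M s ∧ (∀ k, a k < holdingTimes M m ω k) ∧
        b < censoredHolding M T m ω} = ∅ := by
      rw [eq_empty_iff_forall_notMem]
      rintro ω ⟨h1, _, h2⟩
      exact hb (h2.trans_le (censoredHolding_le hT h1.1))
    rw [this, if_neg hb]
    simp

theorem IsMarkovChain.pathSigma_le (hM : IsMarkovChain P π q M) :
    pathSigma M ≤ (inferInstance : MeasurableSpace Ω) :=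
  iSup_le fun t => (hM.measurable t t.2).comap_le

/-- A vanishing quotient always comes from a vanishing intensity, even when the exit rate is zero,
because a single intensity never exceeds the exit rate. -/
theorem chainDensity_eq_zero (hq : ∀ i j, i ≠ j → 0 ≤ q i j) {m : ℕ} {s : Fin (m + 1) → Fin r}
    (hs : ∀ k : Fin m, s k.castSucc ≠ s k.succ) (h0 : jumpProb π q s = 0) (u : Fin m → ℝ) :
    chainDensity π q T s u = 0 := by
  rw [jumpProb, mul_eq_zero, Finset.prod_eq_zero_iff] at h0
  rcases h0 with h0 | ⟨k, _, hk⟩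
  · simp [chainDensity, h0]
  · have hqk : q (s k.castSucc) (s k.succ) = 0 := by
      rcases div_eq_zero_iff.1 hk with hk | hk
      · exact hk
      · exact le_antisymm ((rate_le_exitRate hq (hs k)).trans hk.le) (hq _ _ (hs k))
    rw [chainDensity, Finset.prod_eq_zero (Finset.mem_univ k) (by rw [hqk, mul_zero])]
    simp

theorem measurable_chainDensity {m : ℕ} (s : Fin (m + 1) → Fin r) :
    Measurable (chainDensity π q T s) := by
  refine (measurable_const.mul (Finset.measurable_fun_prod _ fun k _ => ?_)).mul ?_
  · exact (Real.measurable_exp.comp (((measurable_knot T _).sub (measurable_knot T _)).const_mul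
      _).neg).mul_const _
  · exact Real.measurable_exp.comp ((measurable_const.sub (measurable_knot T m)).const_mul _).neg

theorem IsMarkovChain.map_holding [IsProbabilityMeasure P] (hM : IsMarkovChain P π q M) (hπ : ∀ i, 0 ≤ π i)
    (hq : ∀ i j, i ≠ j → 0 ≤ q i j) (hT : 0 < T) {m : ℕ} {s : Fin (m + 1) → Fin r}
    (hs : ∀ k : Fin m, s k.castSucc ≠ s k.succ) (hpos : ∀ k : Fin m, 0 < exitRate q (s k.castSucc))
    {ρ : Measure ℝ} [IsProbabilityMeasure ρ] (hρ : ∀ b, ρ (Ioi b) =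
      if b < T then ENNReal.ofReal (Real.exp (-(exitRate q (s (Fin.last m)) * max b 0))) else 0) :
    (P.restrict (stateEvent M s)).map (fun ω => (holdingTimes M m ω, censoredHolding M T m ω)) =
      ENNReal.ofReal (jumpProb π q s) •
        (Measure.pi fun k : Fin m => expMeasure (exitRate q (s k.castSucc))).prod ρ := by
  have hm := hM.pathSigma_le
  have hp : ∀ k : Fin m, IsProbabilityMeasure (expMeasure (exitRate q (s k.castSucc))) := fun k =>
    isProbabilityMeasure_expMeasure (hpos k)
  have hmeas : Measurable fun ω => (holdingTimes M m ω, censoredHolding M T m ω) :=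
    ((measurable_holdingTimes hM.rightCont m).mono hm le_rfl).prodMk
      ((measurable_censoredHolding hM.rightCont T m).mono hm le_rfl)
  refine measure_eq_of_Ioi fun a b => ?_
  have hS : MeasurableSet ((univ.pi fun i => Ioi (a i)) ×ˢ Ioi b) :=
    (MeasurableSet.univ_pi fun i => measurableSet_Ioi).prod measurableSet_Ioi
  rw [Measure.map_apply hmeas hS, Measure.restrict_apply (hmeas hS), Measure.smul_apply,
    Measure.prod_prod, Measure.pi_pi, hρ]
  simp only [expMeasure_Ioi (hpos _), smul_eq_mul]
  rw [← hM.measure_holding hπ hq hT hs a b]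
  congr 1
  ext ω
  simp only [mem_inter_iff, mem_preimage, mem_prod, mem_univ_pi, mem_Ioi, mem_ofPred_eq]
  tauto

/-- The joint density of the jump times of the chain. -/
theorem IsMarkovChain.measure_regimeTimes [IsProbabilityMeasure P] (hM : IsMarkovChain P π q M) (hπ : ∀ i, 0 ≤ π i)
    (hq : ∀ i j, i ≠ j → 0 ≤ q i j) (hT : 0 < T) {m : ℕ} {s : Fin (m + 1) → Fin r}
    (hs : ∀ k : Fin m, s k.castSucc ≠ s k.succ) {C : Set (Fin m → ℝ)} (hC : MeasurableSet C) :
    P {ω | ω ∈ regimeEvent M T s ∧ (fun k : Fin m => regimeTime M T (k + 1) ω) ∈ C} =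
      ∫⁻ u in C ∩ increasingTimes T m, ENNReal.ofReal (chainDensity π q T s u) := by
  have hm := hM.pathSigma_le
  have hmeas : Measurable fun ω => (holdingTimes M m ω, censoredHolding M T m ω) :=
    ((measurable_holdingTimes hM.rightCont m).mono hm le_rfl).prodMk
      ((measurable_censoredHolding hM.rightCont T m).mono hm le_rfl)
  let D : Set ((Fin m → ℝ) × ℝ) :=
    {p | partialSums p.1 ∈ C ∧ prefixSum p.1 m < T ∧ T - prefixSum p.1 m ≤ p.2}
  have hD : MeasurableSet D := by
    have h1 : Measurable fun p : (Fin m → ℝ) × ℝ => prefixSum p.1 m :=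
      (measurable_prefixSum m).comp measurable_fst
    exact ((measurable_partialSums.comp measurable_fst) hC).inter
      ((measurableSet_lt h1 measurable_const).inter
        (measurableSet_le (measurable_const.sub h1) measurable_snd))
  have hevent : {ω | ω ∈ regimeEvent M T s ∧ (fun k : Fin m => regimeTime M T (k + 1) ω) ∈ C} =
      (fun ω => (holdingTimes M m ω, censoredHolding M T m ω)) ⁻¹' D ∩ stateEvent M s := by
    ext ω
    simp only [mem_ofPred_eq, mem_inter_iff, mem_preimage, D]
    constructor
    · rintro ⟨h1, h2⟩
      rw [regimeTimes_eq_partialSums h1] at h2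
      rw [mem_regimeEvent_iff hT] at h1
      exact ⟨⟨h2, h1.2⟩, h1.1⟩
    · rintro ⟨⟨h1, h2⟩, h3⟩
      have h4 := (mem_regimeEvent_iff hT s).2 ⟨h3, h2⟩
      refine ⟨h4, ?_⟩
      rwa [regimeTimes_eq_partialSums h4]
  have hP : P {ω | ω ∈ regimeEvent M T s ∧ (fun k : Fin m => regimeTime M T (k + 1) ω) ∈ C} =
      (P.restrict (stateEvent M s)).map
        (fun ω => (holdingTimes M m ω, censoredHolding M T m ω)) D := by
    rw [Measure.map_apply hmeas hD, Measure.restrict_apply (hmeas hD), hevent]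
  have hc : 0 ≤ jumpProb π q s := mul_nonneg (hπ _) (Finset.prod_nonneg fun k _ =>
    div_nonneg (hq _ _ (hs k)) (exitRate_nonneg hq _))
  rcases hc.eq_or_lt with hc0 | hc0
  -- Thresholds `-1` impose no condition on positive holding times, so the law gives the probability
  -- of the states alone.
  · have hst : P (stateEvent M s) = 0 := by
      have h1 := hM.measure_holding hπ hq hT hs (fun _ => -1) (-1)
      rw [← hc0, ENNReal.ofReal_zero, zero_mul] at h1
      refine measure_mono_null (fun ω hω => ?_) h1
      exact ⟨hω, fun k => lt_trans (by norm_num) (holdingTimes_pos hM.rightCont hω.1 k),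
        lt_trans (by norm_num) (censoredHolding_pos hM.rightCont hT hω.1)⟩
    rw [hevent, measure_mono_null inter_subset_right hst]
    simp [chainDensity_eq_zero hq hs hc0.symm]
  have hpos : ∀ k : Fin m, 0 < exitRate q (s k.castSucc) := by
    intro k
    refine lt_of_le_of_ne (exitRate_nonneg hq _) fun h => hc0.ne' ?_
    rw [jumpProb, Finset.prod_eq_zero (Finset.mem_univ k) (by rw [← h, div_zero]), mul_zero]
  have hp : ∀ k : Fin m, IsProbabilityMeasure (expMeasure (exitRate q (s k.castSucc))) := fun k =>
    isProbabilityMeasure_expMeasure (hpos k)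
  obtain ⟨ρ, hρ1, hρ⟩ := exists_censored_exponential (exitRate_nonneg hq (s (Fin.last m))) T
  have hpdf : ∀ c : ℝ, Measurable (exponentialPDF c) := fun c =>
    (measurable_exponentialPDFReal c).ennreal_ofReal
  have hν : (Measure.pi fun k : Fin m => expMeasure (exitRate q (s k.castSucc))) =
      volume.withDensity fun x => ∏ k, exponentialPDF (exitRate q (s k.castSucc)) (x k) :=
    @pi_withDensity_fin m (fun _ => ℝ) _ (fun _ => volume) _
      (fun k => exponentialPDF (exitRate q (s k.castSucc))) (fun k => (hpdf _).aemeasurable)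
      (fun k => by have := hp k; change SigmaFinite (expMeasure _); infer_instance)
  have hF : Measurable ((C ∩ increasingTimes T m).indicator fun u =>
      ENNReal.ofReal (chainDensity π q T s u)) :=
    (measurable_chainDensity s).ennreal_ofReal.indicator
      (hC.inter (measurableSet_increasingTimes T m))
  have hprod : Measurable fun x : Fin m → ℝ =>
      ∏ k, exponentialPDF (exitRate q (s k.castSucc)) (x k) :=
    Finset.measurable_fun_prod _ fun k _ => (hpdf _).comp (measurable_pi_apply k)
  rw [hP, hM.map_holding hπ hq hT hs hpos hρ, Measure.smul_apply, Measure.prod_apply hD, hν,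
    lintegral_withDensity_eq_lintegral_mul _ hprod (measurable_measure_prodMk_left hD), smul_eq_mul,
    ← lintegral_const_mul' _ _ ENNReal.ofReal_ne_top, ← lintegral_indicator
      (hC.inter (measurableSet_increasingTimes T m)),
    ← measurePreserving_partialSums.lintegral_comp hF]
  -- The exponential density is positive at `0`, whereas increasing jump times require strictly
  -- positive holding times; the difference is null.
  have hne : ∀ᵐ x : Fin m → ℝ, ∀ k, x k ≠ 0 := by
    rw [ae_all_iff]
    exact fun k => Measure.ae_eval_ne (μ := fun _ : Fin m => (volume : Measure ℝ)) k 0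
  refine lintegral_congr_ae ?_
  filter_upwards [hne] with x hx
  simp only [Pi.mul_apply]
  by_cases hneg : ∃ k, x k < 0
  · obtain ⟨k, hk⟩ := hneg
    rw [Finset.prod_eq_zero (Finset.mem_univ k) (exponentialPDF_of_neg hk), zero_mul, mul_zero,
      indicator_of_notMem]
    intro h
    exact absurd ((partialSums_mem_increasingTimes_iff.1 h.2).1 k) hk.not_gt
  push Not at hneg
  have hxpos : ∀ k, 0 < x k := fun k => lt_of_le_of_ne (hneg k) (hx k).symm
  by_cases hmem : partialSums x ∈ C ∧ prefixSum x m < T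
  · have h1 : partialSums x ∈ C ∩ increasingTimes T m :=
      ⟨hmem.1, partialSums_mem_increasingTimes_iff.2 ⟨hxpos, hmem.2⟩⟩
    -- Given the first `m` holding times, the last one only has to survive the rest of the window,
    -- which yields the final exponential factor.
    have hsec : Prod.mk x ⁻¹' D = Ici (T - prefixSum x m) := by
      ext y
      simp [D, hmem.1, hmem.2]
    rw [indicator_of_mem h1, hsec, censored_exponential_Ici hρ (by linarith [hmem.2])
      (by linarith [prefixSum_nonneg hneg m])]
    simp only [exponentialPDF_of_nonneg (hneg _)]
    rw [← ENNReal.ofReal_prod_of_nonneg fun k _ => mul_nonneg (hpos k).le (Real.exp_nonneg _),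
      ← ENNReal.ofReal_mul (Finset.prod_nonneg fun k _ =>
        mul_nonneg (hpos k).le (Real.exp_nonneg _)), ← ENNReal.ofReal_mul hc]
    congr 1
    rw [chainDensity, jumpProb, knot_partialSums T x le_rfl]
    have hk : ∀ k : Fin m, knot T (partialSums x) (k + 1) - knot T (partialSums x) k = x k := by
      intro k
      rw [knot_partialSums T x k.2.le, knot_partialSums T x k.2, prefixSum_succ]
      ring
    simp only [hk]
    -- The rate in front of each exponential density cancels the denominator of the jump
    -- probability.
    have hjump : (∏ k : Fin m, q (s k.castSucc) (s k.succ) / exitRate q (s k.castSucc)) *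
        ∏ k : Fin m, exitRate q (s k.castSucc) * Real.exp (-(exitRate q (s k.castSucc) * x k)) =
        ∏ k : Fin m, Real.exp (-(exitRate q (s k.castSucc) * x k)) *
          q (s k.castSucc) (s k.succ) := by
      rw [← Finset.prod_mul_distrib]
      refine Finset.prod_congr rfl fun k _ => ?_
      field_simp [(hpos k).ne']
    rw [← hjump]
    ring
  · have hsec : Prod.mk x ⁻¹' D = ∅ := by
      ext y
      simp only [D, mem_preimage, mem_ofPred_eq, mem_empty_iff_false, iff_false]
      exact fun h => hmem ⟨h.1, h.2.1⟩
    rw [hsec, measure_empty, mul_zero, mul_zero, indicator_of_notMem]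
    exact fun h => hmem ⟨h.1, (partialSums_mem_increasingTimes_iff.1 h.2).2⟩

end law

/-! ### The complete likelihood. -/

section completeLaw
variable {Ω : Type*} {r : ℕ} [MeasurableSpace Ω] {P : Measure Ω}
    {π : Fin r → ℝ} {q : Fin r → Fin r → ℝ} {lam : Fin r → ℝ} {γ : ℝ → ℝ}
    {M : ℝ → Ω → Fin r} {N : ℝ → Ω → ℕ} {T : ℝ}

/-- The states, the arrival counts and the arrival times of the first `n` regimes. -/
theorem IsMMNPP.poissonAfter_regimes [IsProbabilityMeasure P] (h : IsMMNPP P π q lam γ M N)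
    (hlam : ∀ i, 0 ≤ lam i) (hγ : ∀ x, 0 ≤ x → 0 ≤ γ x) (hγi : LocallyIntegrableOn γ (Ici 0))
    (hT : 0 ≤ T) (n : ℕ) (s : Fin n → Fin r) (z : Fin n → ℕ) (B : ∀ k, Set (Fin (z k) → ℝ))
    (hB : ∀ k, MeasurableSet (B k)) :
    PoissonAfter P lam γ M N
      {ω | ∀ k : Fin n, ω ∈ regimeState M T k (s k) ∧ regimeCount M N T k ω = z k ∧
        regimeArrivals M N T k (z k) ω ∈ B k}
      (regimeTime M T n)
      (fun ω => ∏ k : Fin n, (regimeState M T k (s k)).indicator (fun ω =>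
        segmentWeight γ (lam (s k)) (z k) (B k) (regimeTime M T k ω) (regimeTime M T (k + 1) ω))
          ω) := by
  induction n with
  | zero =>
    exact (h.poissonAfter hlam hγ hγi (MMNPP.measurable_regimeTime h.chain.rightCont T 0)
      (regimeTime_nonneg hT 0)).congr (by simp) (by simp)
  | succ n ih =>
    refine ((ih (fun k => s k.castSucc) (fun k => z k.castSucc) (fun k => B k.castSucc)
      fun k => hB _).regime h hlam hγ hγi hT (s (Fin.last n)) (hB (Fin.last n))).congr ?_ ?_
    · ext ω
      simp only [mem_inter_iff, mem_ofPred_eq, Fin.forall_fin_succ', Fin.val_castSucc, Fin.val_last]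
    · intro ω
      simp only [Fin.prod_univ_castSucc, Fin.val_castSucc, Fin.val_last]

theorem regimeTime_eq_knot {Ω : Type*} {M : ℝ → Ω → Fin r} {m : ℕ} {s : Fin (m + 1) → Fin r} {ω : Ω}
    (h : ω ∈ regimeEvent M T s) (hT : 0 < T) {k : ℕ} (hk : k ≤ m + 1) :
    regimeTime M T k ω = knot T (fun k : Fin m => regimeTime M T (k + 1) ω) k := by
  cases k with
  | zero => simp [knot, regimeTime, jumpTime_zero, hT.le]
  | succ k =>
    by_cases hkm : k < m
    · simp [knot, hkm]
    · obtain rfl : k = m := by omega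
      simpa [knot] using regimeTime_of_ge h.2.1

/-- The integral of a function of the jump times, on the event that the chain visits `s`. -/
theorem IsMarkovChain.setLIntegral_regimeTimes [IsProbabilityMeasure P]
    (hM : IsMarkovChain P π q M) (hπ : ∀ i, 0 ≤ π i)
    (hq : ∀ i j, i ≠ j → 0 ≤ q i j) (hT : 0 < T) {m : ℕ} {s : Fin (m + 1) → Fin r}
    (hs : ∀ k : Fin m, s k.castSucc ≠ s k.succ) {C : Set (Fin m → ℝ)} (hC : MeasurableSet C)
    {G : (Fin m → ℝ) → ENNReal} (hG : Measurable G) :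
    ∫⁻ ω in {ω | ω ∈ regimeEvent M T s ∧ (fun k : Fin m => regimeTime M T (k + 1) ω) ∈ C},
      G (fun k : Fin m => regimeTime M T (k + 1) ω) ∂P =
    ∫⁻ u in C ∩ increasingTimes T m, ENNReal.ofReal (chainDensity π q T s u) * G u := by
  have hX : Measurable fun ω => fun k : Fin m => regimeTime M T (k + 1) ω :=
    measurable_pi_lambda _ fun k =>
      (measurable_regimeTime hM.rightCont T _).mono hM.pathSigma_le le_rfl
  have hd : Measurable fun u => ENNReal.ofReal (chainDensity π q T s u) :=
    (measurable_chainDensity s).ennreal_ofReal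
  have hlaw : (P.restrict (regimeEvent M T s)).map
      (fun ω => fun k : Fin m => regimeTime M T (k + 1) ω) =
      (volume.restrict (increasingTimes T m)).withDensity
        fun u => ENNReal.ofReal (chainDensity π q T s u) := by
    refine Measure.ext fun A hA => ?_
    rw [Measure.map_apply hX hA, Measure.restrict_apply (hX hA), withDensity_apply _ hA,
      Measure.restrict_restrict hA, ← hM.measure_regimeTimes hπ hq hT hs hA]
    congr 1
    ext ω
    simp [and_comm]
  have hset : {ω | ω ∈ regimeEvent M T s ∧ (fun k : Fin m => regimeTime M T (k + 1) ω) ∈ C} =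
      (fun ω => fun k : Fin m => regimeTime M T (k + 1) ω) ⁻¹' C ∩ regimeEvent M T s := by
    ext ω
    simp [and_comm]
  rw [hset, ← Measure.restrict_restrict (hX hC), ← setLIntegral_map hC hG hX, hlaw,
    setLIntegral_withDensity_eq_setLIntegral_mul _ hd hG hC, Measure.restrict_restrict hC]
  rfl

theorem mem_regimeState_of_mem_regimeEvent {Ω : Type*} {M : ℝ → Ω → Fin r} {m : ℕ} {s : Fin (m + 1) → Fin r} {ω : Ω}
    (h : ω ∈ regimeEvent M T s) (k : Fin (m + 1)) : ω ∈ regimeState M T k (s k) :=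
  ⟨(jumpTime_mono ω (Nat.le_of_lt_succ k.2)).trans_lt h.1, h.2.2 k⟩

theorem measurableSet_regimeEvent {Ω : Type*} {M : ℝ → Ω → Fin r}
    (hM : ∀ ω t, 0 ≤ t → ContinuousWithinAt (fun x => M x ω) (Ici t) t) (hT : 0 ≤ T) {m : ℕ}
    (s : Fin (m + 1) → Fin r) : MeasurableSet[pathSigma M] (regimeEvent M T s) := by
  have : regimeEvent M T s = {ω | (T : EReal) ≤ jumpTime M ω (m + 1)} ∩
      ⋂ k : Fin (m + 1), regimeState M T k (s k) := by
    ext ω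
    simp only [mem_inter_iff, mem_iInter]
    exact ⟨fun h => ⟨h.2.1, mem_regimeState_of_mem_regimeEvent h⟩, fun h =>
      ⟨(h.2 (Fin.last m)).1, h.1, fun k => (h.2 k).2⟩⟩
  rw [this]
  exact (measurable_jumpTime hM (m + 1) measurableSet_Ici).inter
    (MeasurableSet.iInter fun k => measurableSet_regimeState hM hT k (s k))

theorem knot_nonneg {m : ℕ} {u : Fin m → ℝ} (hu : u ∈ increasingTimes T m) {k : ℕ}
    (hk : k ≤ m + 1) : 0 ≤ knot T u k := by
  induction k with
  | zero => exact le_rfl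
  | succ k ih => exact (ih (by omega)).trans (hu ⟨k, hk⟩).le

/-- The probability of a rectangle of jump times and arrival times. -/
theorem IsMMNPP.measure_rectangle [IsProbabilityMeasure P] (h : IsMMNPP P π q lam γ M N)
    (hπ : ∀ i, 0 ≤ π i) (hq : ∀ i j, i ≠ j → 0 ≤ q i j)
    (hlam : ∀ i, 0 ≤ lam i) (hγ : ∀ x, 0 ≤ x → 0 ≤ γ x) (hγi : LocallyIntegrableOn γ (Ici 0))
    (hT : 0 < T) {m : ℕ} {s : Fin (m + 1) → Fin r} (hs : ∀ k : Fin m, s k.castSucc ≠ s k.succ)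
    {z : Fin (m + 1) → ℕ} {C : Set (Fin m → ℝ)} (hC : MeasurableSet C)
    {B : ∀ k, Set (Fin (z k) → ℝ)} (hB : ∀ k, MeasurableSet (B k)) :
    P ({ω | ω ∈ regimeEvent M T s ∧ (fun k : Fin m => regimeTime M T (k + 1) ω) ∈ C} ∩
        {ω | ∀ k : Fin (m + 1), ω ∈ regimeState M T k (s k) ∧ regimeCount M N T k ω = z k ∧
          regimeArrivals M N T k (z k) ω ∈ B k}) =
      ∫⁻ u in C ∩ increasingTimes T m, ENNReal.ofReal (chainDensity π q T s u) *
        ∏ k : Fin (m + 1), segmentWeight γ (lam (s k)) (z k) (B k) (max (knot T u k) 0)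
          (max (knot T u (k + 1)) 0) := by
  have hM := h.chain.rightCont
  have hA : MeasurableSet[pathSigma M]
      {ω | ω ∈ regimeEvent M T s ∧ (fun k : Fin m => regimeTime M T (k + 1) ω) ∈ C} := by
    have h1 := measurableSet_regimeEvent hM hT.le s
    have h2 : Measurable[pathSigma M] fun ω => fun k : Fin m => regimeTime M T (k + 1) ω :=
      @measurable_pi_lambda Ω (Fin m) (fun _ => ℝ) (pathSigma M) _ _ fun k =>
        MMNPP.measurable_regimeTime hM T _
    exact h1.inter (h2 hC)
  -- The truncations at `0` make the weight measurable in all `u`; on the actual jump times they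
  -- have no effect.
  have hG : Measurable fun u : Fin m → ℝ => ∏ k : Fin (m + 1),
      segmentWeight γ (lam (s k)) (z k) (B k) (max (knot T u k) 0) (max (knot T u (k + 1)) 0) :=
    Finset.measurable_fun_prod _ fun k _ => measurable_segmentWeight hγi _ (hB k)
      ((measurable_knot T _).max measurable_const) ((measurable_knot T _).max measurable_const)
      (fun _ => le_max_right _ _) fun _ => le_max_right _ _
  rw [(h.poissonAfter_regimes hlam hγ hγi hT.le (m + 1) s z B hB).measure_inter hA,
    ← h.chain.setLIntegral_regimeTimes hπ hq hT hs hC hG]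
  refine setLIntegral_congr_fun (h.pathSigma_le _ hA) fun ω hω => ?_
  refine Finset.prod_congr rfl fun k _ => ?_
  rw [indicator_of_mem (mem_regimeState_of_mem_regimeEvent hω.1 k),
    ← regimeTime_eq_knot hω.1 hT k.2.le, ← regimeTime_eq_knot hω.1 hT k.2,
    max_eq_left (regimeTime_nonneg hT.le _ ω), max_eq_left (regimeTime_nonneg hT.le _ ω)]

/-- The product over the regimes of the intensity measures of the arrival times. -/
theorem pi_pi_rateMeasure (hγi : LocallyIntegrableOn γ (Ici 0)) {n : ℕ} (z : Fin n → ℕ) :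
    Measure.pi (fun k => Measure.pi fun _ : Fin (z k) => rateMeasure γ) =
      volume.withDensity fun t => ∏ k, ∏ i, rateDensity γ (t k i) := by
  have hpi : ∀ k, Measure.pi (fun _ : Fin (z k) => rateMeasure γ) =
      volume.withDensity fun t => ∏ i, rateDensity γ (t i) := fun k => pi_rateMeasure hγi (z k)
  simp only [hpi]
  have hσ : ∀ k, SigmaFinite ((volume : Measure (Fin (z k) → ℝ)).withDensity
      fun t => ∏ i, rateDensity γ (t i)) := fun k => by
    rw [← hpi k]; infer_instance
  refine pi_withDensity_fin (fun k => (volume : Measure (Fin (z k) → ℝ))) _ fun k => ?_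
  exact Finset.aemeasurable_fun_prod _ fun i _ => (aemeasurable_rateDensity hγi).comp_quasiMeasurePreserving
    (Measure.quasiMeasurePreserving_eval (fun _ => volume) i)

theorem measurableSet_configurations (T : ℝ) (m : ℕ) (z : Fin (m + 1) → ℕ) :
    MeasurableSet (configurations T m z) := by
  have : configurations T m z = Prod.fst ⁻¹' increasingTimes T m ∩ ⋂ k : Fin (m + 1),
      (fun p : (Fin m → ℝ) × ((k : Fin (m + 1)) → Fin (z k) → ℝ) =>
        ((knot T p.1 k, knot T p.1 (k + 1)), p.2 k)) ⁻¹'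
      {x : (ℝ × ℝ) × (Fin (z k) → ℝ) | x.2 ∈ univ ∩ orderedTimes (z k) x.1.1 x.1.2} := by
    ext p
    simp [configurations, increasingTimes]
  rw [this]
  refine (measurable_fst (measurableSet_increasingTimes T m)).inter (MeasurableSet.iInter fun k => ?_)
  have hk : ∀ j : ℕ, Measurable fun p : (Fin m → ℝ) × ((k : Fin (m + 1)) → Fin (z k) → ℝ) =>
      knot T p.1 j := fun j => (measurable_knot T j).comp measurable_fst
  have ht : Measurable fun p : (Fin m → ℝ) × ((k : Fin (m + 1)) → Fin (z k) → ℝ) => p.2 k :=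
    (measurable_pi_apply k).comp measurable_snd
  have hm := ((hk k).prodMk (hk (k + 1))).prodMk ht
  exact hm (measurableSet_orderedTimes_prod MeasurableSet.univ)

theorem chainDensity_nonneg (hπ : ∀ i, 0 ≤ π i) (hq : ∀ i j, i ≠ j → 0 ≤ q i j) {m : ℕ}
    {s : Fin (m + 1) → Fin r} (hs : ∀ k : Fin m, s k.castSucc ≠ s k.succ) (u : Fin m → ℝ) :
    0 ≤ chainDensity π q T s u :=
  mul_nonneg (mul_nonneg (hπ _) (Finset.prod_nonneg fun k _ =>
    mul_nonneg (Real.exp_nonneg _) (hq _ _ (hs k)))) (Real.exp_nonneg _)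

/-- The factors `γ(t)` are separated from a function of the jump times alone, so that they can be
absorbed into the reference measure. -/
theorem ofReal_completeLikelihood (hπ : ∀ i, 0 ≤ π i) (hq : ∀ i j, i ≠ j → 0 ≤ q i j)
    (hlam : ∀ i, 0 ≤ lam i) (hγ : ∀ x, 0 ≤ x → 0 ≤ γ x) {m : ℕ} {s : Fin (m + 1) → Fin r}
    (hs : ∀ k : Fin m, s k.castSucc ≠ s k.succ) {z : Fin (m + 1) → ℕ}
    {p : (Fin m → ℝ) × ((k : Fin (m + 1)) → Fin (z k) → ℝ)} (hp : p ∈ configurations T m z) :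
    ENNReal.ofReal (completeLikelihood π q lam γ T s z p.1 p.2) =
      (∏ k, ∏ i, rateDensity γ (p.2 k i)) * (ENNReal.ofReal (chainDensity π q T s p.1) *
        ∏ k : Fin (m + 1), ENNReal.ofReal (Real.exp (-(lam (s k) *
          ∫ x in (max (knot T p.1 k) 0)..(max (knot T p.1 (k + 1)) 0), γ x)) * lam (s k) ^ z k)) := by
  have ht : ∀ k i, 0 ≤ p.2 k i := fun k i =>
    (knot_nonneg hp.1 k.2.le).trans ((hp.2 k).2 i).1.le
  have hprod : ∀ k, 0 ≤ ∏ i, γ (p.2 k i) := fun k => Finset.prod_nonneg fun i _ => hγ _ (ht k i)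
  have hw : ∀ k : Fin (m + 1), 0 ≤ lam (s k) ^ z k *
      Real.exp (-∫ x in (knot T p.1 k)..(knot T p.1 (k + 1)), lam (s k) * γ x) := fun k =>
    mul_nonneg (pow_nonneg (hlam _) _) (Real.exp_nonneg _)
  change ENNReal.ofReal (chainDensity π q T s p.1 * _) = _
  rw [ENNReal.ofReal_mul (chainDensity_nonneg hπ hq hs _),
    ENNReal.ofReal_prod_of_nonneg fun k _ => mul_nonneg (hw k) (hprod k), mul_left_comm,
    ← Finset.prod_mul_distrib]
  congr 1
  refine Finset.prod_congr rfl fun k _ => ?_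
  rw [ENNReal.ofReal_mul (hw k), ENNReal.ofReal_prod_of_nonneg fun i _ => hγ _ (ht k i),
    max_eq_left (knot_nonneg hp.1 k.2.le), max_eq_left (knot_nonneg hp.1 k.2),
    intervalIntegral.integral_const_mul, mul_comm (lam (s k) ^ z k), mul_comm]
  congr 1
  refine Finset.prod_congr rfl fun i _ => ?_
  rw [rateDensity, indicator_of_mem (mem_Ici.2 (ht k i))]

/-- Tonelli's theorem: with `γ` absorbed into the measure, the integrand depends on the jump times
only. For fixed jump times the admissible arrival times form a product of truncated simplices, whose
masses complete the segment weights. -/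
theorem setLIntegral_completeLikelihood (hπ : ∀ i, 0 ≤ π i) (hq : ∀ i j, i ≠ j → 0 ≤ q i j)
    (hlam : ∀ i, 0 ≤ lam i) (hγ : ∀ x, 0 ≤ x → 0 ≤ γ x) (hγi : LocallyIntegrableOn γ (Ici 0))
    {m : ℕ} {s : Fin (m + 1) → Fin r} (hs : ∀ k : Fin m, s k.castSucc ≠ s k.succ)
    {z : Fin (m + 1) → ℕ} {C : Set (Fin m → ℝ)} (hC : MeasurableSet C)
    {B : ∀ k, Set (Fin (z k) → ℝ)} (hB : ∀ k, MeasurableSet (B k)) :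
    ∫⁻ p in (C ×ˢ univ.pi B) ∩ configurations T m z,
        ENNReal.ofReal (completeLikelihood π q lam γ T s z p.1 p.2) =
      ∫⁻ u in C ∩ increasingTimes T m, ENNReal.ofReal (chainDensity π q T s u) *
        ∏ k : Fin (m + 1), segmentWeight γ (lam (s k)) (z k) (B k) (max (knot T u k) 0)
          (max (knot T u (k + 1)) 0) := by
  set S := (C ×ˢ univ.pi B) ∩ configurations T m z with hSdef
  have hS : MeasurableSet S :=
    (hC.prod (MeasurableSet.univ_pi hB)).inter (measurableSet_configurations T m z)
  let W : ((k : Fin (m + 1)) → Fin (z k) → ℝ) → ENNReal := fun t => ∏ k, ∏ i, rateDensity γ (t k i)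
  let H : (Fin m → ℝ) → ENNReal := fun u => ENNReal.ofReal (chainDensity π q T s u) *
    ∏ k : Fin (m + 1), ENNReal.ofReal (Real.exp (-(lam (s k) *
      ∫ x in (max (knot T u k) 0)..(max (knot T u (k + 1)) 0), γ x)) * lam (s k) ^ z k)
  have hH : Measurable H := by
    refine (measurable_chainDensity s).ennreal_ofReal.mul (Finset.measurable_fun_prod _ fun k _ => ?_)
    have h1 := (measurable_integral_rate hγi).comp
      ((measurable_knot (m := m) T k).prodMk (measurable_knot T (k + 1)))
    exact ((Real.measurable_exp.comp (h1.const_mul (lam (s k))).neg).mul_const _).ennreal_ofReal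
  have hW : AEMeasurable W volume := by
    refine Finset.aemeasurable_fun_prod _ fun k _ => Finset.aemeasurable_fun_prod _ fun i _ => ?_
    exact (aemeasurable_rateDensity hγi).comp_quasiMeasurePreserving
      ((Measure.quasiMeasurePreserving_eval (fun _ => volume) i).comp
        (Measure.quasiMeasurePreserving_eval
          (fun k => (volume : Measure (Fin (z k) → ℝ))) k))
  have hsec : ∀ u, (∫⁻ t, S.indicator (fun p => H p.1) (u, t)
      ∂Measure.pi (fun k => Measure.pi fun _ : Fin (z k) => rateMeasure γ)) =
      (C ∩ increasingTimes T m).indicator (fun u => ENNReal.ofReal (chainDensity π q T s u) *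
        ∏ k : Fin (m + 1), segmentWeight γ (lam (s k)) (z k) (B k) (max (knot T u k) 0)
          (max (knot T u (k + 1)) 0)) u := by
    intro u
    by_cases hu : u ∈ C ∩ increasingTimes T m
    · have hind : ∀ t, S.indicator (fun p => H p.1) (u, t) = (univ.pi fun k : Fin (m + 1) =>
          B k ∩ orderedTimes (z k) (knot T u k) (knot T u (k + 1))).indicator (fun _ => H u) t := by
        intro t
        refine indicator_eq_indicator ?_ rfl
        simp only [S, configurations, mem_inter_iff, mem_prod, mem_univ_pi, mem_ofPred_eq, hu.1,
          true_and, forall_and]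
        exact and_congr_right fun _ => and_iff_right hu.2
      have hm : MeasurableSet (univ.pi fun k : Fin (m + 1) =>
          B k ∩ orderedTimes (z k) (knot T u k) (knot T u (k + 1))) :=
        MeasurableSet.univ_pi fun k => (hB k).inter (measurableSet_orderedTimes _ _ _)
      rw [lintegral_congr hind, lintegral_indicator_const hm, Measure.pi_pi, indicator_of_mem hu]
      simp only [H]
      rw [mul_assoc, ← Finset.prod_mul_distrib]
      congr 1
      refine Finset.prod_congr rfl fun k _ => ?_
      rw [segmentWeight, max_eq_left (knot_nonneg hu.2 k.2.le), max_eq_left (knot_nonneg hu.2 k.2)]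
    · have hind : ∀ t, S.indicator (fun p => H p.1) (u, t) = 0 := fun t =>
        indicator_of_notMem (fun h => hu ⟨h.1.1, h.2.1⟩) _
      rw [lintegral_congr hind, indicator_of_notMem hu, lintegral_zero]
  have hW2 : AEMeasurable (fun p : (Fin m → ℝ) × ((k : Fin (m + 1)) → Fin (z k) → ℝ) => W p.2)
      volume := hW.comp_snd
  calc ∫⁻ p in S, ENNReal.ofReal (completeLikelihood π q lam γ T s z p.1 p.2)
      = ∫⁻ p in S, W p.2 * H p.1 := setLIntegral_congr_fun hS fun p hp =>
        ofReal_completeLikelihood hπ hq hlam hγ hs hp.2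
    _ = ∫⁻ p in S, H p.1 ∂(volume.withDensity fun p => W p.2) :=
        (setLIntegral_withDensity_eq_lintegral_mul₀ hW2 (hH.comp measurable_fst).aemeasurable
          hS).symm
    _ = ∫⁻ p, S.indicator (fun p => H p.1) p ∂(volume.prod
          (Measure.pi fun k => Measure.pi fun _ : Fin (z k) => rateMeasure γ)) := by
        rw [pi_pi_rateMeasure hγi z, prod_withDensity_right₀ hW, lintegral_indicator hS]
        rfl
    _ = _ := by
        rw [lintegral_prod (S.indicator fun p => H p.1)
            ((hH.comp measurable_fst).indicator hS).aemeasurable, lintegral_congr hsec,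
          lintegral_indicator (hC.inter (measurableSet_increasingTimes T m))]

/-- The complete likelihood of a Markov-modulated non-homogeneous Poisson process. -/
theorem IsMMNPP.measure_complete [IsProbabilityMeasure P] (h : IsMMNPP P π q lam γ M N)
    (hπ : ∀ i, 0 ≤ π i) (hq : ∀ i j, i ≠ j → 0 ≤ q i j)
    (hlam : ∀ i, 0 ≤ lam i) (hγ : ∀ x, 0 ≤ x → 0 ≤ γ x) (hγi : LocallyIntegrableOn γ (Ici 0))
    (hT : 0 < T) {m : ℕ} {s : Fin (m + 1) → Fin r} (hs : ∀ k : Fin m, s k.castSucc ≠ s k.succ)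
    (z : Fin (m + 1) → ℕ) {D : Set ((Fin m → ℝ) × ((k : Fin (m + 1)) → Fin (z k) → ℝ))}
    (hD : MeasurableSet D) :
    P {ω | jumpTime M ω m < (T : EReal) ∧ (T : EReal) ≤ jumpTime M ω (m + 1) ∧
        (∀ k : Fin (m + 1), M (regimeTime M T k ω) ω = s k) ∧
        (∀ k : Fin (m + 1), regimeCount M N T k ω = z k) ∧
        ((fun k : Fin m => regimeTime M T (k + 1) ω),
          (fun k : Fin (m + 1) => regimeArrivals M N T k (z k) ω)) ∈ D} =
      ∫⁻ p in D ∩ configurations T m z,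
        ENNReal.ofReal (completeLikelihood π q lam γ T s z p.1 p.2) := by
  let Y : Ω → (Fin m → ℝ) × ((k : Fin (m + 1)) → Fin (z k) → ℝ) := fun ω =>
    ((fun k : Fin m => regimeTime M T (k + 1) ω),
      (fun k : Fin (m + 1) => regimeArrivals M N T k (z k) ω))
  let Q : Set Ω := {ω | ω ∈ regimeEvent M T s ∧ ∀ k : Fin (m + 1), regimeCount M N T k ω = z k}
  have hY : Measurable Y := (measurable_pi_lambda _ fun k => h.measurable_regimeTime T _).prodMk
    (measurable_pi_lambda _ fun k => h.measurable_regimeArrivals hT.le k (z k))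
  let ν : Measure ((Fin m → ℝ) × ((k : Fin (m + 1)) → Fin (z k) → ℝ)) :=
    (volume.restrict (configurations T m z)).withDensity fun p =>
      ENNReal.ofReal (completeLikelihood π q lam γ T s z p.1 p.2)
  have hν : ∀ D, MeasurableSet D → ν D = ∫⁻ p in D ∩ configurations T m z,
      ENNReal.ofReal (completeLikelihood π q lam γ T s z p.1 p.2) := fun D hD => by
    rw [withDensity_apply _ hD, Measure.restrict_restrict hD]
  have hrect : ∀ {C : Set (Fin m → ℝ)}, MeasurableSet C → ∀ {B : ∀ k, Set (Fin (z k) → ℝ)},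
      (∀ k, MeasurableSet (B k)) → (P.restrict Q).map Y (C ×ˢ univ.pi B) = ν (C ×ˢ univ.pi B) := by
    intro C hC B hB
    have hCB := hC.prod (MeasurableSet.univ_pi hB)
    rw [hν _ hCB, setLIntegral_completeLikelihood hπ hq hlam hγ hγi hs hC hB,
      ← h.measure_rectangle hπ hq hlam hγ hγi hT hs hC hB, Measure.map_apply hY hCB,
      Measure.restrict_apply (hY hCB)]
    congr 1
    ext ω
    simp only [Q, Y, mem_inter_iff, mem_preimage, mem_prod, mem_univ_pi, mem_ofPred_eq, forall_and]
    constructor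
    · rintro ⟨⟨h1, h2⟩, h3, h4⟩
      exact ⟨⟨h3, h1⟩, mem_regimeState_of_mem_regimeEvent h3, h4, h2⟩
    · rintro ⟨⟨h3, h1⟩, -, h4, h2⟩
      exact ⟨⟨h1, h2⟩, h3, h4⟩
  -- Rectangles form a generating π-system, and the full rectangle provides the equality of total
  -- masses.
  have heq : (P.restrict Q).map Y = ν := by
    refine ext_of_generate_finite _ (generateFrom_eq_prod
      (@MeasurableSpace.generateFrom_measurableSet _ MeasurableSpace.pi) generateFrom_pi
      isCountablySpanning_measurableSet
      (IsCountablySpanning.pi fun _ => isCountablySpanning_measurableSet)).symm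
      (MeasurableSpace.isPiSystem_measurableSet.prod isPiSystem_pi) ?_ ?_
    · rintro _ ⟨C, hC, _, ⟨B, hB, rfl⟩, rfl⟩
      exact hrect hC fun k => hB k trivial
    · have := hrect MeasurableSet.univ (B := fun _ => univ) fun _ => MeasurableSet.univ
      rwa [pi_univ, univ_prod_univ] at this
  rw [← hν D hD, ← heq, Measure.map_apply hY hD, Measure.restrict_apply (hY hD)]
  congr 1
  ext ω
  simp only [Q, Y, regimeEvent, mem_inter_iff, mem_preimage, mem_ofPred_eq]
  tauto

end completeLaw

end MMNPP

end

theorem lemma3 {Ω : Type*} [MeasurableSpace Ω] (P : Measure Ω) [IsProbabilityMeasure P]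
    {r : ℕ} (π : Fin r → ℝ) (q : Fin r → Fin r → ℝ) (lam : Fin r → ℝ) (γ : ℝ → ℝ)
    (M : ℝ → Ω → Fin r) (N : ℝ → Ω → ℕ)
    (hπ : π ∈ stdSimplex ℝ (Fin r)) (hq : ∀ i j, i ≠ j → 0 ≤ q i j) (hlam : ∀ i, 0 ≤ lam i)
    (hγ : ∀ x, 0 ≤ x → 0 ≤ γ x) (hγi : LocallyIntegrableOn γ (Ici 0))
    (h : MMNPP.IsMMNPP P π q lam γ M N) :
    -- a fixed interval, given that the chain stays in state `s` on it and that it has `z` arrivals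
    (∀ (a b : ℝ) (s : Fin r) (z : ℕ), 0 ≤ a → a < b →
      P ({ω | ∀ x ∈ Ico a b, M x ω = s} ∩ {ω | N b ω - N a ω = z}) ≠ 0 →
      ∀ B : Set (Fin z → ℝ), MeasurableSet B →
        P[{ω | MMNPP.arrivals N a z ω ∈ B} |
            {ω | ∀ x ∈ Ico a b, M x ω = s} ∩ {ω | N b ω - N a ω = z}] =
          ∫⁻ t in B ∩ MMNPP.orderedTimes z a b, ENNReal.ofReal (MMNPP.arrivalDensity γ a b z t)) ∧
    -- the `k`-th regime interval (random), given the path of the chain and the number of arrivals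
    (∀ (T : ℝ), 0 < T → ∀ (k z : ℕ) (B : Set (Fin z → ℝ)), MeasurableSet B →
      ∀ᵐ ω ∂P, MMNPP.jumpTime M ω k < (T : EReal) → MMNPP.regimeCount M N T k ω = z →
        (P⟦{ω' | MMNPP.regimeArrivals M N T k z ω' ∈ B} |
            MMNPP.pathSigma M ⊔ MeasurableSpace.comap (MMNPP.regimeCount M N T k) ⊤⟧) ω =
          ∫ t in B ∩ MMNPP.orderedTimes z (MMNPP.regimeTime M T k ω)
              (MMNPP.regimeTime M T (k + 1) ω),
            MMNPP.arrivalDensity γ (MMNPP.regimeTime M T k ω)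
              (MMNPP.regimeTime M T (k + 1) ω) z t) ∧
    -- the complete likelihood on `[0, T]`
    (∀ (T : ℝ), 0 < T → ∀ (m : ℕ) (s : Fin (m + 1) → Fin r) (z : Fin (m + 1) → ℕ),
      (∀ k : Fin m, s k.castSucc ≠ s k.succ) →
      ∀ D : Set ((Fin m → ℝ) × ((k : Fin (m + 1)) → Fin (z k) → ℝ)), MeasurableSet D →
        P {ω | MMNPP.jumpTime M ω m < (T : EReal) ∧ (T : EReal) ≤ MMNPP.jumpTime M ω (m + 1) ∧
            (∀ k : Fin (m + 1), M (MMNPP.regimeTime M T k ω) ω = s k) ∧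
            (∀ k : Fin (m + 1), MMNPP.regimeCount M N T k ω = z k) ∧
            ((fun k : Fin m => MMNPP.regimeTime M T (k + 1) ω),
              (fun k : Fin (m + 1) => MMNPP.regimeArrivals M N T k (z k) ω)) ∈ D} =
          ∫⁻ p in D ∩ MMNPP.configurations T m z,
            ENNReal.ofReal (MMNPP.completeLikelihood π q lam γ T s z p.1 p.2)) :=
  ⟨fun _ _ _ _ ha hab hpos _ hB => h.cond_arrivals hlam hγ hγi ha hab hpos hB,
    fun _ hT k z _ hB => h.condExp_regimeArrivals hlam hγ hγi hT.le k z hB,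
    fun _ hT _ _ z hs _ hD => h.measure_complete hπ.1 hq hlam hγ hγi hT hs z hD⟩
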